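/- Let $\gamma_1$ be the standard Gaussian measure on $\mathbb R$ and $\gamma_2=\gamma_1\otimes\gamma_1$ the standard Gaussian measure on $\mathbb R^2$. For an open set $\Omega\subset\mathbb R^2$ let $H^1(\Omega,d\gamma_2)$ be the space of functions $u\in L^2(\Omega,d\gamma_2)$ with weak partial derivatives in $L^2(\Omega,d\gamma_2)$, and similarly $H^1((\alpha,\beta),d\gamma_1)$. A real number $\mu$ is a Neumann eigenvalue of the Hermite operator $-\Delta u+(x,y)\cdot\nabla u$ in $\Omega$, with eigenfunction $u\in H^1(\Omega,d\gamma_2)\setminus\{0\}$, if $$\int_\Omega \nabla u\cdot\nabla v\,d\gamma_2=\mu\int_\Omega u\,v\,d\gamma_2\qquad\text{for all } v\in H^1(\Omega,d\gamma_2);$$ the Neumann eigenvalues of the one-dimensional operator $-v''+xv'$ in an interval $(\alpha,\beta)$ are defined in the same way. For $\Omega$ symmetric with respect to the $y$-axis, $\mu_1^{odd}(\Omega)$ denotes the lowest Neumann eigenvalue that has an eigenfunction odd in $x$, i.e. $u(-x,y)=-u(x,y)$ for almost every $(x,y)\in\Omega$. For $a>0$ let $$\mu_1(-a,a)=\min\left\{\frac{\int_{-a}^a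 (z')^2\,d\gamma_1}{\int_{-a}^a z^2\,d\gamma_1}\;:\; z\in H^1((-a,a),d\gamma_1)\setminus\{0\},\ \int_{-a}^a z\,d\gamma_1=0\right\}.$$ **Theorem.** Let $a>0$. The minimum $\mu_1(-a,a)$ is attained, and it is the first nontrivial (i.e. smallest nonzero) Neumann eigenvalue of the one-dimensional Hermite operator $-v''+xv'$ in $(-a,a)$. Let $\Omega\subset\mathbb R^2$ be a (nonempty, open) bounded convex domain, symmetric with respect to the $y$-axis, and let $p,-q:(-a,a)\to\mathbb R$ be concave, even functions such that $$\Omega=\{(x,y)\in\mathbb R^2:\ -a<x<a,\ q(x)<y<p(x)\}.$$ Then the lowest eigenvalue $\mu_1^{odd}(\Omega)$ exists and $$\mu_1^{odd}(\Omega)\ \ge\ \mu_1(-a,a).$$ Moreover, equality holds for every rectangle $\Omega=(-a,a)\times(-b,b)$ with $b>0$. -/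

import Mathlib

open MeasureTheory ProbabilityTheory Set
open scoped ContDiff

/-- `g` is the weak derivative of `u` in the direction `e` on the open set `Ω`
(with respect to Lebesgue measure, tested against smooth functions with compact support in `Ω`). -/
def HasWeakDirDeriv {E : Type*} [NormedAddCommGroup E] [NormedSpace ℝ E] [MeasureSpace E]
    (Ω : Set E) (e : E) (u g : E → ℝ) : Prop :=
  ∀ φ : E → ℝ, ContDiff ℝ ∞ φ → HasCompactSupport φ → tsupport φ ⊆ Ω →
    ∫ z in Ω, u z * fderiv ℝ φ z e = - ∫ z in Ω, g z * φ z

/-- The one-dimensional standard Gaussian measure `dγ_x`. -/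
noncomputable def gamma1 : Measure ℝ := gaussianReal 0 1

/-- The two-dimensional standard Gaussian measure `dγ₂ = dγ_x ⊗ dγ_y`. -/
noncomputable def gamma2 : Measure (ℝ × ℝ) := gamma1.prod gamma1

/-- `z` belongs to the Gaussian Sobolev space `H¹((a,b), dγ_x)`, with weak derivative `dz`. -/
structure IsH1Interval (a b : ℝ) (z dz : ℝ → ℝ) : Prop where
  memLp : MemLp z 2 (gamma1.restrict (Ioo a b))
  memLp_deriv : MemLp dz 2 (gamma1.restrict (Ioo a b))
  weakDeriv : HasWeakDirDeriv (Ioo a b) 1 z dz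

/-- `u` belongs to the Gaussian Sobolev space `H¹(Ω, dγ₂)`, with weak partial derivatives
`ux` and `uy`. -/
structure IsH1Planar (Ω : Set (ℝ × ℝ)) (u ux uy : ℝ × ℝ → ℝ) : Prop where
  memLp : MemLp u 2 (gamma2.restrict Ω)
  memLp_x : MemLp ux 2 (gamma2.restrict Ω)
  memLp_y : MemLp uy 2 (gamma2.restrict Ω)
  weakDeriv_x : HasWeakDirDeriv Ω (1, 0) u ux
  weakDeriv_y : HasWeakDirDeriv Ω (0, 1) u uy

/-- The values of the Rayleigh quotient `∫ (z')² dγ_x / ∫ z² dγ_x` on the nonzero functions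
`z ∈ H¹((a,b), dγ_x)` with `∫ z dγ_x = 0`. -/
def rayleighQuotients (a b : ℝ) : Set ℝ :=
  {r | ∃ z dz : ℝ → ℝ, IsH1Interval a b z dz ∧
    ¬ (∀ᵐ x ∂(gamma1.restrict (Ioo a b)), z x = 0) ∧
    ∫ x in Ioo a b, z x ∂gamma1 = 0 ∧
    r = (∫ x in Ioo a b, dz x ^ 2 ∂gamma1) / ∫ x in Ioo a b, z x ^ 2 ∂gamma1}

/-- The number `μ₁(a,b)`: the least value of the Rayleigh quotient over functions of mean zero. -/
noncomputable def mu1 (a b : ℝ) : ℝ := sInf (rayleighQuotients a b)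

/-- `μ` is an eigenvalue of `-v'' + x v' = μ v` in `(a,b)` with `v'(a) = v'(b) = 0`
(weak formulation). -/
def IsNeumannEigenvalueInterval (a b μ : ℝ) : Prop :=
  ∃ v dv : ℝ → ℝ, IsH1Interval a b v dv ∧
    ¬ (∀ᵐ x ∂(gamma1.restrict (Ioo a b)), v x = 0) ∧
    ∀ w dw : ℝ → ℝ, IsH1Interval a b w dw →
      ∫ x in Ioo a b, dv x * dw x ∂gamma1 = μ * ∫ x in Ioo a b, v x * w x ∂gamma1

/-- `u` is an eigenfunction, with eigenvalue `μ`, of the Neumann problem for the Hermite operator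
`-Δu + (x,y) · ∇u = μ u` in `Ω` (weak formulation). -/
def IsNeumannEigenfunction (Ω : Set (ℝ × ℝ)) (μ : ℝ) (u : ℝ × ℝ → ℝ) : Prop :=
  ∃ ux uy : ℝ × ℝ → ℝ, IsH1Planar Ω u ux uy ∧
    ¬ (∀ᵐ z ∂(gamma2.restrict Ω), u z = 0) ∧
    ∀ v vx vy : ℝ × ℝ → ℝ, IsH1Planar Ω v vx vy →
      ∫ z in Ω, (ux z * vx z + uy z * vy z) ∂gamma2 = μ * ∫ z in Ω, u z * v z ∂gamma2

/-- The Neumann eigenvalues of the Hermite operator in `Ω` having an eigenfunction that is odd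
with respect to the `y`-axis. -/
def oddNeumannEigenvalues (Ω : Set (ℝ × ℝ)) : Set ℝ :=
  {μ | ∃ u : ℝ × ℝ → ℝ, IsNeumannEigenfunction Ω μ u ∧
    ∀ᵐ z ∂(gamma2.restrict Ω), u (-z.1, z.2) = - u z}

/-- `μ₁^odd(Ω)`: the lowest Neumann eigenvalue with an odd eigenfunction. -/
noncomputable def mu1Odd (Ω : Set (ℝ × ℝ)) : ℝ := sInf (oddNeumannEigenvalues Ω)

/-! Everything rests on one number `m`, the least Rayleigh quotient of odd functions on `(-a, a)`.
The direct method shows that it is attained by an odd eigenfunction and is positive, since an odd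
constant vanishes (`exists_odd_eigenfunction_interval`).

The inequality behind `m` localises. If `f 0 = 0` and `0 < l ≤ a`, extend `f` from `[0, l]` by the
constant `f l` and reflect oddly: the Dirichlet integral gains nothing, while the integral of the
square can only grow. Hence `m ∫ f² ≤ ∫ f'²` already on `(0, l)`
(`OddPoincare.integral_Ioo_zero_le`). Applying this to both halves of `f - f 0` gives `m ∫ (f - f
0)² ≤ ∫ f'²` on `(-l, l)`, without any parity assumption (`OddPoincare.integral_Ioo_sub_le`). Two
consequences follow.

For `l = a`, the mean is the constant that minimises the squared distance to `f`, so the inequality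
holds with constant `m` for every function of mean zero. The odd eigenfunction has mean zero and
gives equality, so `m = μ₁(-a, a)`; as a nonconstant eigenfunction has mean zero, `m` is also the
first nonzero eigenvalue.

In the plane, convexity and symmetry make each horizontal slice of `Ω` an interval `(-l, l)` with `l
≤ a`, and an odd smooth function vanishes where the slice meets the axis. Integrating the slice
inequalities in `y` bounds `m ∫ u²` by the integral of `(∂u/∂x)²` alone
(`OddPoincare.integral_planar_le`), so an odd eigenvalue is at least `m`. On a rectangle the
one-dimensional eigenfunction, taken constant in `y`, is admissible and attains `m`.

The analytic input is Sobolev theory on a bounded convex `Ω`. Instead of extending functions beyond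
the boundary, one averages `u` over contractions `z ↦ (1 - t) z + t s` towards points `s` of a
compact subset of `Ω`. Convexity keeps these points inside `Ω`, so weak derivatives commute with the
averages up to the factor `1 - t`, on all of `Ω`. This gives density of smooth functions
(`IsMollifier.exists_smooth_approximation`) and Rellich compactness
(`exists_subseq_tendsto_of_isWeakGradient`). Compactness feeds an abstract minimisation result
(`exists_rayleigh_minimizer`), applied to odd functions in both dimensions at once through
`IsReflectionDomain`. -/

open Filter Topology Convolution

set_option linter.unusedSectionVars false

/-- Jensen's inequality for the square in extended nonnegative reals. -/
theorem lintegral_sq_le_of_isProbabilityMeasure {A : Type*} [MeasurableSpace A] (Q : Measure A)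
    [IsProbabilityMeasure Q] {F : A → ENNReal} (hF : AEMeasurable F Q) :
    (∫⁻ x, F x ∂Q) ^ 2 ≤ ∫⁻ x, F x ^ 2 ∂Q := by
  have h := ENNReal.lintegral_mul_le_Lp_mul_Lq Q (p := 2) (q := 2)
    (Real.HolderConjugate.two_two) hF (aemeasurable_const (b := (1 : ENNReal)))
  simp only [Pi.mul_apply, mul_one, ENNReal.one_rpow, lintegral_const, measure_univ] at h
  calc (∫⁻ x, F x ∂Q) ^ 2 ≤ ((∫⁻ x, F x ^ (2 : ℝ) ∂Q) ^ (1 / 2 : ℝ)) ^ 2 := by gcongr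
    _ = ∫⁻ x, F x ^ 2 ∂Q := by
        rw [← ENNReal.rpow_natCast, ← ENNReal.rpow_mul]
        norm_num

/-! ### Contraction averages: smoothing up to the boundary of a convex set -/

section Mollifier

variable {E : Type*} [NormedAddCommGroup E] [NormedSpace ℝ E] [FiniteDimensional ℝ E]
  [MeasureSpace E] [BorelSpace E] [(volume : Measure E).IsAddHaarMeasure]

open Module in
theorem lintegral_comp_homothety (F : E → ENNReal) {r : ℝ} (hr : 0 < r) (c : E) :
    ∫⁻ z, F (r • z + c) = ENNReal.ofReal ((r ^ finrank ℝ E)⁻¹) * ∫⁻ z, F z := by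
  have h1 : ∫⁻ z, F (r • z + c) = ∫⁻ z, (fun w => F (w + c)) z ∂(Measure.map (r • ·) volume) :=
    ((Homeomorph.smulOfNeZero r hr.ne').measurableEmbedding.lintegral_map
      (fun w => F (w + c))).symm
  rw [h1, Measure.map_addHaar_smul _ hr.ne', lintegral_smul_measure,
    lintegral_add_right_eq_self, abs_of_pos (by positivity)]
  rfl

open Module in
/-- Averages of a function over contractions with ratio at least `1/2` are bounded in `L²`. -/
theorem lintegral_sq_average_le {A : Type*} [MeasurableSpace A] (Q : Measure A)
    [IsProbabilityMeasure Q] {F : E → ENNReal} (hF : Measurable F) {r : A → ℝ} {s : A → E}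
    (hr : Measurable r) (hs : Measurable s) (hr2 : ∀ x, r x ≤ 1 / 2) :
    ∫⁻ z : E, (∫⁻ x, F ((1 - r x) • z + r x • s x) ∂Q) ^ 2 ≤
      2 ^ finrank ℝ E * ∫⁻ z, F z ^ 2 := by
  have hmeas : Measurable fun p : E × A => F ((1 - r p.2) • p.1 + r p.2 • s p.2) := by
    fun_prop
  calc ∫⁻ z : E, (∫⁻ x, F ((1 - r x) • z + r x • s x) ∂Q) ^ 2
      ≤ ∫⁻ z, ∫⁻ x, F ((1 - r x) • z + r x • s x) ^ 2 ∂Q := by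
        refine lintegral_mono fun z => lintegral_sq_le_of_isProbabilityMeasure Q ?_
        exact (hmeas.comp (measurable_const.prodMk measurable_id)).aemeasurable
    _ = ∫⁻ x, (∫⁻ z : E, F ((1 - r x) • z + r x • s x) ^ 2) ∂Q := by
        rw [lintegral_lintegral_swap]
        exact (hmeas.pow_const 2).aemeasurable
    _ ≤ ∫⁻ _, (2 ^ finrank ℝ E * ∫⁻ z, F z ^ 2) ∂Q := by
        refine lintegral_mono fun x => ?_
        -- The change of variables costs the Jacobian `(1 - r)⁻ᵈ`, which is at most `2ᵈ` because `r
        -- ≤ 1/2`.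
        have hpos : (1 / 2 : ℝ) ≤ 1 - r x := by linarith [hr2 x]
        rw [lintegral_comp_homothety (fun z => F z ^ 2) (by linarith : 0 < 1 - r x)]
        gcongr
        rw [ENNReal.ofReal_le_iff_le_toReal (by simp)]
        simp only [ENNReal.toReal_pow, ENNReal.toReal_ofNat]
        rw [← inv_pow]
        have : (1 - r x)⁻¹ ≤ 2 := by
          rw [inv_le_comm₀ (by linarith) (by norm_num)]; linarith
        have h0 : 0 ≤ (1 - r x)⁻¹ := inv_nonneg.2 (by linarith)
        gcongr
    _ = _ := by simp

/-- The average of `u` over the contractions `z ↦ (1 - t) z + t s` with weight `η s`. -/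
noncomputable def contractionAverage (η u : E → ℝ) (t : ℝ) (z : E) : ℝ :=
  ∫ s, η s * u ((1 - t) • z + t • s)

/-- A smooth probability density with compact support inside `Ω`. -/
structure IsMollifier (Ω : Set E) (η : E → ℝ) : Prop where
  contDiff : ContDiff ℝ ∞ η
  hasCompactSupport : HasCompactSupport η
  tsupport_subset : tsupport η ⊆ Ω
  nonneg : ∀ s, 0 ≤ η s
  integral_eq_one : ∫ s, η s = 1

namespace IsMollifier

variable {Ω : Set E} {η : E → ℝ}

theorem integrable (h : IsMollifier Ω η) : Integrable η :=
  h.contDiff.continuous.integrable_of_hasCompactSupport h.hasCompactSupport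

/-- The probability measure with density `η`. -/
noncomputable def prob (_ : IsMollifier Ω η) : Measure E :=
  volume.withDensity fun s => ENNReal.ofReal (η s)

theorem isProbabilityMeasure (h : IsMollifier Ω η) : IsProbabilityMeasure h.prob := by
  constructor
  rw [prob, withDensity_apply _ MeasurableSet.univ, Measure.restrict_univ,
    ← ofReal_integral_eq_lintegral_ofReal h.integrable (Eventually.of_forall h.nonneg),
    h.integral_eq_one, ENNReal.ofReal_one]

theorem integral_prob (h : IsMollifier Ω η) (f : E → ℝ) :
    ∫ s, f s ∂h.prob = ∫ s, η s * f s := by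
  rw [prob, integral_withDensity_eq_integral_toReal_smul]
  · simp only [ENNReal.toReal_ofReal (h.nonneg _), smul_eq_mul]
  · exact h.contDiff.continuous.measurable.ennreal_ofReal
  · simp

theorem ae_mem (h : IsMollifier Ω η) : ∀ᵐ s ∂h.prob, s ∈ Ω := by
  rw [prob, ae_withDensity_iff h.contDiff.continuous.measurable.ennreal_ofReal]
  refine Eventually.of_forall fun s hs => h.tsupport_subset (subset_tsupport _ ?_)
  simp only [ne_eq, ENNReal.ofReal_eq_zero, not_le] at hs
  exact hs.ne'

theorem contractionAverage_eq_integral_prob (h : IsMollifier Ω η) (u : E → ℝ) (t : ℝ) (z : E) :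
    contractionAverage η u t z = ∫ s, u ((1 - t) • z + t • s) ∂h.prob := by
  rw [integral_prob, contractionAverage]

end IsMollifier

open Module in
/-- Contraction averages after the change of variables `w = (1 - t) z + t s`. -/
theorem contractionAverage_eq_integral (η u : E → ℝ) {t : ℝ} (ht : 0 < t) (z : E) :
    contractionAverage η u t z =
      ∫ w, u w * ((t ^ finrank ℝ E)⁻¹ * η (t⁻¹ • (w - (1 - t) • z))) := by
  rw [← integral_add_left_eq_self _ ((1 - t) • z)]
  have h := Measure.integral_comp_smul (volume : Measure E)
    (fun w => u ((1 - t) • z + w) * ((t ^ finrank ℝ E)⁻¹ * η (t⁻¹ • w))) t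
  simp only [add_sub_cancel_left]
  have hpos : 0 < (t ^ finrank ℝ E)⁻¹ := by positivity
  rw [abs_of_pos hpos, smul_eq_mul, eq_comm, ← eq_inv_mul_iff_mul_eq₀ hpos.ne'] at h
  rw [h, contractionAverage, ← integral_const_mul]
  refine integral_congr_ae (Eventually.of_forall fun s => ?_)
  simp only [smul_smul, inv_mul_cancel₀ ht.ne', one_smul]
  field_simp

/-- After the change of variables the average is an integral of `u` against a fixed density, so null
sets are invisible. Positivity of `t` matters: at `t = 0` the average only sees the value of `u` at
the single point `z`. -/
theorem contractionAverage_congr_ae (η : E → ℝ) {u v : E → ℝ} (huv : u =ᵐ[volume] v)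
    {t : ℝ} (ht : 0 < t) : contractionAverage η u t = contractionAverage η v t := by
  funext z
  rw [contractionAverage_eq_integral _ _ ht, contractionAverage_eq_integral _ _ ht]
  refine integral_congr_ae ?_
  filter_upwards [huv] with w hw
  rw [hw]

-- Writing the average as a convolution evaluated at the dilated point `(1 - t) z` makes its
-- smoothness, and the formula for its derivative, consequences of the corresponding facts for
-- convolutions.
open Module in
theorem contractionAverage_eq_convolution (η u : E → ℝ) {t : ℝ} (ht : 0 < t) :
    contractionAverage η u t = fun z =>
      (u ⋆[ContinuousLinearMap.mul ℝ ℝ, volume]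
        fun x => (t ^ finrank ℝ E)⁻¹ * η (-(t⁻¹ • x))) ((1 - t) • z) := by
  funext z
  rw [contractionAverage_eq_integral _ _ ht, convolution_def]
  refine integral_congr_ae (Eventually.of_forall fun w => ?_)
  simp only [ContinuousLinearMap.mul_apply', ← smul_neg, neg_sub]

theorem hasCompactSupport_rescale {η : E → ℝ} (h : HasCompactSupport η) {t : ℝ} (ht : 0 < t)
    (c : ℝ) : HasCompactSupport fun x => c * η (-(t⁻¹ • x)) := by
  have h2 : HasCompactSupport fun x => η (-(t⁻¹ • x)) := by
    have := h.comp_homeomorph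
      ((Homeomorph.smulOfNeZero t⁻¹ (inv_ne_zero ht.ne')).trans (Homeomorph.neg E))
    exact this
  exact h2.mul_left

theorem IsMollifier.contDiff_contractionAverage {Ω : Set E} {η u : E → ℝ} (h : IsMollifier Ω η)
    (hu : LocallyIntegrable u) {t : ℝ} (ht : 0 < t) :
    ContDiff ℝ ∞ (contractionAverage η u t) := by
  rw [contractionAverage_eq_convolution _ _ ht]
  have h1 := (hasCompactSupport_rescale h.hasCompactSupport ht
    ((t ^ Module.finrank ℝ E)⁻¹)).contDiff_convolution_right (n := ⊤)
    (ContinuousLinearMap.mul ℝ ℝ) hu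
    (contDiff_const.mul (h.contDiff.comp (contDiff_id.const_smul t⁻¹ : ContDiff ℝ ∞ _).neg))
  exact h1.comp (contDiff_id.const_smul (1 - t))

/-- Contraction averages of a function on a convex set intertwine weak derivatives. -/
theorem IsMollifier.fderiv_contractionAverage {Ω : Set E} {η u g : E → ℝ} {e : E}
    (hΩm : MeasurableSet Ω)
    (hΩ : Convex ℝ Ω) (h : IsMollifier Ω η) (hu : LocallyIntegrable (Ω.indicator u))
    (hug : HasWeakDirDeriv Ω e u g) {t : ℝ} (ht : 0 < t) (ht1 : t < 1) {z : E} (hz : z ∈ Ω) :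
    fderiv ℝ (contractionAverage η (Ω.indicator u) t) z e =
      (1 - t) * contractionAverage η (Ω.indicator g) t z := by
  set ρ : E → ℝ := fun x => (t ^ Module.finrank ℝ E)⁻¹ * η (-(t⁻¹ • x)) with hρ
  have hρs : ContDiff ℝ ∞ ρ :=
    contDiff_const.mul (h.contDiff.comp (contDiff_id.const_smul t⁻¹ : ContDiff ℝ ∞ _).neg)
  have hρc : HasCompactSupport ρ := hasCompactSupport_rescale h.hasCompactSupport ht _
  set x₀ := (1 - t) • z with hx₀
  have hd := hρc.hasFDerivAt_convolution_right (𝕜 := ℝ) (ContinuousLinearMap.mul ℝ ℝ) hu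
    (hρs.of_le (by simp)) x₀
  have hin : HasFDerivAt (fun z : E => (1 - t) • z) ((1 - t) • ContinuousLinearMap.id ℝ E) z :=
    (hasFDerivAt_id z).const_smul (1 - t)
  have hd2 := (hd.comp z hin).congr_of_eventuallyEq
    (Eventually.of_forall (congrFun (contractionAverage_eq_convolution η (Ω.indicator u) ht)))
  rw [hd2.fderiv]
  simp only [ContinuousLinearMap.comp_apply, _root_.smul_apply,
    ContinuousLinearMap.id_apply, map_smul, smul_eq_mul]
  congr 1
  have hφs : ContDiff ℝ ∞ fun w => ρ (x₀ - w) := hρs.comp (contDiff_const.sub contDiff_id)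
  have hφc : HasCompactSupport fun w => ρ (x₀ - w) :=
    hρc.comp_homeomorph (Homeomorph.subLeft x₀)
  -- The kernel seen from `z` is supported in `(1 - t) z + t • tsupport η`, which lies in `Ω` by
  -- convexity. It is therefore an admissible test function for every `z ∈ Ω`, however close to the
  -- boundary.
  have hφt : tsupport (fun w => ρ (x₀ - w)) ⊆ Ω := by
    have hcl : IsClosed {w : E | t⁻¹ • (w - x₀) ∈ tsupport η} :=
      (isClosed_tsupport η).preimage (by fun_prop)
    have hsub : tsupport (fun w => ρ (x₀ - w)) ⊆ {w : E | t⁻¹ • (w - x₀) ∈ tsupport η} := by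
      refine closure_minimal (fun w hw => subset_tsupport _ ?_) hcl
      simp only [hρ, Function.mem_support, ne_eq, mul_eq_zero, not_or] at hw
      rw [← smul_neg, neg_sub] at hw
      exact hw.2
    intro w hw
    have hw2 := h.tsupport_subset (hsub hw)
    have := hΩ hz hw2 (by linarith : 0 ≤ 1 - t) ht.le (by ring)
    rwa [smul_smul, mul_inv_cancel₀ ht.ne', one_smul, ← hx₀, add_sub_cancel] at this
  have hweak := hug _ hφs hφc hφt
  have hfd : ∀ w, fderiv ℝ (fun w => ρ (x₀ - w)) w e = - fderiv ℝ ρ (x₀ - w) e := by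
    intro w
    have h1 : HasFDerivAt (𝕜 := ℝ) (fun w => ρ (x₀ - w)) _ w :=
      ((hρs.differentiable (by simp)).differentiableAt.hasFDerivAt).comp w
        ((hasFDerivAt_id w).const_sub x₀)
    rw [h1.fderiv]
    simp
  rw [convolution_precompR_apply _ hu (hρc.fderiv ℝ) (hρs.continuous_fderiv (by simp)),
    convolution_def, contractionAverage_eq_integral _ _ ht]
  have e1 : ∫ w, (ContinuousLinearMap.mul ℝ ℝ) (Ω.indicator u w) (fderiv ℝ ρ (x₀ - w) e) =
      - ∫ w in Ω, u w * fderiv ℝ (fun w => ρ (x₀ - w)) w e := by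
    rw [← integral_indicator hΩm, ← integral_neg]
    refine integral_congr_ae (Eventually.of_forall fun w => ?_)
    by_cases hw : w ∈ Ω <;> simp [hw, hfd]
  have e2 : ∫ w, Ω.indicator g w *
        ((t ^ Module.finrank ℝ E)⁻¹ * η (t⁻¹ • (w - (1 - t) • z))) =
      ∫ w in Ω, g w * ρ (x₀ - w) := by
    rw [← integral_indicator hΩm]
    refine integral_congr_ae (Eventually.of_forall fun w => ?_)
    by_cases hw : w ∈ Ω <;> simp [hw, hρ, ← smul_neg, neg_sub, hx₀]
  rw [e1, hweak, neg_neg, e2]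

end Mollifier

theorem eLpNorm_two_sq {A : Type*} [MeasurableSpace A] (f : A → ℝ) (μ : Measure A) :
    eLpNorm f 2 μ ^ 2 = ∫⁻ x, ‖f x‖ₑ ^ 2 ∂μ := by
  have := eLpNorm_nnreal_pow_eq_lintegral (f := f) (μ := μ) (p := 2) (by norm_num)
  simpa using this

/-! ### Boundedness and convergence of the averages in `L²` -/

section Mollifier

variable {E : Type*} [NormedAddCommGroup E] [NormedSpace ℝ E] [FiniteDimensional ℝ E]
  [MeasureSpace E] [BorelSpace E] [(volume : Measure E).IsAddHaarMeasure]

-- Ratio and centre both depend on the sample, so that one estimate serves twice: with fixed ratio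
-- `t` and random centre it bounds the averages themselves, and with ratio `τ t` for random `τ` it
-- bounds integrals over the segments joining `z` to its contractions.
open Module in
theorem eLpNorm_two_le_of_average {A : Type*} [MeasurableSpace A] (Q : Measure A)
    [IsProbabilityMeasure Q] {F : E → ENNReal} (hF : Measurable F) {r : A → ℝ} {s : A → E}
    (hr : Measurable r) (hs : Measurable s) (hr2 : ∀ x, r x ≤ 1 / 2) {f : E → ℝ} {c : ENNReal}
    {Ω : Set E} (hΩ : MeasurableSet Ω)
    (hf : ∀ z ∈ Ω, ‖f z‖ₑ ≤ c * ∫⁻ x, F ((1 - r x) • z + r x • s x) ∂Q) :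
    eLpNorm f 2 (volume.restrict Ω) ^ 2 ≤ c ^ 2 * (2 ^ finrank ℝ E * ∫⁻ z, F z ^ 2) := by
  have hmeas : Measurable fun p : E × A => F ((1 - r p.2) • p.1 + r p.2 • s p.2) := by
    fun_prop
  rw [eLpNorm_two_sq]
  calc ∫⁻ z in Ω, ‖f z‖ₑ ^ 2 ≤
      ∫⁻ z in Ω, (c * ∫⁻ x, F ((1 - r x) • z + r x • s x) ∂Q) ^ 2 := by
        refine setLIntegral_mono' hΩ fun z hz => ?_
        gcongr
        exact hf z hz
    _ ≤ ∫⁻ z : E, (c * ∫⁻ x, F ((1 - r x) • z + r x • s x) ∂Q) ^ 2 :=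
        setLIntegral_le_lintegral _ _
    _ = c ^ 2 * ∫⁻ z : E, (∫⁻ x, F ((1 - r x) • z + r x • s x) ∂Q) ^ 2 := by
        simp_rw [mul_pow]
        rw [lintegral_const_mul]
        exact (hmeas.lintegral_prod_right').pow_const 2
    _ ≤ _ := by
        gcongr
        exact lintegral_sq_average_le Q hF hr hs hr2

namespace IsMollifier

variable {Ω : Set E} {η : E → ℝ}

open Module in
theorem eLpNorm_contractionAverage_le (h : IsMollifier Ω η) {u : E → ℝ}
    (hu : AEStronglyMeasurable u) {t : ℝ} (ht : 0 < t) (ht2 : t ≤ 1 / 2) :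
    eLpNorm (contractionAverage η u t) 2 ≤ 2 ^ finrank ℝ E * eLpNorm u 2 := by
  have := h.isProbabilityMeasure
  rw [contractionAverage_congr_ae η hu.ae_eq_mk ht, eLpNorm_congr_ae hu.ae_eq_mk]
  set v := hu.mk u
  have hv : Measurable v := hu.stronglyMeasurable_mk.measurable
  have key := eLpNorm_two_le_of_average h.prob (F := fun z => ‖v z‖ₑ) (by fun_prop)
    (r := fun _ => t) (s := id) measurable_const measurable_id (fun _ => ht2)
    (f := contractionAverage η v t) (c := 1) MeasurableSet.univ (fun z _ => by
      rw [h.contractionAverage_eq_integral_prob, one_mul]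
      exact enorm_integral_le_lintegral_enorm _)
  rw [Measure.restrict_univ, one_pow, one_mul, ← eLpNorm_two_sq] at key
  -- The squared norms compare with factor `2ᵈ`, so `2^(d/2)` would do; the factor is relaxed to
  -- `2ᵈ` to avoid half powers.
  refine (ENNReal.pow_le_pow_left_iff two_ne_zero).1 (key.trans ?_)
  rw [mul_pow]
  exact mul_le_mul_left (le_self_pow₀ (one_le_pow₀ one_le_two) two_ne_zero) _

theorem integrable_average_integrand (h : IsMollifier Ω η) {u : E → ℝ} (hu : LocallyIntegrable u)
    {t : ℝ} (ht : 0 < t) (z : E) : Integrable fun s => η s * u ((1 - t) • z + t • s) := by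
  have hl : LocallyIntegrable fun s => u ((1 - t) • z + t • s) := by
    rw [locallyIntegrable_iff] at hu ⊢
    intro K hK
    have hK' : IsCompact ((fun s => (1 - t) • z + t • s) '' K) := hK.image (by fun_prop)
    have h1 := (hu _ hK').integrable_indicator hK'.measurableSet
    have h2 := (h1.comp_add_left ((1 - t) • z)).comp_smul ht.ne'
    refine (h2.integrableOn (s := K)).congr_fun (fun s hs => ?_) hK.measurableSet
    have : (1 - t) • z + t • s ∈ (fun s => (1 - t) • z + t • s) '' K := mem_image_of_mem _ hs
    simp only [Set.indicator_of_mem this]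
  have := hl.integrable_smul_left_of_hasCompactSupport h.contDiff.continuous h.hasCompactSupport
  exact this

theorem integrable_prob (h : IsMollifier Ω η) {f : E → ℝ}
    (hf : Integrable fun s => η s * f s) : Integrable f h.prob := by
  rw [prob, integrable_withDensity_iff_integrable_smul']
  · simpa only [ENNReal.toReal_ofReal (h.nonneg _), smul_eq_mul] using hf
  · exact h.contDiff.continuous.measurable.ennreal_ofReal
  · simp

theorem contractionAverage_sub (h : IsMollifier Ω η) {u v : E → ℝ} (hu : LocallyIntegrable u)
    (hv : LocallyIntegrable v) {t : ℝ} (ht : 0 < t) :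
    contractionAverage η (u - v) t = contractionAverage η u t - contractionAverage η v t := by
  funext z
  simp only [contractionAverage, Pi.sub_apply, mul_sub]
  exact integral_sub (h.integrable_average_integrand hu ht z)
    (h.integrable_average_integrand hv ht z)

/-- Contraction averages of a function in `L²` converge to it in `L²(Ω)`. -/
theorem tendsto_eLpNorm_contractionAverage_sub (h : IsMollifier Ω η) (hΩm : MeasurableSet Ω)
    (hb : Bornology.IsBounded Ω) {u : E → ℝ} (hu : MemLp u 2) :
    Tendsto (fun t => eLpNorm (contractionAverage η u t - u) 2 (volume.restrict Ω))
      (𝓝[>] 0) (𝓝 0) := by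
  have := h.isProbabilityMeasure
  rw [ENNReal.tendsto_nhds_zero]
  intro ε hε
  -- With `T` the averaging operator, the splitting `T u - u = T (u - g) + (T g - g) - (u - g)`, for
  -- a compactly supported continuous `g` within `δ` of `u`, costs `δ` times these three constants:
  -- the norm bound of `T`, the square root of the volume (the middle term is uniformly at most `δ`
  -- on `Ω`), and `1`.
  set M : ENNReal := 2 ^ Module.finrank ℝ E + (volume Ω) ^ (1 / (2 : ENNReal).toReal) + 1 with hM
  have hvol : volume Ω ≠ ⊤ := hb.measure_lt_top.ne
  have hMtop : M ≠ ⊤ := by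
    simp only [hM]
    refine ENNReal.add_ne_top.2 ⟨ENNReal.add_ne_top.2 ⟨by simp, ?_⟩, by simp⟩
    exact ENNReal.rpow_ne_top_of_nonneg (by simp) hvol
  have hM0 : M ≠ 0 := by simp [hM]
  obtain ⟨δ, hδ0, hδ⟩ : ∃ δ : NNReal, 0 < δ ∧ M * δ ≤ ε := by
    obtain ⟨δ, hδ0, hδ⟩ := ENNReal.lt_iff_exists_nnreal_btwn.1 (ENNReal.div_pos hε.ne' hMtop)
    refine ⟨δ, by exact_mod_cast hδ0, ?_⟩
    rw [mul_comm]
    exact (ENNReal.le_div_iff_mul_le (Or.inl hM0) (Or.inl hMtop)).1 hδ.le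
  obtain ⟨g, hgc, hgu, hgcont, hgL⟩ := hu.exists_hasCompactSupport_eLpNorm_sub_le
    (by simp) (ε := δ) (by simpa using hδ0.ne')
  obtain ⟨ρ, hρ0, hρ⟩ := Metric.uniformContinuous_iff.1
    (hgc.uniformContinuous_of_continuous hgcont) δ hδ0
  obtain ⟨D, hD0, hD⟩ : ∃ D : ℝ, 0 < D ∧ ∀ x ∈ Ω, ∀ y ∈ Ω, ‖x - y‖ ≤ D := by
    refine ⟨Metric.diam Ω + 1, by positivity, fun x hx y hy => ?_⟩
    rw [← dist_eq_norm]
    linarith [Metric.dist_le_diam_of_mem hb hx hy]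
  have hev : ∀ᶠ t : ℝ in 𝓝[>] 0, 0 < t ∧ t ≤ 1 / 2 ∧ t * D < ρ := by
    have h1 : ∀ᶠ t : ℝ in 𝓝[>] 0, t < min (1 / 2) (ρ / D) :=
      nhdsWithin_le_nhds (gt_mem_nhds (by positivity))
    filter_upwards [h1, self_mem_nhdsWithin] with t ht ht0
    exact ⟨ht0, (ht.trans_le (min_le_left _ _)).le,
      (lt_div_iff₀ hD0).1 (ht.trans_le (min_le_right _ _))⟩
  filter_upwards [hev] with t ⟨ht0, ht2, htρ⟩
  have hul := hu.locallyIntegrable (by norm_num)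
  have hgl := hgcont.locallyIntegrable (μ := (volume : Measure E))
  have hdec : contractionAverage η u t - u = (contractionAverage η (u - g) t +
      (contractionAverage η g t - g)) - (u - g) := by
    rw [h.contractionAverage_sub hul hgl ht0]; abel
  have hm1 : AEStronglyMeasurable (contractionAverage η (u - g) t) (volume.restrict Ω) :=
    (h.contDiff_contractionAverage (hul.sub hgl) ht0).continuous.aestronglyMeasurable
  have hm2 : AEStronglyMeasurable (contractionAverage η g t - g) (volume.restrict Ω) :=
    ((h.contDiff_contractionAverage hgl ht0).continuous.sub hgcont).aestronglyMeasurable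
  have hm3 : AEStronglyMeasurable (u - g) :=
    hu.aestronglyMeasurable.sub hgcont.aestronglyMeasurable
  have b1 : eLpNorm (contractionAverage η (u - g) t) 2 (volume.restrict Ω) ≤
      2 ^ Module.finrank ℝ E * δ :=
    (eLpNorm_mono_measure _ Measure.restrict_le_self).trans
      ((h.eLpNorm_contractionAverage_le hm3 ht0 ht2).trans (by gcongr))
  have b2 : eLpNorm (contractionAverage η g t - g) 2 (volume.restrict Ω) ≤
      (volume Ω) ^ (1 / (2 : ENNReal).toReal) * δ := by
    have hbd : ∀ᵐ z ∂(volume.restrict Ω), ‖(contractionAverage η g t - g) z‖ ≤ δ := by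
      filter_upwards [ae_restrict_mem hΩm] with z hz
      have e : (contractionAverage η g t - g) z =
          ∫ s, (g ((1 - t) • z + t • s) - g z) ∂h.prob := by
        rw [integral_sub (h.integrable_prob (h.integrable_average_integrand hgl ht0 z))
          (integrable_const _)]
        simp [h.contractionAverage_eq_integral_prob]
      rw [e]
      refine (norm_integral_le_of_norm_le_const (C := δ) ?_).trans (by simp)
      filter_upwards [h.ae_mem] with s hs
      rw [← dist_eq_norm]
      refine (hρ ?_).le
      rw [dist_eq_norm, show (1 - t) • z + t • s - z = t • (s - z) by module, norm_smul,
        Real.norm_of_nonneg ht0.le]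
      exact (mul_le_mul_of_nonneg_left (hD s hs z hz) ht0.le).trans_lt htρ
    refine (eLpNorm_le_of_ae_bound hbd).trans ?_
    simp
  have b3 : eLpNorm (u - g) 2 (volume.restrict Ω) ≤ δ :=
    (eLpNorm_mono_measure _ Measure.restrict_le_self).trans hgu
  calc eLpNorm (contractionAverage η u t - u) 2 (volume.restrict Ω)
      ≤ (2 ^ Module.finrank ℝ E * δ + (volume Ω) ^ (1 / (2 : ENNReal).toReal) * δ) + δ := by
        rw [hdec]
        refine (eLpNorm_sub_le (hm1.add hm2) hm3.restrict (by norm_num)).trans ?_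
        gcongr
        refine (eLpNorm_add_le hm1 hm2 (by norm_num)).trans ?_
        gcongr
    _ = M * δ := by rw [hM]; ring
    _ ≤ ε := hδ

end IsMollifier

end Mollifier

/-! ### Gradient estimates and density of smooth functions in `H¹` -/

section Sobolev

variable {E : Type*} [NormedAddCommGroup E] [NormedSpace ℝ E] [FiniteDimensional ℝ E]
  [MeasureSpace E] [BorelSpace E] [(volume : Measure E).IsAddHaarMeasure]
  {ι : Type*} [Fintype ι]

/-- `u ∈ H¹(Ω)` with weak derivative `g i` in the direction of the basis vector `b i`. -/
structure IsWeakGradient (Ω : Set E) (b : Module.Basis ι ℝ E) (u : E → ℝ) (g : ι → E → ℝ) :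
    Prop where
  memLp : MemLp u 2 (volume.restrict Ω)
  memLp_grad : ∀ i, MemLp (g i) 2 (volume.restrict Ω)
  weakDeriv : ∀ i, HasWeakDirDeriv Ω (b i) u (g i)

theorem exists_coord_bound (b : Module.Basis ι ℝ E) :
    ∃ K : ℝ, 0 ≤ K ∧ ∀ v i, |b.repr v i| ≤ K * ‖v‖ := by
  refine ⟨∑ i, ‖(b.coord i).toContinuousLinearMap‖, by positivity, fun v i => ?_⟩
  have h1 : |b.repr v i| ≤ ‖(b.coord i).toContinuousLinearMap‖ * ‖v‖ :=
    (b.coord i).toContinuousLinearMap.le_opNorm v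
  refine h1.trans (mul_le_mul_of_nonneg_right ?_ (norm_nonneg v))
  exact Finset.single_le_sum (f := fun i => ‖(b.coord i).toContinuousLinearMap‖)
    (fun i _ => norm_nonneg _) (Finset.mem_univ i)

theorem enorm_clm_apply_le (b : Module.Basis ι ℝ E) {K : ℝ}
    (hK : ∀ v i, |b.repr v i| ≤ K * ‖v‖) (L : E →L[ℝ] ℝ) (v : E) {M : ℝ} (hM : K * ‖v‖ ≤ M) :
    ‖L v‖ₑ ≤ ENNReal.ofReal M * ∑ i, ‖L (b i)‖ₑ := by
  conv_lhs => rw [← b.sum_repr v, map_sum]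
  refine (enorm_sum_le _ _).trans ?_
  rw [Finset.mul_sum]
  refine Finset.sum_le_sum fun i _ => ?_
  rw [map_smul, enorm_smul]
  gcongr
  rw [Real.enorm_eq_ofReal_abs]
  exact ENNReal.ofReal_le_ofReal ((hK v i).trans hM)

theorem enorm_sub_le_lintegral_segment {u : E → ℝ} (hu : ContDiff ℝ 1 u) (z v : E) :
    ‖u (z + v) - u z‖ₑ ≤ ∫⁻ τ in Ioc (0 : ℝ) 1, ‖fderiv ℝ u (z + τ • v) v‖ₑ := by
  have hd : ∀ τ ∈ uIcc (0 : ℝ) 1,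
      HasDerivAt (fun τ : ℝ => u (z + τ • v)) (fderiv ℝ u (z + τ • v) v) τ := by
    intro τ _
    have h1 : HasDerivAt (fun τ : ℝ => z + τ • v) v τ := by
      simpa using ((hasDerivAt_id τ).smul_const v).const_add z
    exact (hu.differentiable one_ne_zero _).hasFDerivAt.comp_hasDerivAt τ h1
  have hc : Continuous fun τ : ℝ => fderiv ℝ u (z + τ • v) v := by
    have := hu.continuous_fderiv one_ne_zero
    fun_prop
  have h := intervalIntegral.integral_eq_sub_of_hasDerivAt hd (hc.intervalIntegrable _ _)
  simp only [one_smul, zero_smul, add_zero] at h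
  rw [← h, intervalIntegral.integral_of_le zero_le_one]
  exact enorm_integral_le_lintegral_enorm _

namespace IsMollifier

variable {Ω : Set E} {η : E → ℝ}

/-- The difference is an average of increments of `u` along segments from `z` to `(1 - t) z + t s`.
The fundamental theorem of calculus turns each into an integral of the gradient at the points `(1 -
τ t) z + τ t s`, and the segment has length at most `t D`. The segment stays in `Ω`, where `G`
dominates the gradient. -/
theorem enorm_contractionAverage_sub_le (h : IsMollifier Ω η) (hΩ : Convex ℝ Ω)
    (b : Module.Basis ι ℝ E) {K D : ℝ} (hK0 : 0 ≤ K)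
    (hK : ∀ v i, |b.repr v i| ≤ K * ‖v‖) (hD : ∀ x ∈ Ω, ∀ y ∈ Ω, ‖x - y‖ ≤ D)
    {u : E → ℝ} (hu : ContDiff ℝ 1 u) (hl : LocallyIntegrable (Ω.indicator u))
    {t : ℝ} (ht : 0 < t) (ht2 : t ≤ 1 / 2)
    {G : E → ENNReal} (hGm : Measurable G)
    (hG : ∀ p ∈ Ω, ∑ i, ‖fderiv ℝ u p (b i)‖ₑ ≤ G p) {z : E} (hz : z ∈ Ω) :
    ‖(contractionAverage η (Ω.indicator u) t - u) z‖ₑ ≤ ENNReal.ofReal (t * (K * D)) *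
      ∫⁻ x, G ((1 - min (x.2 * t) (1 / 2)) • z + min (x.2 * t) (1 / 2) • x.1)
        ∂(h.prob.prod (volume.restrict (Ioc (0 : ℝ) 1))) := by
  have := h.isProbabilityMeasure
  have e : (contractionAverage η (Ω.indicator u) t - u) z =
      ∫ s, (Ω.indicator u ((1 - t) • z + t • s) - u z) ∂h.prob := by
    rw [integral_sub (h.integrable_prob (h.integrable_average_integrand hl ht z))
      (integrable_const _)]
    simp [h.contractionAverage_eq_integral_prob]
  have hmeas : Measurable fun x : E × ℝ =>
      G ((1 - min (x.2 * t) (1 / 2)) • z + min (x.2 * t) (1 / 2) • x.1) := by fun_prop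
  rw [e, lintegral_prod _ hmeas.aemeasurable, ← lintegral_const_mul _ hmeas.lintegral_prod_right']
  refine (enorm_integral_le_lintegral_enorm _).trans (lintegral_mono_ae ?_)
  filter_upwards [h.ae_mem] with s hs
  have hmem : ∀ r ∈ Icc (0 : ℝ) 1, (1 - r) • z + r • s ∈ Ω := fun r hr =>
    hΩ hz hs (by linarith [hr.2]) hr.1 (by ring)
  rw [indicator_of_mem (hmem t ⟨ht.le, by linarith⟩),
    show (1 - t) • z + t • s = z + t • (s - z) by module]
  refine (enorm_sub_le_lintegral_segment hu z _).trans ?_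
  rw [← lintegral_const_mul _ (by fun_prop)]
  refine setLIntegral_mono' measurableSet_Ioc fun τ hτ => ?_
  have hτt : τ * t ≤ t := by nlinarith [hτ.2]
  -- The truncation at `1/2` never acts for `τ ≤ 1`; it is present because the averaging estimate
  -- asks for a ratio at most `1/2` at every parameter.
  rw [min_eq_left (hτt.trans ht2)]
  have hp : z + τ • t • (s - z) = (1 - τ * t) • z + (τ * t) • s := by module
  rw [hp]
  refine (enorm_clm_apply_le b hK _ _ (M := t * (K * D)) ?_).trans ?_
  · rw [norm_smul, Real.norm_of_nonneg ht.le, mul_left_comm]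
    have := hD s hs z hz
    gcongr
  · gcongr
    exact hG _ (hmem _ ⟨mul_nonneg hτ.1.le ht.le, by linarith⟩)

/-- Contraction averages of a smooth function are close to it in terms of its gradient. -/
theorem eLpNorm_contractionAverage_sub_le (h : IsMollifier Ω η) (hΩm : MeasurableSet Ω)
    (hΩ : Convex ℝ Ω) (b : Module.Basis ι ℝ E) {K D : ℝ} (hK0 : 0 ≤ K)
    (hK : ∀ v i, |b.repr v i| ≤ K * ‖v‖) (hD : ∀ x ∈ Ω, ∀ y ∈ Ω, ‖x - y‖ ≤ D)
    {u : E → ℝ} (hu : ContDiff ℝ 1 u) (hl : LocallyIntegrable (Ω.indicator u))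
    {t : ℝ} (ht : 0 < t) (ht2 : t ≤ 1 / 2) :
    eLpNorm (contractionAverage η (Ω.indicator u) t - u) 2 (volume.restrict Ω) ≤
      ENNReal.ofReal (t * (K * D)) * (2 ^ Module.finrank ℝ E *
        ∑ i, eLpNorm (fun z => fderiv ℝ u z (b i)) 2 (volume.restrict Ω)) := by
  have := h.isProbabilityMeasure
  have : IsProbabilityMeasure (volume.restrict (Ioc (0 : ℝ) 1)) := ⟨by simp⟩
  have hcont : ∀ i, Continuous fun z => fderiv ℝ u z (b i) := fun i => by
    have := hu.continuous_fderiv one_ne_zero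
    fun_prop
  set S : E → ℝ := fun z => ∑ i, ‖fderiv ℝ u z (b i)‖ with hS
  have hSc : Continuous S := continuous_finsetSum _ fun i _ => (hcont i).norm
  have hSe : ∀ z, ‖S z‖ₑ = ∑ i, ‖fderiv ℝ u z (b i)‖ₑ := by
    intro z
    rw [Real.enorm_eq_ofReal (by positivity), hS, ENNReal.ofReal_sum_of_nonneg (by simp)]
    simp [Real.enorm_eq_ofReal_abs]
  have hGm : Measurable (Ω.indicator fun z => ‖S z‖ₑ) :=
    (by fun_prop : Measurable fun z => ‖S z‖ₑ).indicator hΩm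
  have key := eLpNorm_two_le_of_average (h.prob.prod (volume.restrict (Ioc (0 : ℝ) 1)))
    (F := Ω.indicator fun z => ‖S z‖ₑ) hGm
    (r := fun x => min (x.2 * t) (1 / 2)) (s := Prod.fst) (by fun_prop) (by fun_prop)
    (fun x => min_le_right _ _) (c := ENNReal.ofReal (t * (K * D))) hΩm
    (f := contractionAverage η (Ω.indicator u) t - u) (fun z hz =>
      h.enorm_contractionAverage_sub_le hΩ b hK0 hK hD hu hl ht ht2 hGm
        (fun p hp => by rw [indicator_of_mem hp, hSe]) hz)
  have e1 : ∫⁻ z, (Ω.indicator fun z => ‖S z‖ₑ) z ^ 2 = eLpNorm S 2 (volume.restrict Ω) ^ 2 := by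
    rw [eLpNorm_two_sq, ← lintegral_indicator hΩm]
    refine lintegral_congr fun z => ?_
    by_cases hz : z ∈ Ω <;> simp [hz]
  have e2 : eLpNorm S 2 (volume.restrict Ω) ≤
      ∑ i, eLpNorm (fun z => fderiv ℝ u z (b i)) 2 (volume.restrict Ω) := by
    have := eLpNorm_sum_le (μ := volume.restrict Ω) (p := 2) (s := Finset.univ)
      (f := fun i z => ‖fderiv ℝ u z (b i)‖)
      (fun i _ => (hcont i).norm.aestronglyMeasurable) (by norm_num)
    simp only [eLpNorm_norm] at this
    convert this using 2
    funext z
    simp [hS]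
  refine (ENNReal.pow_le_pow_left_iff two_ne_zero).1 (key.trans ?_)
  rw [e1, mul_pow, mul_pow]
  have h2 : (2 : ENNReal) ^ Module.finrank ℝ E ≤ (2 ^ Module.finrank ℝ E) ^ 2 :=
    le_self_pow₀ (one_le_pow₀ one_le_two) two_ne_zero
  exact mul_le_mul_right (mul_le_mul' h2 (pow_le_pow_left' e2 2)) _

/-- On `Ω` the derivative of the average of `u` is `1 - t` times the average of `g`. Its distance to
`g` is controlled by the convergence of the averages of `g` plus `t ‖g‖`. -/
theorem tendsto_eLpNorm_fderiv_sub (h : IsMollifier Ω η) (hΩm : MeasurableSet Ω)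
    (hΩ : Convex ℝ Ω) (hb : Bornology.IsBounded Ω) {u g : E → ℝ} {e : E}
    (hu : MemLp u 2 (volume.restrict Ω)) (hg : MemLp g 2 (volume.restrict Ω))
    (hug : HasWeakDirDeriv Ω e u g) :
    Tendsto (fun t => eLpNorm (fun z => fderiv ℝ (contractionAverage η (Ω.indicator u) t) z e - g z)
      2 (volume.restrict Ω)) (𝓝[>] 0) (𝓝 0) := by
  have hgi : MemLp (Ω.indicator g) 2 := (memLp_indicator_iff_restrict hΩm).2 hg
  have hui : MemLp (Ω.indicator u) 2 := (memLp_indicator_iff_restrict hΩm).2 hu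
  have h1 := h.tendsto_eLpNorm_contractionAverage_sub hΩm hb hgi
  have h2 : Tendsto (fun t : ℝ => ENNReal.ofReal t * eLpNorm g 2 (volume.restrict Ω))
      (𝓝[>] 0) (𝓝 0) := by
    have : Tendsto (fun t : ℝ => ENNReal.ofReal t) (𝓝[>] 0) (𝓝 0) := by
      have := (ENNReal.continuous_ofReal.tendsto 0).mono_left
        (nhdsWithin_le_nhds (s := Ioi (0 : ℝ)))
      simpa using this
    simpa using ENNReal.Tendsto.mul_const this (Or.inr hg.eLpNorm_ne_top)
  refine tendsto_of_tendsto_of_tendsto_of_le_of_le' tendsto_const_nhds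
    (by simpa using h1.add h2) (Eventually.of_forall fun _ => zero_le) ?_
  have hev : ∀ᶠ t : ℝ in 𝓝[>] 0, t < 1 := nhdsWithin_le_nhds (gt_mem_nhds one_pos)
  filter_upwards [hev, self_mem_nhdsWithin] with t ht1 ht0
  have ht0 : 0 < t := ht0
  have hc : AEStronglyMeasurable (contractionAverage η (Ω.indicator g) t) (volume.restrict Ω) :=
    (h.contDiff_contractionAverage (hgi.locallyIntegrable (by norm_num))
      ht0).continuous.aestronglyMeasurable
  have heq : (fun z => fderiv ℝ (contractionAverage η (Ω.indicator u) t) z e - g z)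
      =ᵐ[volume.restrict Ω] ((1 - t) • (contractionAverage η (Ω.indicator g) t - Ω.indicator g)
        - t • g) := by
    filter_upwards [ae_restrict_mem hΩm] with z hz
    rw [h.fderiv_contractionAverage hΩm hΩ (hui.locallyIntegrable (by norm_num)) hug ht0 ht1 hz]
    simp [hz]
    ring
  rw [eLpNorm_congr_ae heq]
  have hgir : AEStronglyMeasurable (Ω.indicator g) (volume.restrict Ω) :=
    hgi.aestronglyMeasurable.restrict
  refine (eLpNorm_sub_le ((hc.sub hgir).const_smul _)
    (hg.aestronglyMeasurable.const_smul _) (by norm_num)).trans ?_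
  gcongr
  · rw [eLpNorm_const_smul]
    refine mul_le_of_le_one_left' ?_
    rw [Real.enorm_of_nonneg (by linarith)]
    exact ENNReal.ofReal_le_one.2 (by linarith)
  · rw [eLpNorm_const_smul, Real.enorm_of_nonneg ht0.le]

/-- Smooth functions are dense in `H¹(Ω)` for bounded convex `Ω`. -/
theorem exists_smooth_approximation (h : IsMollifier Ω η) (hΩm : MeasurableSet Ω)
    (hΩ : Convex ℝ Ω) (hb : Bornology.IsBounded Ω) {b : Module.Basis ι ℝ E} {u : E → ℝ}
    {g : ι → E → ℝ} (hu : IsWeakGradient Ω b u g) :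
    ∃ t : ℕ → ℝ, (∀ k, 0 < t k ∧ t k ≤ 1 / 2) ∧
      (∀ k, ContDiff ℝ ∞ (contractionAverage η (Ω.indicator u) (t k))) ∧
      Tendsto (fun k => eLpNorm (contractionAverage η (Ω.indicator u) (t k) - u) 2
        (volume.restrict Ω)) atTop (𝓝 0) ∧
      ∀ i, Tendsto (fun k => eLpNorm (fun z =>
        fderiv ℝ (contractionAverage η (Ω.indicator u) (t k)) z (b i) - g i z) 2
        (volume.restrict Ω)) atTop (𝓝 0) := by
  have hui : MemLp (Ω.indicator u) 2 := (memLp_indicator_iff_restrict hΩm).2 hu.memLp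
  have htk : ∀ k : ℕ, 0 < (1 / ((k : ℝ) + 2)) ∧ 1 / ((k : ℝ) + 2) ≤ 1 / 2 := fun k =>
    ⟨by positivity, one_div_le_one_div_of_le two_pos (by linarith [Nat.cast_nonneg (α := ℝ) k])⟩
  have ht : Tendsto (fun k : ℕ => 1 / ((k : ℝ) + 2)) atTop (𝓝[>] 0) := by
    refine tendsto_nhdsWithin_iff.2 ⟨?_, Eventually.of_forall fun k => (htk k).1⟩
    exact (tendsto_natCast_atTop_atTop.atTop_add tendsto_const_nhds).const_div_atTop 1
  refine ⟨fun k => 1 / ((k : ℝ) + 2), htk, fun k =>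
    h.contDiff_contractionAverage (hui.locallyIntegrable (by norm_num)) (htk k).1, ?_, fun i =>
    (h.tendsto_eLpNorm_fderiv_sub hΩm hΩ hb hu.memLp (hu.memLp_grad i) (hu.weakDeriv i)).comp ht⟩
  refine ((h.tendsto_eLpNorm_contractionAverage_sub hΩm hb hui).comp ht).congr fun k => ?_
  refine eLpNorm_congr_ae ?_
  filter_upwards [ae_restrict_mem hΩm] with z hz
  simp [hz]

end IsMollifier

end Sobolev

/-! ### Weak compactness and Rellich's theorem -/

/-- Bounded sequences in a separable real Hilbert space have weakly convergent subsequences. -/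
theorem exists_weakly_convergent_subseq {X : Type*} [NormedAddCommGroup X] [InnerProductSpace ℝ X]
    [CompleteSpace X] [TopologicalSpace.SeparableSpace X] {x : ℕ → X} {R : ℝ}
    (hx : ∀ k, ‖x k‖ ≤ R) :
    ∃ φ : ℕ → ℕ, StrictMono φ ∧ ∃ l : X, ∀ y,
      Tendsto (fun k => inner ℝ (x (φ k)) y) atTop (𝓝 (inner ℝ l y)) := by
  have hs := WeakDual.isSeqCompact_closedBall ℝ X (0 : StrongDual ℝ X) R
  have hmem : ∀ k, StrongDual.toWeakDual (InnerProductSpace.toDual ℝ X (x k)) ∈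
      WeakDual.toStrongDual ⁻¹' Metric.closedBall (0 : StrongDual ℝ X) R := fun k => by
    simpa using hx k
  obtain ⟨f, -, φ, hφ, hf⟩ := hs hmem
  refine ⟨φ, hφ, (InnerProductSpace.toDual ℝ X).symm (WeakDual.toStrongDual f), fun y => ?_⟩
  rw [InnerProductSpace.toDual_symm_apply]
  have h1 := (WeakDual.eval_continuous (𝕜 := ℝ) y).tendsto f
  exact h1.comp hf

section Sobolev

variable {E : Type*} [NormedAddCommGroup E] [NormedSpace ℝ E] [FiniteDimensional ℝ E]
  [MeasureSpace E] [BorelSpace E] [(volume : Measure E).IsAddHaarMeasure]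
  {ι : Type*} [Fintype ι]

namespace IsMollifier

variable {Ω : Set E} {η : E → ℝ}

/-- Contraction averages of an `H¹` function are close to it in terms of its weak gradient. -/
theorem eLpNorm_contractionAverage_sub_le_of_isWeakGradient (h : IsMollifier Ω η)
    (hΩm : MeasurableSet Ω)
    (hΩ : Convex ℝ Ω) (hb : Bornology.IsBounded Ω) {b : Module.Basis ι ℝ E} {K D : ℝ} (hK0 : 0 ≤ K)
    (hK : ∀ v i, |b.repr v i| ≤ K * ‖v‖) (hD : ∀ x ∈ Ω, ∀ y ∈ Ω, ‖x - y‖ ≤ D)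
    {u : E → ℝ} {g : ι → E → ℝ} (hu : IsWeakGradient Ω b u g)
    {t : ℝ} (ht : 0 < t) (ht2 : t ≤ 1 / 2) :
    eLpNorm (contractionAverage η (Ω.indicator u) t - u) 2 (volume.restrict Ω) ≤
      ENNReal.ofReal (t * (K * D)) * (2 ^ Module.finrank ℝ E *
        ∑ i, eLpNorm (g i) 2 (volume.restrict Ω)) := by
  obtain ⟨τ, -, hs, hl, hlg⟩ := h.exists_smooth_approximation hΩm hΩ hb hu
  set f : ℕ → E → ℝ := fun k => contractionAverage η (Ω.indicator u) (τ k)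
  have hfc : ∀ k, Continuous (f k) := fun k => (hs k).continuous
  have hvol : volume Ω ≠ ⊤ := hb.measure_lt_top.ne
  have hui : MemLp (Ω.indicator u) 2 := (memLp_indicator_iff_restrict hΩm).2 hu.memLp
  have hul := hui.locallyIntegrable (by norm_num)
  have hfl : ∀ k, LocallyIntegrable (Ω.indicator (f k)) := fun k =>
    (hfc k).locallyIntegrable.indicator hΩm
  have hfm : ∀ k i, AEStronglyMeasurable (fun z => fderiv ℝ (f k) z (b i)) (volume.restrict Ω) := by
    intro k i
    have := (hs k).continuous_fderiv (by simp)
    exact Continuous.aestronglyMeasurable (by fun_prop)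
  -- For each smooth approximation `f k`, split into the average of `u - f k`, the averaging error
  -- of `f k`, and `f k - u`. The first and last terms vanish as `k → ∞`, and the middle one obeys
  -- the smooth estimate, whose gradient norms converge.
  have hbound : ∀ k, eLpNorm (contractionAverage η (Ω.indicator u) t - u) 2 (volume.restrict Ω) ≤
      (2 ^ Module.finrank ℝ E * eLpNorm (f k - u) 2 (volume.restrict Ω) +
      ENNReal.ofReal (t * (K * D)) * (2 ^ Module.finrank ℝ E *
        ∑ i, (eLpNorm (fun z => fderiv ℝ (f k) z (b i) - g i z) 2 (volume.restrict Ω) +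
          eLpNorm (g i) 2 (volume.restrict Ω)))) + eLpNorm (f k - u) 2 (volume.restrict Ω) := by
    intro k
    have hfu : Ω.indicator u - Ω.indicator (f k) = -(Ω.indicator (f k - u)) := by
      funext z
      by_cases hz : z ∈ Ω <;> simp [hz]
    have hdec : contractionAverage η (Ω.indicator u) t - u =
        (contractionAverage η (Ω.indicator u - Ω.indicator (f k)) t +
        (contractionAverage η (Ω.indicator (f k)) t - f k)) + (f k - u) := by
      rw [h.contractionAverage_sub hul (hfl k) ht]; abel
    have hm1 : AEStronglyMeasurable (contractionAverage η (Ω.indicator u - Ω.indicator (f k)) t)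
        (volume.restrict Ω) :=
      (h.contDiff_contractionAverage (hul.sub (hfl k)) ht).continuous.aestronglyMeasurable
    have hm2 : AEStronglyMeasurable (contractionAverage η (Ω.indicator (f k)) t - f k)
        (volume.restrict Ω) :=
      ((h.contDiff_contractionAverage (hfl k) ht).continuous.sub (hfc k)).aestronglyMeasurable
    have hm3 : AEStronglyMeasurable (f k - u) (volume.restrict Ω) :=
      (hfc k).aestronglyMeasurable.sub hu.memLp.aestronglyMeasurable
    rw [hdec]
    refine (eLpNorm_add_le (hm1.add hm2) hm3 (by norm_num)).trans ?_
    gcongr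
    refine (eLpNorm_add_le hm1 hm2 (by norm_num)).trans ?_
    gcongr ?_ + ?_
    · refine (eLpNorm_mono_measure _ Measure.restrict_le_self).trans
        ((h.eLpNorm_contractionAverage_le ?_ ht ht2).trans ?_)
      · exact hui.aestronglyMeasurable.sub ((hfc k).aestronglyMeasurable.indicator hΩm)
      · rw [hfu, eLpNorm_neg, eLpNorm_indicator_eq_eLpNorm_restrict hΩm]
    · refine (h.eLpNorm_contractionAverage_sub_le hΩm hΩ b hK0 hK hD ((hs k).of_le (by simp))
        (hfl k) ht ht2).trans ?_
      gcongr with i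
      have : (fun z => fderiv ℝ (f k) z (b i)) =
          (fun z => fderiv ℝ (f k) z (b i) - g i z) + g i := by
        funext z; simp
      conv_lhs => rw [this]
      exact eLpNorm_add_le ((hfm k i).sub (hu.memLp_grad i).aestronglyMeasurable)
        (hu.memLp_grad i).aestronglyMeasurable (by norm_num)
  refine ge_of_tendsto' (x := atTop) (f := fun k => _) ?_ hbound
  have t1 : Tendsto (fun k => 2 ^ Module.finrank ℝ E * eLpNorm (f k - u) 2 (volume.restrict Ω))
      atTop (𝓝 0) := by
    simpa using ENNReal.Tendsto.const_mul (a := 2 ^ Module.finrank ℝ E) hl (Or.inr (by simp))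
  have t2 : Tendsto (fun k => ∑ i,
      (eLpNorm (fun z => fderiv ℝ (f k) z (b i) - g i z) 2 (volume.restrict Ω) +
          eLpNorm (g i) 2 (volume.restrict Ω))) atTop
      (𝓝 (∑ i, eLpNorm (g i) 2 (volume.restrict Ω))) := by
    refine tendsto_finsetSum _ fun i _ => ?_
    simpa using (hlg i).add_const (eLpNorm (g i) 2 (volume.restrict Ω))
  have t3 := ENNReal.Tendsto.const_mul (a := ENNReal.ofReal (t * (K * D)))
    (ENNReal.Tendsto.const_mul (a := 2 ^ Module.finrank ℝ E) t2 (Or.inr (by simp)))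
    (Or.inr (by simp))
  simpa using (t1.add t3).add hl

end IsMollifier

/-- Contraction averages are inner products with a fixed bounded family. -/
theorem IsMollifier.exists_kernel {Ω : Set E} {η : E → ℝ} (h : IsMollifier Ω η)
    (hΩm : MeasurableSet Ω) (hb : Bornology.IsBounded Ω) {t : ℝ} (ht : 0 < t) :
    ∃ (ψ : E → Lp ℝ 2 ((volume : Measure E).restrict Ω)) (B : ℝ), (∀ z, ‖ψ z‖ ≤ B) ∧
      ∀ x : Lp ℝ 2 ((volume : Measure E).restrict Ω), ∀ z,
        contractionAverage η (Ω.indicator x) t z = inner ℝ x (ψ z) := by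
  have hfin : IsFiniteMeasure ((volume : Measure E).restrict Ω) :=
    ⟨by simpa using hb.measure_lt_top⟩
  obtain ⟨M, hM⟩ := h.contDiff.continuous.bounded_above_of_compact_support h.hasCompactSupport
  set c := (t ^ Module.finrank ℝ E)⁻¹
  have hbd : ∀ z w, ‖c * η (t⁻¹ • (w - (1 - t) • z))‖ ≤ ‖c‖ * M := fun z w => by
    rw [norm_mul]
    exact mul_le_mul_of_nonneg_left (hM _) (norm_nonneg _)
  have hcont : ∀ z, Continuous fun w => c * η (t⁻¹ • (w - (1 - t) • z)) := fun z => by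
    have := h.contDiff.continuous
    fun_prop
  have hL : ∀ z, MemLp (fun w => c * η (t⁻¹ • (w - (1 - t) • z))) 2 (volume.restrict Ω) := fun z =>
    MemLp.of_bound (hcont z).aestronglyMeasurable _ (Eventually.of_forall (hbd z))
  refine ⟨fun z => (hL z).toLp, _, fun z => Lp.norm_le_of_ae_bound (C := ‖c‖ * M) ?_ ?_,
    fun x z => ?_⟩
  · exact (norm_nonneg _).trans (hbd 0 0)
  · filter_upwards [(hL z).coeFn_toLp] with w hw
    rw [hw]
    exact hbd z w
  · rw [contractionAverage_eq_integral _ _ ht, L2.inner_def]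
    have : ∀ w, Ω.indicator x w * (c * η (t⁻¹ • (w - (1 - t) • z))) =
        Ω.indicator (fun w => x w * (c * η (t⁻¹ • (w - (1 - t) • z)))) w := fun w => by
      by_cases hw : w ∈ Ω <;> simp [hw]
    simp_rw [c] at this
    simp_rw [this]
    rw [integral_indicator hΩm]
    refine integral_congr_ae ?_
    filter_upwards [(hL z).coeFn_toLp] with w hw
    rw [hw]
    simp [mul_comm, c]

/-- Contraction averages turn weak convergence into strong convergence. -/
theorem IsMollifier.tendsto_contractionAverage_of_weak {Ω : Set E} {η : E → ℝ}
    (h : IsMollifier Ω η)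
    (hΩm : MeasurableSet Ω) (hb : Bornology.IsBounded Ω) {t : ℝ} (ht : 0 < t)
    {x : ℕ → Lp ℝ 2 ((volume : Measure E).restrict Ω)}
    {l : Lp ℝ 2 ((volume : Measure E).restrict Ω)}
    {R : ℝ} (hx : ∀ k, ‖x k‖ ≤ R)
    (hl : ∀ y, Tendsto (fun k => inner ℝ (x k) y) atTop (𝓝 (inner ℝ l y))) :
    Tendsto (fun k => eLpNorm (contractionAverage η (Ω.indicator (x k)) t -
      contractionAverage η (Ω.indicator l) t) 2 (volume.restrict Ω)) atTop (𝓝 0) := by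
  have hfin : IsFiniteMeasure ((volume : Measure E).restrict Ω) :=
    ⟨by simpa using hb.measure_lt_top⟩
  obtain ⟨ψ, B, hB, hψ⟩ := h.exists_kernel hΩm hb ht
  have hloc : ∀ y : Lp ℝ 2 ((volume : Measure E).restrict Ω),
      LocallyIntegrable (Ω.indicator y) := fun y =>
    ((memLp_indicator_iff_restrict hΩm).2 (Lp.memLp y)).locallyIntegrable (by norm_num)
  have hcont : ∀ y : Lp ℝ 2 ((volume : Measure E).restrict Ω),
      Continuous (contractionAverage η (Ω.indicator y) t) := fun y =>
    (h.contDiff_contractionAverage (hloc y) ht).continuous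
  have hsq : Tendsto (fun k => eLpNorm (contractionAverage η (Ω.indicator (x k)) t -
      contractionAverage η (Ω.indicator l) t) 2 (volume.restrict Ω) ^ 2) atTop (𝓝 0) := by
    simp_rw [eLpNorm_two_sq]
    -- Each value of the average is an inner product with some `ψ z`, so weak convergence gives
    -- pointwise convergence; the uniform bound on `‖ψ z‖` gives a constant dominating function on
    -- the finite measure space.
    have := tendsto_lintegral_of_dominated_convergence' (μ := (volume : Measure E).restrict Ω)
      (F := fun k z => ‖(contractionAverage η (Ω.indicator (x k)) t -
        contractionAverage η (Ω.indicator l) t) z‖ₑ ^ 2) (f := fun _ => 0)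
      (fun _ => ENNReal.ofReal ((R + ‖l‖) * B) ^ 2) (fun k => ?_) (fun k => ?_) ?_ ?_
    · simpa using this
    · exact (((hcont _).sub (hcont _)).enorm.measurable.pow_const 2).aemeasurable
    · refine Eventually.of_forall fun z => ?_
      simp only
      gcongr
      rw [Real.enorm_eq_ofReal_abs]
      refine ENNReal.ofReal_le_ofReal ?_
      rw [Pi.sub_apply, hψ, hψ, ← inner_sub_left]
      refine (abs_real_inner_le_norm _ _).trans ?_
      gcongr
      · exact (norm_nonneg _).trans ((norm_sub_le _ _).trans (add_le_add_left (hx k) _))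
      · exact (norm_sub_le _ _).trans (add_le_add_left (hx k) _)
      · exact hB z
    · simp only [lintegral_const]
      exact ENNReal.mul_ne_top (by simp) (measure_ne_top _ _)
    · refine Eventually.of_forall fun z => ?_
      have h1 : Tendsto (fun k => (contractionAverage η (Ω.indicator (x k)) t -
          contractionAverage η (Ω.indicator l) t) z) atTop (𝓝 0) := by
        simp only [Pi.sub_apply, hψ]
        simpa using (hl (ψ z)).sub_const (inner ℝ l (ψ z))
      have h2 := (ENNReal.continuous_pow 2).continuousAt.tendsto.comp
        ((continuous_enorm.tendsto _).comp h1)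
      simpa [Function.comp_def] using h2
  have := hsq.ennrpow_const (r := (1 / 2 : ℝ))
  simp only [one_div, ← ENNReal.rpow_natCast, ← ENNReal.rpow_mul] at this
  simpa using this

/-- **Rellich's theorem** for bounded convex sets. -/
theorem exists_subseq_tendsto_of_isWeakGradient {Ω : Set E} {η : E → ℝ} (h : IsMollifier Ω η)
    (hΩm : MeasurableSet Ω) (hΩ : Convex ℝ Ω) (hb : Bornology.IsBounded Ω)
    {b : Module.Basis ι ℝ E} {x : ℕ → Lp ℝ 2 ((volume : Measure E).restrict Ω)}
    {g : ℕ → ι → E → ℝ} (hw : ∀ k, IsWeakGradient Ω b (x k) (g k)) {R : ℝ}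
    (hx : ∀ k, ‖x k‖ ≤ R)
    (hg : ∀ k i, eLpNorm (g k i) 2 (volume.restrict Ω) ≤ ENNReal.ofReal R) :
    ∃ φ : ℕ → ℕ, StrictMono φ ∧ ∃ l, Tendsto (fun k => x (φ k)) atTop (𝓝 l) := by
  have : Fact ((2 : ENNReal) ≠ ⊤) := ⟨by simp⟩
  obtain ⟨φ, hφ, l, hl⟩ := exists_weakly_convergent_subseq hx
  refine ⟨φ, hφ, l, ?_⟩
  rw [Lp.tendsto_Lp_iff_tendsto_eLpNorm']
  obtain ⟨K, hK0, hK⟩ := exists_coord_bound b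
  obtain ⟨D, hD0, hD⟩ : ∃ D : ℝ, 0 < D ∧ ∀ x ∈ Ω, ∀ y ∈ Ω, ‖x - y‖ ≤ D := by
    refine ⟨Metric.diam Ω + 1, by positivity, fun x hx y hy => ?_⟩
    rw [← dist_eq_norm]
    linarith [Metric.dist_le_diam_of_mem hb hx hy]
  have hli : MemLp (Ω.indicator l) 2 := (memLp_indicator_iff_restrict hΩm).2 (Lp.memLp l)
  set C : ENNReal := 2 ^ Module.finrank ℝ E * ∑ _i : ι, ENNReal.ofReal R with hC
  have hCtop : C ≠ ⊤ := by
    refine ENNReal.mul_ne_top (by simp) ?_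
    simp [ENNReal.mul_eq_top]
  have hsmall : Tendsto (fun t : ℝ => ENNReal.ofReal (t * (K * D)) * C +
      eLpNorm (contractionAverage η (Ω.indicator l) t - Ω.indicator l) 2 (volume.restrict Ω))
      (𝓝[>] 0) (𝓝 0) := by
    have h1 : Tendsto (fun t : ℝ => ENNReal.ofReal (t * (K * D))) (𝓝[>] 0) (𝓝 0) := by
      have : Continuous fun t : ℝ => ENNReal.ofReal (t * (K * D)) :=
        ENNReal.continuous_ofReal.comp (by fun_prop)
      simpa using (this.tendsto 0).mono_left (nhdsWithin_le_nhds (s := Ioi (0 : ℝ)))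
    simpa using (ENNReal.Tendsto.mul_const h1 (Or.inr hCtop)).add
      (h.tendsto_eLpNorm_contractionAverage_sub hΩm hb hli)
  rw [ENNReal.tendsto_nhds_zero]
  intro ε hε
  have hε2 : 0 < ε / 2 := ENNReal.half_pos hε.ne'
  have hev : ∀ᶠ t : ℝ in 𝓝[>] 0, t < 1 / 2 := nhdsWithin_le_nhds (gt_mem_nhds (by norm_num))
  obtain ⟨t, ⟨htε, ht2⟩, ht0⟩ :=
    (((ENNReal.tendsto_nhds_zero.1 hsmall _ hε2).and hev).and self_mem_nhdsWithin).exists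
  have ht0 : 0 < t := ht0
  have hwk := h.tendsto_contractionAverage_of_weak hΩm hb ht0 (fun k => hx (φ k)) hl
  filter_upwards [ENNReal.tendsto_nhds_zero.1 hwk _ hε2] with k hk
  have hloc : ∀ y : Lp ℝ 2 ((volume : Measure E).restrict Ω),
      LocallyIntegrable (Ω.indicator y) := fun y =>
    ((memLp_indicator_iff_restrict hΩm).2 (Lp.memLp y)).locallyIntegrable (by norm_num)
  have hm : ∀ y : Lp ℝ 2 ((volume : Measure E).restrict Ω),
      AEStronglyMeasurable (contractionAverage η (Ω.indicator y) t) (volume.restrict Ω) := fun y =>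
    (h.contDiff_contractionAverage (hloc y) ht0).continuous.aestronglyMeasurable
  set T := fun y : Lp ℝ 2 ((volume : Measure E).restrict Ω) =>
    contractionAverage η (Ω.indicator y) t with hT
  set xf : E → ℝ := (x (φ k) : E → ℝ) with hxf
  set lf : E → ℝ := (l : E → ℝ) with hlf
  -- Once `t` is fixed, the middle difference is small since `l` is in `L²`, the last is small
  -- uniformly in `k` by the gradient bound, and the first tends to zero since averaging upgrades
  -- weak convergence to strong.
  have hdec : xf - lf =
      ((T (x (φ k)) - T l) + (T l - lf)) - (T (x (φ k)) - xf) := by abel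
  have b1 : eLpNorm (T l - lf) 2 (volume.restrict Ω) =
      eLpNorm (contractionAverage η (Ω.indicator l) t - Ω.indicator l) 2 (volume.restrict Ω) := by
    refine eLpNorm_congr_ae ?_
    filter_upwards [ae_restrict_mem hΩm] with z hz
    simp [hz, hT, hlf]
  have b2 : eLpNorm (T (x (φ k)) - xf) 2 (volume.restrict Ω) ≤
      ENNReal.ofReal (t * (K * D)) * C := by
    refine (h.eLpNorm_contractionAverage_sub_le_of_isWeakGradient hΩm hΩ hb hK0 hK hD (hw (φ k))
      ht0 ht2.le).trans ?_
    rw [hC]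
    gcongr with i
    exact hg _ _
  have m : ∀ y : Lp ℝ 2 ((volume : Measure E).restrict Ω),
      AEStronglyMeasurable (y : E → ℝ) (volume.restrict Ω) := fun y => Lp.aestronglyMeasurable y
  calc eLpNorm (xf - lf) 2 (volume.restrict Ω)
      ≤ (eLpNorm (T (x (φ k)) - T l) 2 (volume.restrict Ω) +
        eLpNorm (T l - lf) 2 (volume.restrict Ω)) +
        eLpNorm (T (x (φ k)) - xf) 2 (volume.restrict Ω) := by
        rw [hdec]
        refine (eLpNorm_sub_le (((hm _).sub (hm _)).add ((hm _).sub (m _)))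
          ((hm _).sub (m _)) (by norm_num)).trans ?_
        gcongr
        exact eLpNorm_add_le ((hm _).sub (hm _)) ((hm _).sub (m _)) (by norm_num)
    _ ≤ ε / 2 + (ENNReal.ofReal (t * (K * D)) * C +
        eLpNorm (contractionAverage η (Ω.indicator l) t - Ω.indicator l) 2
          (volume.restrict Ω)) := by
        rw [b1, add_assoc]
        gcongr ?_ + ?_
        rw [add_comm]
        gcongr
    _ ≤ ε / 2 + ε / 2 := by gcongr
    _ = ε := ENNReal.add_halves ε

end Sobolev

/-! ### Abstract minimisation of a Rayleigh quotient -/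

/-- A quadratic form that is bounded below and has relatively compact energy balls attains its
minimal Rayleigh quotient, and the minimiser solves the weak eigenvalue equation. -/
theorem exists_rayleigh_minimizer {X Y : Type*} [NormedAddCommGroup X] [InnerProductSpace ℝ X]
    [NormedAddCommGroup Y] [InnerProductSpace ℝ Y] [CompleteSpace Y] (V : Submodule ℝ (X × Y))
    (hV : IsClosed (V : Set (X × Y)))
    (hc : ∀ (R : ℝ) (v : ℕ → X × Y), (∀ k, v k ∈ V) → (∀ k, ‖(v k).1‖ ≤ R) →
      (∀ k, ‖(v k).2‖ ≤ R) → ∃ φ : ℕ → ℕ, StrictMono φ ∧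
        ∃ l, Tendsto (fun k => (v (φ k)).1) atTop (𝓝 l))
    (hne : ∃ v ∈ V, v.1 ≠ 0) :
    ∃ m : ℝ, 0 ≤ m ∧ (∃ v ∈ V, v.1 ≠ 0 ∧ ∀ w ∈ V, inner ℝ v.2 w.2 = m * inner ℝ v.1 w.1) ∧
      ∀ w ∈ V, m * ‖w.1‖ ^ 2 ≤ ‖w.2‖ ^ 2 := by
  set S : Set ℝ := {r | ∃ v ∈ V, ‖v.1‖ = 1 ∧ r = ‖v.2‖ ^ 2} with hS
  have hS0 : ∀ r ∈ S, 0 ≤ r := by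
    rintro r ⟨v, -, -, rfl⟩; positivity
  have hnorm : ∀ v ∈ V, v.1 ≠ 0 → ‖v.2‖ ^ 2 / ‖v.1‖ ^ 2 ∈ S := by
    intro v hv hv0
    have hpos : 0 < ‖v.1‖ := norm_pos_iff.2 hv0
    refine ⟨‖v.1‖⁻¹ • v, V.smul_mem _ hv, ?_, ?_⟩
    · simp [norm_smul, hpos.ne']
    · simp only [Prod.smul_snd, norm_smul, norm_inv, norm_norm]
      field_simp
  have hSne : S.Nonempty := by
    obtain ⟨v, hv, hv0⟩ := hne
    exact ⟨_, hnorm v hv hv0⟩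
  have hbdd : BddBelow S := ⟨0, hS0⟩
  set m := sInf S with hm
  have hm0 : 0 ≤ m := le_csInf hSne hS0
  have hlow : ∀ w ∈ V, m * ‖w.1‖ ^ 2 ≤ ‖w.2‖ ^ 2 := by
    intro w hw
    by_cases h0 : w.1 = 0
    · simp [h0]
    · have := csInf_le hbdd (hnorm w hw h0)
      rwa [le_div_iff₀ (by positivity)] at this
  have hex : ∀ k : ℕ, ∃ v ∈ V, ‖v.1‖ = 1 ∧ ‖v.2‖ ^ 2 < m + 1 / ((k : ℝ) + 1) := by
    intro k
    obtain ⟨r, ⟨v, hv, hv1, rfl⟩, hr⟩ := exists_lt_of_csInf_lt hSne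
      (lt_add_of_pos_right m (by positivity : 0 < 1 / ((k : ℝ) + 1)))
    exact ⟨v, hv, hv1, hr⟩
  choose v hvV hv1 hv2 using hex
  have hvb : ∀ k, ‖(v k).2‖ ≤ m + 2 := by
    intro k
    have h1 : 1 / ((k : ℝ) + 1) ≤ 1 := by
      rw [div_le_one (by positivity)]; linarith [Nat.cast_nonneg (α := ℝ) k]
    have h2 := hv2 k
    nlinarith [norm_nonneg (v k).2, sq_nonneg (‖(v k).2‖ - 1)]
  obtain ⟨φ, hφ, l, hl⟩ := hc (m + 2) v hvV (fun k => by rw [hv1]; linarith) hvb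
  set ε : ℕ → ℝ := fun k => 1 / ((φ k : ℝ) + 1) with hε
  have hε0 : Tendsto ε atTop (𝓝 0) := tendsto_one_div_add_atTop_nhds_zero_nat.comp hφ.tendsto_atTop
  -- Compactness only controls first components. The parallelogram law in both spaces, with the
  -- lower bound `m` applied to the sum of two normalised near-minimisers, controls the distance of
  -- the second components by that of the first.
  have hpar : ∀ j k, dist (v (φ j)).2 (v (φ k)).2 ^ 2 ≤
      2 * ε j + 2 * ε k + m * dist (v (φ j)).1 (v (φ k)).1 ^ 2 := by
    intro j k
    have p1 := parallelogram_law_with_norm ℝ (v (φ j)).2 (v (φ k)).2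
    have p2 := parallelogram_law_with_norm ℝ (v (φ j)).1 (v (φ k)).1
    have h1 := hlow _ (V.add_mem (hvV (φ j)) (hvV (φ k)))
    have h2 := hv2 (φ j)
    have h3 := hv2 (φ k)
    simp only [Prod.fst_add, Prod.snd_add, hv1] at h1 p1 p2
    have p2' : ‖(v (φ j)).1 + (v (φ k)).1‖ ^ 2 = 4 - ‖(v (φ j)).1 - (v (φ k)).1‖ ^ 2 := by
      linarith
    rw [p2'] at h1
    rw [dist_eq_norm, dist_eq_norm]
    simp only [hε]
    linarith
  have hcau : CauchySeq fun k => (v (φ k)).2 := by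
    rw [cauchySeq_iff_tendsto_dist_atTop_0]
    have hx := cauchySeq_iff_tendsto_dist_atTop_0.1 hl.cauchySeq
    have t1 : Tendsto (fun n : ℕ × ℕ => ε n.1) atTop (𝓝 0) := by
      rw [← prod_atTop_atTop_eq]; exact hε0.comp tendsto_fst
    have t2 : Tendsto (fun n : ℕ × ℕ => ε n.2) atTop (𝓝 0) := by
      rw [← prod_atTop_atTop_eq]; exact hε0.comp tendsto_snd
    have t3 := (((t1.const_mul 2).add (t2.const_mul 2)).add ((hx.pow 2).const_mul m)).sqrt
    simp only [mul_zero, add_zero, ne_eq, OfNat.ofNat_ne_zero, not_false_eq_true, zero_pow,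
      Real.sqrt_zero] at t3
    exact squeeze_zero (fun _ => dist_nonneg) (fun n => Real.le_sqrt_of_sq_le (hpar n.1 n.2)) t3
  obtain ⟨y, hy⟩ := cauchySeq_tendsto_of_complete hcau
  have hly : (l, y) ∈ V := hV.mem_of_tendsto (hl.prodMk_nhds hy)
    (Eventually.of_forall fun k => hvV (φ k))
  have hl1 : ‖l‖ = 1 := tendsto_nhds_unique hl.norm (by simp [hv1])
  have hym : ‖y‖ ^ 2 ≤ m := by
    refine le_of_tendsto_of_tendsto' (hy.norm.pow 2) (by simpa [hε] using hε0.const_add m)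
      fun k => (hv2 (φ k)).le
  refine ⟨m, hm0, ⟨(l, y), hly, ?_, fun w hw => ?_⟩, hlow⟩
  · intro h; simp [show l = 0 from h] at hl1
  · have hq := hlow w hw
    set q := ‖w.2‖ ^ 2 - m * ‖w.1‖ ^ 2 with hqd
    have hq0 : 0 ≤ q := by linarith
    set p := inner ℝ y w.2 - m * inner ℝ l w.1 with hpd
    -- Expand the minimality inequality at `(l, y) + s w`; its constant term `‖y‖² - m` is at most
    -- zero and can be dropped.
    have hs : ∀ s : ℝ, 0 ≤ 2 * s * p + s ^ 2 * q := by
      intro s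
      have h1 := hlow _ (V.add_mem hly (V.smul_mem s hw))
      simp only [Prod.fst_add, Prod.snd_add, Prod.smul_fst, Prod.smul_snd, norm_add_sq_real,
        real_inner_smul_right, norm_smul, mul_pow, Real.norm_eq_abs, sq_abs, hl1] at h1
      rw [hpd, hqd]
      linarith
    -- The denominator `q + 1` rather than `q` covers the degenerate case `q = 0`; the value is
    -- still strictly negative unless `p = 0`.
    have h2 := hs (-p / (q + 1))
    have h3 : 2 * (-p / (q + 1)) * p + (-p / (q + 1)) ^ 2 * q =
        -(p ^ 2 * (q + 2)) / (q + 1) ^ 2 := by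
      field_simp; ring
    rw [h3, neg_div, Left.nonneg_neg_iff] at h2
    have h4 : p = 0 := by
      by_contra hp
      have : 0 < p ^ 2 * (q + 2) / (q + 1) ^ 2 := by positivity
      linarith
    simp only
    linarith

/-! ### Convergence of integrals along `L²` limits -/

section L2

variable {A : Type*} [MeasurableSpace A] {μ ν : Measure A}

theorem tendsto_integral_mul_of_eLpNorm {f g : ℕ → A → ℝ} {f' g' : A → ℝ}
    (hf : ∀ k, MemLp (f k) 2 μ) (hg : ∀ k, MemLp (g k) 2 μ) (hf' : MemLp f' 2 μ)
    (hg' : MemLp g' 2 μ) (h1 : Tendsto (fun k => eLpNorm (f k - f') 2 μ) atTop (𝓝 0))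
    (h2 : Tendsto (fun k => eLpNorm (g k - g') 2 μ) atTop (𝓝 0)) :
    Tendsto (fun k => ∫ x, f k x * g k x ∂μ) atTop (𝓝 (∫ x, f' x * g' x ∂μ)) := by
  have key : ∀ (a b : A → ℝ) (ha : MemLp a 2 μ) (hb : MemLp b 2 μ),
      inner ℝ ha.toLp hb.toLp = ∫ x, a x * b x ∂μ := by
    intro a b ha hb
    rw [L2.inner_def]
    refine integral_congr_ae ?_
    filter_upwards [ha.coeFn_toLp, hb.coeFn_toLp] with x hx hy
    rw [hx, hy]
    simp [mul_comm]
  have t1 := (Lp.tendsto_Lp_iff_tendsto_eLpNorm'' f hf f' hf').2 h1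
  have t2 := (Lp.tendsto_Lp_iff_tendsto_eLpNorm'' g hg g' hg').2 h2
  have := t1.inner (𝕜 := ℝ) t2
  simpa only [key] using this

theorem tendsto_integral_sq_of_eLpNorm {f : ℕ → A → ℝ} {f' : A → ℝ}
    (hf : ∀ k, MemLp (f k) 2 μ) (hf' : MemLp f' 2 μ)
    (h1 : Tendsto (fun k => eLpNorm (f k - f') 2 μ) atTop (𝓝 0)) :
    Tendsto (fun k => ∫ x, f k x ^ 2 ∂μ) atTop (𝓝 (∫ x, f' x ^ 2 ∂μ)) := by
  simp only [pow_two]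
  exact tendsto_integral_mul_of_eLpNorm hf hf hf' hf' h1 h1

theorem eLpNorm_le_of_measure_le_smul {c : ENNReal} (h : ν ≤ c • μ) (f : A → ℝ) :
    eLpNorm f 2 ν ≤ c ^ (1 / 2 : ℝ) * eLpNorm f 2 μ := by
  refine (eLpNorm_mono_measure f h).trans ?_
  rw [eLpNorm_smul_measure_of_ne_top (by simp)]
  simp

theorem tendsto_eLpNorm_of_measure_le_smul {c : ENNReal} (hc : c ≠ ⊤) (h : ν ≤ c • μ)
    {f : ℕ → A → ℝ} (hf : Tendsto (fun k => eLpNorm (f k) 2 μ) atTop (𝓝 0)) :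
    Tendsto (fun k => eLpNorm (f k) 2 ν) atTop (𝓝 0) := by
  have hc' : c ^ (1 / 2 : ℝ) ≠ ⊤ := ENNReal.rpow_ne_top_of_nonneg (by norm_num) hc
  refine tendsto_of_tendsto_of_tendsto_of_le_of_le tendsto_const_nhds ?_
    (fun _ => zero_le) (fun k => eLpNorm_le_of_measure_le_smul h (f k))
  simpa using ENNReal.Tendsto.const_mul hf (Or.inr hc')

end L2

theorem integrable_mul_of_memLp_two {A : Type*} [MeasurableSpace A] {μ : Measure A} {f g : A → ℝ}
    (hf : MemLp f 2 μ) (hg : MemLp g 2 μ) : Integrable (fun x => f x * g x) μ :=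
  hf.integrable_mul hg

/-! ### Calculus of weak derivatives -/

section Sobolev

variable {E : Type*} [NormedAddCommGroup E] [NormedSpace ℝ E] [FiniteDimensional ℝ E]
  [MeasureSpace E] [BorelSpace E] [(volume : Measure E).IsAddHaarMeasure]

theorem memLp_of_continuous_of_hasCompactSupport {φ : E → ℝ} (h : Continuous φ)
    (hc : HasCompactSupport φ) (Ω : Set E) : MemLp φ 2 (volume.restrict Ω) :=
  (h.memLp_of_hasCompactSupport hc).restrict Ω

theorem memLp_fderiv_of_hasCompactSupport {φ : E → ℝ} (h : ContDiff ℝ ∞ φ)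
    (hc : HasCompactSupport φ) (Ω : Set E) (e : E) :
    MemLp (fun z => fderiv ℝ φ z e) 2 (volume.restrict Ω) := by
  have h1 := h.continuous_fderiv (by simp)
  exact memLp_of_continuous_of_hasCompactSupport (by fun_prop) (hc.fderiv_apply ℝ e) Ω

namespace HasWeakDirDeriv

variable {Ω : Set E} {e : E} {u v g k : E → ℝ}

theorem congr_ae (h : HasWeakDirDeriv Ω e u g) (hu : u =ᵐ[volume.restrict Ω] v)
    (hg : g =ᵐ[volume.restrict Ω] k) : HasWeakDirDeriv Ω e v k := by
  intro φ h1 h2 h3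
  have e1 : ∫ z in Ω, v z * fderiv ℝ φ z e = ∫ z in Ω, u z * fderiv ℝ φ z e :=
    integral_congr_ae (by filter_upwards [hu] with z hz; rw [hz])
  have e2 : ∫ z in Ω, k z * φ z = ∫ z in Ω, g z * φ z :=
    integral_congr_ae (by filter_upwards [hg] with z hz; rw [hz])
  rw [e1, e2, h φ h1 h2 h3]

theorem add (h : HasWeakDirDeriv Ω e u g) (h' : HasWeakDirDeriv Ω e v k)
    (hu : MemLp u 2 (volume.restrict Ω)) (hg : MemLp g 2 (volume.restrict Ω))
    (hv : MemLp v 2 (volume.restrict Ω)) (hk : MemLp k 2 (volume.restrict Ω)) :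
    HasWeakDirDeriv Ω e (u + v) (g + k) := by
  intro φ h1 h2 h3
  have m1 := memLp_of_continuous_of_hasCompactSupport h1.continuous h2 Ω
  have m2 := memLp_fderiv_of_hasCompactSupport h1 h2 Ω e
  simp only [Pi.add_apply, add_mul]
  rw [integral_add (integrable_mul_of_memLp_two hu m2) (integrable_mul_of_memLp_two hv m2),
    integral_add (integrable_mul_of_memLp_two hg m1) (integrable_mul_of_memLp_two hk m1),
    h φ h1 h2 h3, h' φ h1 h2 h3]
  ring

theorem const_smul (h : HasWeakDirDeriv Ω e u g) (c : ℝ) :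
    HasWeakDirDeriv Ω e (c • u) (c • g) := by
  intro φ h1 h2 h3
  simp only [Pi.smul_apply, smul_eq_mul, mul_assoc, integral_const_mul]
  rw [h φ h1 h2 h3]
  ring

/-- For a fixed test function both sides of the defining identity are `L²` inner products, hence
continuous. This is what makes `H¹` closed. -/
theorem of_tendsto {f d : ℕ → E → ℝ} (h : ∀ n, HasWeakDirDeriv Ω e (f n) (d n))
    (hf : ∀ n, MemLp (f n) 2 (volume.restrict Ω)) (hd : ∀ n, MemLp (d n) 2 (volume.restrict Ω))
    (hu : MemLp u 2 (volume.restrict Ω)) (hg : MemLp g 2 (volume.restrict Ω))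
    (h1 : Tendsto (fun n => eLpNorm (f n - u) 2 (volume.restrict Ω)) atTop (𝓝 0))
    (h2 : Tendsto (fun n => eLpNorm (d n - g) 2 (volume.restrict Ω)) atTop (𝓝 0)) :
    HasWeakDirDeriv Ω e u g := by
  intro φ p1 p2 p3
  have m1 := memLp_of_continuous_of_hasCompactSupport p1.continuous p2 Ω
  have m2 := memLp_fderiv_of_hasCompactSupport p1 p2 Ω e
  have t1 := tendsto_integral_mul_of_eLpNorm hf (fun _ => m2) hu m2 h1 (by simp)
  have t2 := tendsto_integral_mul_of_eLpNorm hd (fun _ => m1) hg m1 h2 (by simp)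
  refine tendsto_nhds_unique t1 (t2.neg.congr fun n => ?_)
  exact (h n φ p1 p2 p3).symm

/-- Weak derivatives in `L²` are unique. -/
theorem ae_eq (hΩ : IsOpen Ω) (h : HasWeakDirDeriv Ω e u g) (h' : HasWeakDirDeriv Ω e u k)
    (hg : MemLp g 2 (volume.restrict Ω)) (hk : MemLp k 2 (volume.restrict Ω)) :
    g =ᵐ[volume.restrict Ω] k := by
  have hgk : MemLp (g - k) 2 (volume.restrict Ω) := hg.sub hk
  have hl : LocallyIntegrableOn (g - k) Ω := 
    locallyIntegrableOn_of_locallyIntegrable_restrict (hgk.locallyIntegrable (by norm_num))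
  have := hΩ.ae_eq_zero_of_integral_contDiff_smul_eq_zero (μ := volume) hl ?_
  · filter_upwards [(ae_restrict_iff' hΩ.measurableSet).2 this] with z hz
    simpa [sub_eq_zero] using hz
  · intro φ h1 h2 h3
    have m1 := memLp_of_continuous_of_hasCompactSupport h1.continuous h2 Ω
    have e1 : ∫ z, φ z • (g - k) z = ∫ z in Ω, φ z • (g - k) z := by
      rw [setIntegral_eq_integral_of_forall_compl_eq_zero]
      intro z hz
      rw [image_eq_zero_of_notMem_tsupport (fun hh => hz (h3 hh)), zero_smul]
    rw [e1]
    simp only [smul_eq_mul, Pi.sub_apply, mul_comm (φ _), sub_mul]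
    rw [integral_sub (integrable_mul_of_memLp_two hg m1) (integrable_mul_of_memLp_two hk m1)]
    have a1 := h φ h1 h2 h3
    have a2 := h' φ h1 h2 h3
    linarith

/-- Differentiable functions have their classical derivative as weak derivative. -/
theorem of_contDiff (hu : ContDiff ℝ 1 u) : HasWeakDirDeriv Ω e u (fun z => fderiv ℝ u z e) := by
  intro φ h1 h2 h3
  have c1 := hu.continuous_fderiv one_ne_zero
  have c2 := h1.continuous_fderiv (by simp)
  have e1 : ∫ z in Ω, u z * fderiv ℝ φ z e = ∫ z, u z * fderiv ℝ φ z e := by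
    rw [setIntegral_eq_integral_of_forall_compl_eq_zero]
    intro z hz
    have : fderiv ℝ φ z = 0 := image_eq_zero_of_notMem_tsupport
      (fun hh => hz (h3 (tsupport_fderiv_subset ℝ hh)))
    simp [this]
  have e2 : ∫ z in Ω, fderiv ℝ u z e * φ z = ∫ z, fderiv ℝ u z e * φ z := by
    rw [setIntegral_eq_integral_of_forall_compl_eq_zero]
    intro z hz
    rw [image_eq_zero_of_notMem_tsupport (fun hh => hz (h3 hh)), mul_zero]
  rw [e1, e2]
  refine integral_mul_fderiv_eq_neg_fderiv_mul_of_integrable ?_ ?_ ?_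
    (fun z _ => hu.differentiable one_ne_zero z)
    (fun z _ => h1.differentiable (by simp) z)
  · exact Continuous.integrable_of_hasCompactSupport
      (by have := h1.continuous; fun_prop) h2.mul_left
  · exact Continuous.integrable_of_hasCompactSupport
      (by have := hu.continuous; fun_prop) (h2.fderiv_apply ℝ e).mul_left
  · exact Continuous.integrable_of_hasCompactSupport
      (by have := hu.continuous; have := h1.continuous; fun_prop) h2.mul_left

end HasWeakDirDeriv

namespace IsWeakGradient

variable {ι : Type*} {Ω : Set E} {b : Module.Basis ι ℝ E} {u v : E → ℝ} {g k : ι → E → ℝ}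

theorem congr_ae (h : IsWeakGradient Ω b u g) (hu : u =ᵐ[volume.restrict Ω] v)
    (hg : ∀ i, g i =ᵐ[volume.restrict Ω] k i) : IsWeakGradient Ω b v k where
  memLp := h.memLp.ae_eq hu
  memLp_grad i := (h.memLp_grad i).ae_eq (hg i)
  weakDeriv i := (h.weakDeriv i).congr_ae hu (hg i)

theorem add (h : IsWeakGradient Ω b u g) (h' : IsWeakGradient Ω b v k) :
    IsWeakGradient Ω b (u + v) (g + k) where
  memLp := h.memLp.add h'.memLp
  memLp_grad i := (h.memLp_grad i).add (h'.memLp_grad i)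
  weakDeriv i := (h.weakDeriv i).add (h'.weakDeriv i) h.memLp (h.memLp_grad i) h'.memLp
    (h'.memLp_grad i)

theorem const_smul (h : IsWeakGradient Ω b u g) (c : ℝ) :
    IsWeakGradient Ω b (c • u) (c • g) where
  memLp := h.memLp.const_smul c
  memLp_grad i := (h.memLp_grad i).const_smul c
  weakDeriv i := (h.weakDeriv i).const_smul c

theorem of_contDiff (hb : Bornology.IsBounded Ω) (hu : ContDiff ℝ 1 u) :
    IsWeakGradient Ω b u (fun i z => fderiv ℝ u z (b i)) := by
  have hL : ∀ f : E → ℝ, Continuous f → MemLp f 2 (volume.restrict Ω) := by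
    intro f hf
    have : ProperSpace E := FiniteDimensional.proper_real E
    have hK : IsCompact (closure Ω) := hb.isCompact_closure
    obtain ⟨C, hC⟩ := hK.exists_bound_of_continuousOn hf.continuousOn
    have : IsFiniteMeasure (volume.restrict (closure Ω)) := ⟨by simpa using hK.measure_lt_top⟩
    have h1 : MemLp f 2 (volume.restrict (closure Ω)) := MemLp.of_bound hf.aestronglyMeasurable C
      ((ae_restrict_mem isClosed_closure.measurableSet).mono hC)
    exact h1.mono_measure (Measure.restrict_mono subset_closure le_rfl)
  have c1 := hu.continuous_fderiv one_ne_zero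
  exact ⟨hL u hu.continuous, fun i => hL _ (by fun_prop), fun i => .of_contDiff hu⟩

end IsWeakGradient

/-- A weakly constant function on an open bounded convex set is almost everywhere constant. -/
theorem IsMollifier.exists_ae_eq_const {ι : Type*} [Fintype ι] {Ω : Set E} {η : E → ℝ}
    (h : IsMollifier Ω η) (hΩo : IsOpen Ω)
    (hΩ : Convex ℝ Ω) (hb : Bornology.IsBounded Ω) {b : Module.Basis ι ℝ E} {u : E → ℝ}
    {g : ι → E → ℝ} (hu : IsWeakGradient Ω b u g) (hg : ∀ i, g i =ᵐ[volume.restrict Ω] 0) :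
    ∃ c : ℝ, ∀ᵐ z ∂volume.restrict Ω, u z = c := by
  have hu0 : IsWeakGradient Ω b u (fun _ _ => 0) :=
    hu.congr_ae (Eventually.of_forall fun _ => rfl) hg
  have hΩm := hΩo.measurableSet
  have hui : MemLp (Ω.indicator u) 2 := (memLp_indicator_iff_restrict hΩm).2 hu.memLp
  have hl := hui.locallyIntegrable (by norm_num)
  obtain ⟨K, hK0, hK⟩ := exists_coord_bound b
  have hD : ∀ x ∈ Ω, ∀ y ∈ Ω, ‖x - y‖ ≤ Metric.diam Ω := fun x hx y hy => by
    rw [← dist_eq_norm]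
    exact Metric.dist_le_diam_of_mem hb hx hy
  have h2 : (0 : ℝ) < 1 / 2 := by norm_num
  -- With zero gradient the estimate says that `u` agrees almost everywhere with its average already
  -- at the fixed value `t = 1/2`. The average is smooth with vanishing derivative on the connected
  -- set `Ω`.
  have key :=
    h.eLpNorm_contractionAverage_sub_le_of_isWeakGradient hΩm hΩ hb hK0 hK hD hu0 h2 le_rfl
  set f := contractionAverage η (Ω.indicator u) (1 / 2) with hf
  have hfs : ContDiff ℝ ∞ f := h.contDiff_contractionAverage hl h2
  have hz : eLpNorm (f - u) 2 (volume.restrict Ω) = 0 := by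
    refine le_antisymm (key.trans ?_) zero_le
    simp
  rw [eLpNorm_eq_zero_iff (hfs.continuous.aestronglyMeasurable.sub hu.memLp.aestronglyMeasurable)
    (by norm_num)] at hz
  have hd : EqOn (fderiv ℝ f) 0 Ω := by
    intro z hz
    refine ContinuousLinearMap.coe_injective (b.ext fun i => ?_)
    have := h.fderiv_contractionAverage hΩm hΩ hl (hu0.weakDeriv i) h2 (by norm_num) hz
    simp only [ContinuousLinearMap.coe_coe]
    rw [hf, this]
    simp [contractionAverage]
  obtain ⟨c, hc⟩ := hΩo.exists_is_const_of_fderiv_eq_zero hΩ.isPreconnected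
    (hfs.differentiable (by simp)).differentiableOn hd
  refine ⟨c, ?_⟩
  filter_upwards [hz, ae_restrict_mem hΩm] with z h1 h2
  have h3 := hc z h2
  simp only [Pi.sub_apply, Pi.zero_apply, sub_eq_zero] at h1
  rw [← h1, h3]

end Sobolev

/-! ### Reflection domains and their lowest odd eigenvalue -/

section Sobolev

variable {E : Type*} [NormedAddCommGroup E] [NormedSpace ℝ E] [FiniteDimensional ℝ E]
  [MeasureSpace E] [BorelSpace E] [(volume : Measure E).IsAddHaarMeasure]
  {ι : Type*}

/-- A bounded convex domain `Ω`, invariant under a linear reflection `σ` that maps each basis vector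
to plus or minus itself, and a reflection invariant weight `ν` on `Ω` comparable with volume. -/
structure IsReflectionDomain (Ω : Set E) (b : Module.Basis ι ℝ E) (σ : E →L[ℝ] E) (s : ι → ℝ)
    (ν : Measure E) : Prop where
  isOpen : IsOpen Ω
  nonempty : Ω.Nonempty
  convex : Convex ℝ Ω
  isBounded : Bornology.IsBounded Ω
  involutive : ∀ z, σ (σ z) = z
  map_mem : ∀ z ∈ Ω, σ z ∈ Ω
  map_basis : ∀ i, σ (b i) = s i • b i
  sign_mul_self : ∀ i, s i * s i = 1
  measurePreserving_volume : MeasurePreserving σ volume volume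
  measurePreserving : MeasurePreserving σ ν ν
  le_volume : ∃ c : ENNReal, c ≠ ⊤ ∧ ν ≤ c • volume.restrict Ω
  volume_le : ∃ c : ENNReal, c ≠ ⊤ ∧ volume.restrict Ω ≤ c • ν

namespace IsReflectionDomain

variable {Ω : Set E} {b : Module.Basis ι ℝ E} {σ : E →L[ℝ] E} {s : ι → ℝ} {ν : Measure E}

theorem memLp_iff (h : IsReflectionDomain Ω b σ s ν) {f : E → ℝ} :
    MemLp f 2 ν ↔ MemLp f 2 (volume.restrict Ω) := by
  obtain ⟨c, hc, h1⟩ := h.le_volume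
  obtain ⟨c', hc', h2⟩ := h.volume_le
  exact ⟨fun hf => hf.of_measure_le_smul hc' h2, fun hf => hf.of_measure_le_smul hc h1⟩

theorem ae_eq (h : IsReflectionDomain Ω b σ s ν) : ae ν = ae (volume.restrict Ω) := by
  obtain ⟨c, hc, h1⟩ := h.le_volume
  obtain ⟨c', hc', h2⟩ := h.volume_le
  refine le_antisymm ?_ ?_
  · exact (Measure.absolutelyContinuous_of_le_smul h1).ae_le
  · exact (Measure.absolutelyContinuous_of_le_smul h2).ae_le

theorem tendsto_iff (h : IsReflectionDomain Ω b σ s ν) {f : ℕ → E → ℝ} :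
    Tendsto (fun k => eLpNorm (f k) 2 ν) atTop (𝓝 0) ↔
      Tendsto (fun k => eLpNorm (f k) 2 (volume.restrict Ω)) atTop (𝓝 0) := by
  obtain ⟨c, hc, h1⟩ := h.le_volume
  obtain ⟨c', hc', h2⟩ := h.volume_le
  exact ⟨tendsto_eLpNorm_of_measure_le_smul hc' h2, tendsto_eLpNorm_of_measure_le_smul hc h1⟩

theorem preimage_eq (h : IsReflectionDomain Ω b σ s ν) : σ ⁻¹' Ω = Ω := by
  ext z
  refine ⟨fun hz => ?_, h.map_mem z⟩
  rw [← h.involutive z]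
  exact h.map_mem _ hz

theorem measurePreserving_restrict (h : IsReflectionDomain Ω b σ s ν) :
    MeasurePreserving σ ((volume : Measure E).restrict Ω) (volume.restrict Ω) := by
  have := h.measurePreserving_volume.restrict_preimage h.isOpen.measurableSet
  rwa [h.preimage_eq] at this

theorem measurableEmbedding (h : IsReflectionDomain Ω b σ s ν) : MeasurableEmbedding σ :=
  (MeasurableEquiv.mk (Function.Involutive.toPerm σ h.involutive) σ.measurable
    σ.measurable).measurableEmbedding

/-- The reflection as a homeomorphism. -/
def homeomorph (h : IsReflectionDomain Ω b σ s ν) : E ≃ₜ E where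
  toEquiv := Function.Involutive.toPerm σ h.involutive
  continuous_toFun := σ.continuous
  continuous_invFun := σ.continuous

theorem hasCompactSupport_comp (h : IsReflectionDomain Ω b σ s ν) {φ : E → ℝ}
    (hφ : HasCompactSupport φ) : HasCompactSupport (φ ∘ σ) :=
  hφ.comp_homeomorph h.homeomorph

/-- A bump is averaged with its mirror image. The symmetry of `η` is what makes contraction averages
of odd functions odd. -/
theorem exists_mollifier (h : IsReflectionDomain Ω b σ s ν) :
    ∃ η, IsMollifier Ω η ∧ ∀ z, η (σ z) = η z := by
  obtain ⟨c, hc⟩ := h.nonempty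
  obtain ⟨r, hr, hrΩ⟩ := Metric.nhds_basis_closedBall.mem_iff.1 (h.isOpen.mem_nhds hc)
  let f : ContDiffBump c := ⟨r / 2, r, by positivity, by linarith⟩
  set ρ : E → ℝ := f.normed volume with hρ
  have hρs : ContDiff ℝ ∞ ρ := f.contDiff_normed
  have hρc : HasCompactSupport ρ := f.hasCompactSupport_normed
  have hρt : tsupport ρ ⊆ Ω := by
    rw [hρ, f.tsupport_normed_eq]
    exact hrΩ
  have hρσt : tsupport (ρ ∘ σ) ⊆ σ ⁻¹' tsupport ρ :=
    tsupport_comp_subset_preimage ρ σ.continuous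
  have hσs : ContDiff ℝ ∞ (ρ ∘ σ) := hρs.comp σ.contDiff
  have hσt : tsupport (ρ ∘ σ) ⊆ Ω := hρσt.trans fun z hz => by
    rw [← h.preimage_eq]
    exact hρt hz
  have hσc : HasCompactSupport (ρ ∘ σ) := h.hasCompactSupport_comp hρc
  have hint : ∫ z, ρ z = 1 := f.integral_normed
  have hi : Integrable ρ := hρs.continuous.integrable_of_hasCompactSupport hρc
  have hi' : Integrable (ρ ∘ σ) := hσs.continuous.integrable_of_hasCompactSupport hσc
  refine ⟨fun z => (1 / 2) * (ρ z + (ρ ∘ σ) z), ⟨?_, ?_, ?_, ?_, ?_⟩, fun z => ?_⟩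
  · exact contDiff_const.mul (hρs.add hσs)
  · exact (hρc.add hσc).mul_left
  · refine (tsupport_mul_subset_right (f := fun _ => (1 / 2 : ℝ))).trans ?_
    exact (tsupport_add ρ (ρ ∘ σ)).trans (union_subset hρt hσt)
  · intro z
    have h1 := f.nonneg_normed (μ := volume) z
    have h2 := f.nonneg_normed (μ := volume) (σ z)
    simp only [Function.comp_apply, hρ]
    linarith
  · rw [integral_const_mul, integral_add hi hi']
    have : ∫ z, (ρ ∘ σ) z = 1 := by
      rw [← hint]
      exact h.measurePreserving_volume.integral_comp h.measurableEmbedding ρ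
    rw [this, hint]; norm_num
  · simp only [Function.comp_apply, h.involutive]
    ring

theorem contractionAverage_odd (h : IsReflectionDomain Ω b σ s ν) {η u : E → ℝ}
    (hη : ∀ z, η (σ z) = η z) (hu : ∀ᵐ z ∂(volume.restrict Ω), u (σ z) = - u z) {t : ℝ}
    (ht : 0 < t) (z : E) :
    contractionAverage η (Ω.indicator u) t (σ z) = - contractionAverage η (Ω.indicator u) t z := by
  have hU : (Ω.indicator u) ∘ σ =ᵐ[volume] -(Ω.indicator u) := by
    rw [EventuallyEq]
    filter_upwards [(ae_restrict_iff' h.isOpen.measurableSet).1 hu] with z hz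
    have hiff : σ z ∈ Ω ↔ z ∈ Ω := by
      conv_rhs => rw [← h.preimage_eq]
      rfl
    by_cases hzΩ : z ∈ Ω
    · simp [hzΩ, hiff.2 hzΩ, hz hzΩ]
    · simp [hzΩ, mt hiff.1 hzΩ]
  have e1 : contractionAverage η (Ω.indicator u) t (σ z) =
      contractionAverage η ((Ω.indicator u) ∘ σ) t z := by
    rw [contractionAverage, contractionAverage,
      ← h.measurePreserving_volume.integral_comp h.measurableEmbedding]
    simp [hη]
  rw [e1, contractionAverage_congr_ae η hU ht]
  simp [contractionAverage, integral_neg]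

/-- Substituting `σ z` for `z` moves the reflection onto the test function, whose derivative along
`b i` picks up the sign `s i`; because `s i * s i = 1`, the sign can be moved to the other side. -/
theorem hasWeakDirDeriv_comp (h : IsReflectionDomain Ω b σ s ν) {u g : E → ℝ} {i : ι}
    (hu : HasWeakDirDeriv Ω (b i) u g) : HasWeakDirDeriv Ω (b i) (u ∘ σ) (s i • (g ∘ σ)) := by
  intro φ h1 h2 h3
  have hψ1 : ContDiff ℝ ∞ (φ ∘ σ) := h1.comp σ.contDiff
  have hψt : tsupport (φ ∘ σ) ⊆ σ ⁻¹' tsupport φ := tsupport_comp_subset_preimage φ σ.continuous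
  have hψ2 : HasCompactSupport (φ ∘ σ) := h.hasCompactSupport_comp h2
  have hψ3 : tsupport (φ ∘ σ) ⊆ Ω := hψt.trans fun z hz => by
    rw [← h.preimage_eq]
    exact h3 hz
  have hd : ∀ z, fderiv ℝ (φ ∘ σ) z (b i) = s i * fderiv ℝ φ (σ z) (b i) := by
    intro z
    rw [fderiv_comp z (h1.differentiable (by simp) _) σ.differentiableAt]
    simp [h.map_basis]
  have key := hu _ hψ1 hψ2 hψ3
  have mp := h.measurePreserving_restrict
  rw [← mp.integral_comp h.measurableEmbedding, ← mp.integral_comp h.measurableEmbedding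
    (fun z => (s i • (g ∘ σ)) z * φ z)]
  simp only [hd, Function.comp_apply, Pi.smul_apply, smul_eq_mul, h.involutive, mul_assoc,
    integral_const_mul] at key ⊢
  simp only [mul_left_comm _ (s i), integral_const_mul] at key
  have hs := h.sign_mul_self i
  calc ∫ z in Ω, u z * fderiv ℝ φ (σ z) (b i)
      = (s i * s i) * ∫ z in Ω, u z * fderiv ℝ φ (σ z) (b i) := by rw [hs, one_mul]
    _ = s i * (s i * ∫ z in Ω, u z * fderiv ℝ φ (σ z) (b i)) := by ring
    _ = _ := by rw [key]; ring

theorem isWeakGradient_comp (h : IsReflectionDomain Ω b σ s ν) {u : E → ℝ} {g : ι → E → ℝ}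
    (hu : IsWeakGradient Ω b u g) :
    IsWeakGradient Ω b (u ∘ σ) (fun i => s i • (g i ∘ σ)) where
  memLp := hu.memLp.comp_measurePreserving h.measurePreserving_restrict
  memLp_grad i :=
    ((hu.memLp_grad i).comp_measurePreserving h.measurePreserving_restrict).const_smul _
  weakDeriv i := h.hasWeakDirDeriv_comp (hu.weakDeriv i)

/-- The weak gradient of an odd function. -/
theorem grad_comp_ae_eq_of_odd (h : IsReflectionDomain Ω b σ s ν) {u : E → ℝ} {g : ι → E → ℝ}
    (hu : IsWeakGradient Ω b u g) (hodd : ∀ᵐ z ∂ν, u (σ z) = - u z) (i : ι) :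
    ∀ᵐ z ∂ν, g i (σ z) = - (s i * g i z) := by
  rw [h.ae_eq] at hodd ⊢
  have h1 := (h.isWeakGradient_comp hu).congr_ae (v := (-1 : ℝ) • u)
    (by filter_upwards [hodd] with z hz; simp [hz]) (fun _ => EventuallyEq.rfl)
  have h2 := hu.const_smul (-1)
  have h3 := (h1.weakDeriv i).ae_eq h.isOpen (h2.weakDeriv i) (h1.memLp_grad i) (h2.memLp_grad i)
  filter_upwards [h3] with z hz
  simp only [Pi.smul_apply, Function.comp_apply, smul_eq_mul] at hz
  have hs := h.sign_mul_self i
  calc g i (σ z) = s i * s i * g i (σ z) := by rw [hs, one_mul]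
    _ = _ := by rw [mul_assoc, hz]; ring

variable [Fintype ι]

/-- `H¹` functions that are odd under the reflection, together with their gradients. -/
def oddSubmodule (h : IsReflectionDomain Ω b σ s ν) :
    Submodule ℝ (Lp ℝ 2 ν × PiLp 2 (fun _ : ι => Lp ℝ 2 ν)) where
  carrier := {v | IsWeakGradient Ω b v.1 (fun i => v.2 i) ∧ ∀ᵐ z ∂ν, v.1 (σ z) = - v.1 z}
  zero_mem' := by
    have e : ((0 : Lp ℝ 2 ν) : E → ℝ) =ᵐ[volume.restrict Ω] 0 := by
      rw [EventuallyEq, ← h.ae_eq]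
      exact Lp.coeFn_zero _ _ _
    have h0 : IsWeakGradient Ω b (0 : E → ℝ) (fun _ => 0) :=
      ⟨MemLp.zero, fun _ => MemLp.zero, fun i φ _ _ _ => by simp⟩
    refine ⟨h0.congr_ae e.symm fun _ => e.symm, ?_⟩
    have e0 := Lp.coeFn_zero ℝ 2 ν
    filter_upwards [e0, h.measurePreserving.quasiMeasurePreserving.ae e0] with z h1 h2
    simp only [Prod.fst_zero]
    rw [h1, h2]
    simp
  add_mem' := by
    rintro v w ⟨hv, hv'⟩ ⟨hw, hw'⟩
    have e : ∀ x y : Lp ℝ 2 ν,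
        (x : E → ℝ) + (y : E → ℝ) =ᵐ[volume.restrict Ω] ((x + y : Lp ℝ 2 ν) : E → ℝ) := by
      intro x y
      rw [EventuallyEq, ← h.ae_eq]
      exact (Lp.coeFn_add _ _).symm
    refine ⟨(hv.add hw).congr_ae (e _ _) fun i => e _ _, ?_⟩
    have e0 := Lp.coeFn_add v.1 w.1
    filter_upwards [e0, h.measurePreserving.quasiMeasurePreserving.ae e0, hv', hw']
      with z h1 h2 h3 h4
    simp only [Prod.fst_add]
    rw [h1, h2]
    simp only [Pi.add_apply, h3, h4]
    ring
  smul_mem' := by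
    rintro c v ⟨hv, hv'⟩
    have e : ∀ x : Lp ℝ 2 ν,
        c • (x : E → ℝ) =ᵐ[volume.restrict Ω] ((c • x : Lp ℝ 2 ν) : E → ℝ) := by
      intro x
      rw [EventuallyEq, ← h.ae_eq]
      exact (Lp.coeFn_smul _ _).symm
    refine ⟨(hv.const_smul c).congr_ae (e _) fun i => e _, ?_⟩
    have e0 := Lp.coeFn_smul c v.1
    filter_upwards [e0, h.measurePreserving.quasiMeasurePreserving.ae e0, hv'] with z h1 h2 h3
    simp only [Prod.smul_fst]
    rw [h1, h2]
    simp only [Pi.smul_apply, h3, smul_eq_mul]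
    ring

/-- Weak gradients pass to `L²` limits by testing. Oddness does too: `σ` preserves `ν`, so the norm
of `w ∘ σ + w` is at most twice the distance from `w` to any odd function. -/
theorem isClosed_oddSubmodule (h : IsReflectionDomain Ω b σ s ν) :
    IsClosed (h.oddSubmodule : Set (Lp ℝ 2 ν × PiLp 2 (fun _ : ι => Lp ℝ 2 ν))) := by
  refine IsSeqClosed.isClosed fun v w hv hvw => ?_
  have m : ∀ x : Lp ℝ 2 ν, MemLp x 2 (volume.restrict Ω) := fun x => h.memLp_iff.1 (Lp.memLp x)
  have t1 : Tendsto (fun k => eLpNorm ((v k).1 - w.1 : E → ℝ) 2 ν) atTop (𝓝 0) :=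
    (Lp.tendsto_Lp_iff_tendsto_eLpNorm' _ _).1 ((continuous_fst.tendsto w).comp hvw)
  have t2 : ∀ i, Tendsto (fun k => eLpNorm ((v k).2 i - w.2 i : E → ℝ) 2 ν) atTop (𝓝 0) := by
    intro i
    have : Continuous fun p : Lp ℝ 2 ν × PiLp 2 (fun _ : ι => Lp ℝ 2 ν) => p.2 i :=
      (PiLp.continuous_apply 2 _ i).comp continuous_snd
    exact (Lp.tendsto_Lp_iff_tendsto_eLpNorm' _ _).1 ((this.tendsto w).comp hvw)
  refine ⟨⟨m _, fun i => m _, fun i => ?_⟩, ?_⟩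
  · exact HasWeakDirDeriv.of_tendsto (fun k => (hv k).1.weakDeriv i) (fun k => m _) (fun k => m _)
      (m _) (m _) (h.tendsto_iff.1 t1) (h.tendsto_iff.1 (t2 i))
  · have hm : ∀ x : Lp ℝ 2 ν, AEStronglyMeasurable (fun z => x (σ z)) ν := fun x =>
      (Lp.aestronglyMeasurable x).comp_measurePreserving h.measurePreserving
    have hle : ∀ k, eLpNorm (fun z => w.1 (σ z) + w.1 z) 2 ν ≤
        eLpNorm ((v k).1 - w.1 : E → ℝ) 2 ν + eLpNorm ((v k).1 - w.1 : E → ℝ) 2 ν := by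
      intro k
      have hd : AEStronglyMeasurable ((v k).1 - w.1 : E → ℝ) ν :=
        (Lp.aestronglyMeasurable _).sub (Lp.aestronglyMeasurable _)
      have e1 : eLpNorm (((v k).1 - w.1 : E → ℝ) ∘ σ) 2 ν = eLpNorm ((v k).1 - w.1 : E → ℝ) 2 ν :=
        eLpNorm_comp_measurePreserving hd h.measurePreserving
      have e2 : (fun z => w.1 (σ z) + w.1 z) =ᵐ[ν]
          -(((v k).1 - w.1 : E → ℝ) ∘ σ + ((v k).1 - w.1 : E → ℝ)) := by
        filter_upwards [(hv k).2] with z hz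
        simp only [Pi.neg_apply, Pi.add_apply, Function.comp_apply, Pi.sub_apply, hz]
        ring
      rw [eLpNorm_congr_ae e2, eLpNorm_neg]
      refine (eLpNorm_add_le (hd.comp_measurePreserving h.measurePreserving) hd
        (by norm_num)).trans ?_
      rw [e1]
    have hz : eLpNorm (fun z => w.1 (σ z) + w.1 z) 2 ν = 0 := by
      refine le_antisymm (ge_of_tendsto' (x := atTop) ?_ hle) zero_le
      simpa using t1.add t1
    have hme : AEStronglyMeasurable (fun z => w.1 (σ z) + w.1 z) ν :=
      (hm _).add (Lp.aestronglyMeasurable _)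
    rw [eLpNorm_eq_zero_iff hme (by norm_num)] at hz
    filter_upwards [hz] with z hz
    exact eq_neg_of_add_eq_zero_left hz

/-- Rellich's theorem lives on Lebesgue measure. The two-sided comparison of `ν` with volume carries
the bounds there and the limit back. -/
theorem exists_subseq_of_oddSubmodule (h : IsReflectionDomain Ω b σ s ν) (R : ℝ)
    (v : ℕ → Lp ℝ 2 ν × PiLp 2 (fun _ : ι => Lp ℝ 2 ν)) (hv : ∀ k, v k ∈ h.oddSubmodule)
    (h1 : ∀ k, ‖(v k).1‖ ≤ R) (h2 : ∀ k, ‖(v k).2‖ ≤ R) :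
    ∃ φ : ℕ → ℕ, StrictMono φ ∧ ∃ l, Tendsto (fun k => (v (φ k)).1) atTop (𝓝 l) := by
  obtain ⟨η, hη, -⟩ := h.exists_mollifier
  obtain ⟨c, hc, hcν⟩ := h.volume_le
  have hR : 0 ≤ R := (norm_nonneg _).trans (h1 0)
  set C : ENNReal := c ^ (1 / 2 : ℝ) with hC
  have hCtop : C ≠ ⊤ := ENNReal.rpow_ne_top_of_nonneg (by norm_num) hc
  have m : ∀ x : Lp ℝ 2 ν, MemLp x 2 (volume.restrict Ω) := fun x => h.memLp_iff.1 (Lp.memLp x)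
  have hb : ∀ x : Lp ℝ 2 ν, ‖x‖ ≤ R →
      eLpNorm x 2 (volume.restrict Ω) ≤ ENNReal.ofReal (C.toReal * R) := by
    intro x hx
    refine (eLpNorm_le_of_measure_le_smul hcν x).trans ?_
    rw [ENNReal.ofReal_mul ENNReal.toReal_nonneg, ENNReal.ofReal_toReal hCtop]
    gcongr
    rw [Lp.norm_def] at hx
    exact (ENNReal.le_ofReal_iff_toReal_le (Lp.eLpNorm_ne_top x) hR).2 hx
  have hw : ∀ k, IsWeakGradient Ω b (m (v k).1).toLp (fun i => (v k).2 i) := fun k =>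
    (hv k).1.congr_ae (m (v k).1).coeFn_toLp.symm fun _ => EventuallyEq.rfl
  have hn : ∀ k, ‖(m (v k).1).toLp‖ ≤ C.toReal * R := fun k => by
    rw [Lp.norm_toLp]
    exact ENNReal.toReal_le_of_le_ofReal (by positivity) (hb _ (h1 k))
  obtain ⟨φ, hφ, l, hl⟩ := exists_subseq_tendsto_of_isWeakGradient hη h.isOpen.measurableSet
    h.convex h.isBounded hw hn
    fun k i => hb _ ((PiLp.norm_apply_le _ i).trans (h2 k))
  have ml : MemLp l 2 ν := h.memLp_iff.2 (Lp.memLp l)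
  refine ⟨φ, hφ, ml.toLp, ?_⟩
  have t1 := (Lp.tendsto_Lp_iff_tendsto_eLpNorm' _ _).1 hl
  have t2 : Tendsto (fun k => eLpNorm ((v (φ k)).1 - l : E → ℝ) 2 (volume.restrict Ω))
      atTop (𝓝 0) := by
    refine t1.congr fun k => eLpNorm_congr_ae ?_
    filter_upwards [(m (v (φ k)).1).coeFn_toLp] with z hz
    simp [hz]
  refine (Lp.tendsto_Lp_iff_tendsto_eLpNorm' _ _).2 ((h.tendsto_iff.2 t2).congr fun k =>
    eLpNorm_congr_ae ?_)
  filter_upwards [ml.coeFn_toLp] with z hz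
  simp [hz]

/-- The lowest Neumann eigenvalue with odd eigenfunctions exists and is positive. -/
theorem exists_odd_eigenfunction (h : IsReflectionDomain Ω b σ s ν)
    (hne : ∃ u g, IsWeakGradient Ω b u g ∧ (∀ᵐ z ∂ν, u (σ z) = - u z) ∧ ¬ (∀ᵐ z ∂ν, u z = 0)) :
    ∃ (m : ℝ) (u : E → ℝ) (g : ι → E → ℝ), 0 < m ∧ IsWeakGradient Ω b u g ∧
      (∀ᵐ z ∂ν, u (σ z) = - u z) ∧ ¬ (∀ᵐ z ∂ν, u z = 0) ∧
      (∀ v dv, IsWeakGradient Ω b v dv →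
        ∑ i, ∫ z, g i z * dv i z ∂ν = m * ∫ z, u z * v z ∂ν) ∧
      ∀ v dv, IsWeakGradient Ω b v dv → (∀ᵐ z ∂ν, v (σ z) = - v z) →
        m * ∫ z, v z ^ 2 ∂ν ≤ ∑ i, ∫ z, dv i z ^ 2 ∂ν := by
  have key : ∀ (x y : E → ℝ) (hx : MemLp x 2 ν) (hy : MemLp y 2 ν),
      inner ℝ hx.toLp hy.toLp = ∫ z, x z * y z ∂ν := by
    intro x y hx hy
    rw [L2.inner_def]
    refine integral_congr_ae ?_
    filter_upwards [hx.coeFn_toLp, hy.coeFn_toLp] with z h1 h2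
    rw [h1, h2]
    simp [mul_comm]
  have key2 : ∀ (x : Lp ℝ 2 ν) (y : E → ℝ) (hy : MemLp y 2 ν),
      inner ℝ x hy.toLp = ∫ z, x z * y z ∂ν := by
    intro x y hy
    rw [← key x y (Lp.memLp x) hy, Lp.toLp_coeFn]
  have mL : ∀ {u : E → ℝ} {g : ι → E → ℝ}, IsWeakGradient Ω b u g → MemLp u 2 ν := fun hu =>
    h.memLp_iff.2 hu.memLp
  have mG : ∀ {u : E → ℝ} {g : ι → E → ℝ}, IsWeakGradient Ω b u g → ∀ i, MemLp (g i) 2 ν :=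
    fun hu i => h.memLp_iff.2 (hu.memLp_grad i)
  have hmem : ∀ (u : E → ℝ) (g : ι → E → ℝ) (hu : IsWeakGradient Ω b u g),
      (∀ᵐ z ∂ν, u (σ z) = - u z) →
      ((mL hu).toLp, WithLp.toLp 2 fun i => (mG hu i).toLp) ∈ h.oddSubmodule := by
    intro u g hu ho
    have c : ∀ (f : E → ℝ) (hf : MemLp f 2 ν), f =ᵐ[volume.restrict Ω] hf.toLp := by
      intro f hf
      rw [EventuallyEq, ← h.ae_eq]
      exact hf.coeFn_toLp.symm
    refine ⟨hu.congr_ae (c _ (mL hu)) fun i => c _ (mG hu i), ?_⟩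
    have e0 := (mL hu).coeFn_toLp
    filter_upwards [e0, h.measurePreserving.quasiMeasurePreserving.ae e0, ho] with z h1 h2 h3
    rw [h1, h2, h3]
  obtain ⟨m, hm0, ⟨⟨x, y⟩, ⟨hw, ho⟩, hx0, heq⟩, hlow⟩ := exists_rayleigh_minimizer h.oddSubmodule
    h.isClosed_oddSubmodule h.exists_subseq_of_oddSubmodule (by
      obtain ⟨u, g, hu, ho, hn⟩ := hne
      refine ⟨_, hmem u g hu ho, fun h0 => hn ?_⟩
      have h1 := (mL hu).coeFn_toLp
      simp only at h0
      rw [h0] at h1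
      filter_upwards [h1, Lp.coeFn_zero ℝ 2 ν] with z h2 h3
      rw [← h2, h3]; rfl)
  simp only at hw ho hx0 heq
  have hx0' : ¬ (∀ᵐ z ∂ν, x z = 0) := fun hz => hx0 ((Lp.eq_zero_iff_ae_eq_zero).2 hz)
  have heq' : ∀ v dv, IsWeakGradient Ω b v dv → (∀ᵐ z ∂ν, v (σ z) = - v z) →
      ∑ i, ∫ z, y i z * dv i z ∂ν = m * ∫ z, x z * v z ∂ν := by
    intro v dv hv hvo
    have := heq _ (hmem v dv hv hvo)
    simpa only [PiLp.inner_apply, key2] using this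
  have hlow' : ∀ v dv, IsWeakGradient Ω b v dv → (∀ᵐ z ∂ν, v (σ z) = - v z) →
      m * ∫ z, v z ^ 2 ∂ν ≤ ∑ i, ∫ z, dv i z ^ 2 ∂ν := by
    intro v dv hv hvo
    have := hlow _ (hmem v dv hv hvo)
    rw [← real_inner_self_eq_norm_sq, ← real_inner_self_eq_norm_sq] at this
    simpa only [PiLp.inner_apply, key, pow_two] using this
  -- If `m` were zero, the gradient of the minimiser would vanish, so the minimiser would be a
  -- constant that is odd, that is, zero.
  have hmpos : m ≠ 0 := by
    intro hm
    have h1 := heq' _ _ hw ho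
    rw [hm, zero_mul, Finset.sum_eq_zero_iff_of_nonneg
      (fun i _ => integral_nonneg fun z => mul_self_nonneg _)] at h1
    have hg : ∀ i, (y i : E → ℝ) =ᵐ[volume.restrict Ω] 0 := by
      intro i
      have h2 := h1 i (Finset.mem_univ i)
      rw [integral_eq_zero_iff_of_nonneg (fun z => mul_self_nonneg _)
        (integrable_mul_of_memLp_two (Lp.memLp _) (Lp.memLp _))] at h2
      rw [EventuallyEq, ← h.ae_eq]
      filter_upwards [h2] with z hz
      simpa using hz
    obtain ⟨η, hη, -⟩ := h.exists_mollifier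
    obtain ⟨c, hc⟩ := hη.exists_ae_eq_const h.isOpen h.convex h.isBounded hw hg
    rw [← h.ae_eq] at hc
    refine hx0' ?_
    filter_upwards [hc, ho, h.measurePreserving.quasiMeasurePreserving.ae hc] with z h1 h2 h3
    rw [h1, h3] at h2
    rw [h1]
    linarith
  refine ⟨m, x, fun i => y i, lt_of_le_of_ne hm0 hmpos.symm, hw, ho, hx0', fun v dv hv => ?_,
    hlow'⟩
  -- Minimality gives the equation for odd test functions only. For general `v`, test with the odd
  -- function `v - v ∘ σ`: since `x` is odd and its gradient has matching parities, both sides are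
  -- twice their values at `v`.
  have hσ := h.isWeakGradient_comp hv
  have hsub := hv.add (hσ.const_smul (-1))
  have hso : ∀ᵐ z ∂ν, (v + (-1 : ℝ) • (v ∘ σ)) (σ z) = - (v + (-1 : ℝ) • (v ∘ σ)) z := by
    refine Eventually.of_forall fun z => ?_
    simp only [Pi.add_apply, Pi.smul_apply, Function.comp_apply, smul_eq_mul, h.involutive]
    ring
  have e := heq' _ _ hsub hso
  have c1 : ∫ z, x z * (v + (-1 : ℝ) • (v ∘ σ)) z ∂ν = 2 * ∫ z, x z * v z ∂ν := by
    have a1 : ∫ z, x z * v (σ z) ∂ν = - ∫ z, x z * v z ∂ν := by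
      rw [← h.measurePreserving.integral_comp h.measurableEmbedding, ← integral_neg]
      refine integral_congr_ae ?_
      filter_upwards [ho] with z hz
      rw [hz, h.involutive]; ring
    have i1 := integrable_mul_of_memLp_two (Lp.memLp x) (mL hv)
    have i2 := integrable_mul_of_memLp_two (Lp.memLp x) (mL hσ)
    have : ∀ z, x z * (v + (-1 : ℝ) • (v ∘ σ)) z = x z * v z - x z * (v ∘ σ) z := fun z => by
      simp only [Pi.add_apply, Pi.smul_apply, smul_eq_mul]; ring
    simp only [this]
    rw [integral_sub i1 i2]
    simp only [Function.comp_apply, a1]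
    ring
  have c2 : ∀ i, ∫ z, y i z * (dv + (-1 : ℝ) • fun i => s i • (dv i ∘ σ)) i z ∂ν =
      2 * ∫ z, y i z * dv i z ∂ν := by
    intro i
    have a1 : ∫ z, y i z * (s i • (dv i ∘ σ)) z ∂ν = - ∫ z, y i z * dv i z ∂ν := by
      rw [← h.measurePreserving.integral_comp h.measurableEmbedding, ← integral_neg]
      refine integral_congr_ae ?_
      filter_upwards [h.grad_comp_ae_eq_of_odd hw ho i] with z hz
      rw [hz]
      simp only [Pi.smul_apply, Function.comp_apply, h.involutive, smul_eq_mul]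
      linear_combination (-(y i z * dv i z)) * h.sign_mul_self i
    have i1 := integrable_mul_of_memLp_two (Lp.memLp (y i)) (mG hv i)
    have i2 := integrable_mul_of_memLp_two (Lp.memLp (y i)) (mG hσ i)
    have : ∀ z, y i z * (dv + (-1 : ℝ) • fun i => s i • (dv i ∘ σ)) i z =
        y i z * dv i z - y i z * (s i • (dv i ∘ σ)) z := fun z => by
      simp only [Pi.add_apply, Pi.smul_apply, smul_eq_mul]; ring
    simp only [this]
    rw [integral_sub i1 i2, a1]
    ring
  rw [c1] at e
  simp only [c2, ← Finset.mul_sum] at e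
  linarith

end IsReflectionDomain

end Sobolev

/-! ### The Gaussian weight, and the two concrete reflection domains -/

section Comparison

variable {E : Type*} [NormedAddCommGroup E] [NormedSpace ℝ E] [FiniteDimensional ℝ E]
  [MeasurableSpace E] [BorelSpace E]

/-- A measure with continuous positive density is comparable with the reference measure on bounded
sets. -/
theorem exists_comparable_withDensity (μ : Measure E) [SFinite μ] {ρ : E → ℝ} (hρ : Continuous ρ)
    (hpos : ∀ z, 0 < ρ z) {Ω : Set E} (hΩ : MeasurableSet Ω) (hb : Bornology.IsBounded Ω) :
    (∃ c : ENNReal, c ≠ ⊤ ∧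
      (μ.withDensity fun z => ENNReal.ofReal (ρ z)).restrict Ω ≤ c • μ.restrict Ω) ∧
    ∃ c : ENNReal, c ≠ ⊤ ∧
      μ.restrict Ω ≤ c • (μ.withDensity fun z => ENNReal.ofReal (ρ z)).restrict Ω := by
  have : ProperSpace E := FiniteDimensional.proper_real E
  have hK : IsCompact (closure Ω) := hb.isCompact_closure
  have hinv : Continuous fun z => (ρ z)⁻¹ := hρ.inv₀ fun z => (hpos z).ne'
  obtain ⟨C, hC⟩ := hK.exists_bound_of_continuousOn hρ.continuousOn
  obtain ⟨D, hD⟩ := hK.exists_bound_of_continuousOn hinv.continuousOn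
  have hm : Measurable fun z => ENNReal.ofReal (ρ z) := hρ.measurable.ennreal_ofReal
  rw [restrict_withDensity hΩ]
  refine ⟨⟨ENNReal.ofReal C, by simp, ?_⟩, ⟨ENNReal.ofReal D, by simp, ?_⟩⟩
  · rw [← withDensity_const]
    refine withDensity_mono ?_
    filter_upwards [ae_restrict_mem hΩ] with z hz
    exact ENNReal.ofReal_le_ofReal ((Real.le_norm_self _).trans (hC z (subset_closure hz)))
  · rw [← withDensity_smul _ hm]
    conv_lhs => rw [← withDensity_one (μ := μ.restrict Ω)]
    refine withDensity_mono ?_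
    filter_upwards [ae_restrict_mem hΩ] with z hz
    have h1 : (ρ z)⁻¹ ≤ D := (Real.le_norm_self _).trans (hD z (subset_closure hz))
    simp only [Pi.one_apply, Pi.smul_apply, smul_eq_mul]
    rw [← ENNReal.ofReal_mul ((inv_pos.2 (hpos z)).le.trans h1), ENNReal.one_le_ofReal]
    calc (1 : ℝ) = (ρ z)⁻¹ * ρ z := (inv_mul_cancel₀ (hpos z).ne').symm
      _ ≤ D * ρ z := mul_le_mul_of_nonneg_right h1 (hpos z).le

end Comparison

theorem continuous_gaussianPDFReal : Continuous (gaussianPDFReal 0 1) := by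
  unfold gaussianPDFReal
  fun_prop

theorem gamma1_eq_withDensity :
    gamma1 = volume.withDensity fun x => ENNReal.ofReal (gaussianPDFReal 0 1 x) := by
  rw [gamma1, gaussianReal_of_var_ne_zero _ one_ne_zero]
  rfl

theorem gamma2_eq_withDensity :
    gamma2 = volume.withDensity fun z : ℝ × ℝ =>
      ENNReal.ofReal (gaussianPDFReal 0 1 z.1 * gaussianPDFReal 0 1 z.2) := by
  have hm : Measurable fun x => ENNReal.ofReal (gaussianPDFReal 0 1 x) :=
    continuous_gaussianPDFReal.measurable.ennreal_ofReal
  rw [gamma2, gamma1_eq_withDensity, prod_withDensity hm hm, Measure.volume_eq_prod]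
  congr 1
  funext z
  rw [ENNReal.ofReal_mul (gaussianPDFReal_nonneg _ _ _)]

instance gamma1.instIsProbabilityMeasure : IsProbabilityMeasure gamma1 := by
  unfold gamma1; infer_instance

instance gamma1.instNullSingletonClass : NullSingletonClass gamma1 := by
  rw [gamma1]; exact nullSingletonClass_gaussianReal one_ne_zero

theorem measurePreserving_neg_gamma1 : MeasurePreserving (fun x : ℝ => -x) gamma1 gamma1 :=
  ⟨measurable_neg, by rw [gamma1]; simpa using gaussianReal_map_neg (μ := 0) (v := 1)⟩

/-- The reflection of the line. -/
noncomputable def lineReflection : ℝ →L[ℝ] ℝ := -(ContinuousLinearMap.id ℝ ℝ)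

@[simp] theorem lineReflection_apply (x : ℝ) : lineReflection x = -x := rfl

/-- The reflection of the plane in the vertical axis. -/
noncomputable def planeReflection : ℝ × ℝ →L[ℝ] ℝ × ℝ :=
  lineReflection.prodMap (ContinuousLinearMap.id ℝ ℝ)

@[simp] theorem planeReflection_apply (z : ℝ × ℝ) : planeReflection z = (-z.1, z.2) := rfl

theorem MeasureTheory.MeasurePreserving.restrict_of_preimage_eq {A : Type*} [MeasurableSpace A]
    {μ : Measure A} {f : A → A} (h : MeasurePreserving f μ μ) {Ω : Set A} (hΩ : MeasurableSet Ω)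
    (he : f ⁻¹' Ω = Ω) : MeasurePreserving f (μ.restrict Ω) (μ.restrict Ω) := by
  have := h.restrict_preimage hΩ
  rwa [he] at this

theorem isReflectionDomain_interval {a : ℝ} (ha : 0 < a) :
    IsReflectionDomain (Ioo (-a) a) (Module.Basis.singleton Unit ℝ) lineReflection (fun _ => -1)
      (gamma1.restrict (Ioo (-a) a)) := by
  have hcomp := exists_comparable_withDensity (volume : Measure ℝ) continuous_gaussianPDFReal
    (fun x => gaussianPDFReal_pos 0 1 x one_ne_zero) (measurableSet_Ioo (a := -a) (b := a))
    (Metric.isBounded_Ioo _ _)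
  rw [← gamma1_eq_withDensity] at hcomp
  have hpre : lineReflection ⁻¹' Ioo (-a) a = Ioo (-a) a := by
    ext x
    simp only [mem_preimage, lineReflection_apply, mem_Ioo]
    constructor <;> rintro ⟨h1, h2⟩ <;> constructor <;> linarith
  refine ⟨isOpen_Ioo, ⟨0, by simpa using ha⟩, convex_Ioo _ _, Metric.isBounded_Ioo _ _,
    fun z => by simp, fun z hz => ?_, fun i => by simp, fun i => by simp, Measure.measurePreserving_neg volume,
    measurePreserving_neg_gamma1.restrict_of_preimage_eq measurableSet_Ioo hpre, hcomp.1, hcomp.2⟩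
  rw [← hpre] at hz
  exact hz

theorem isReflectionDomain_planar {Ω : Set (ℝ × ℝ)} (ho : IsOpen Ω) (hne : Ω.Nonempty)
    (hc : Convex ℝ Ω) (hb : Bornology.IsBounded Ω) (hs : ∀ x y : ℝ, (x, y) ∈ Ω → (-x, y) ∈ Ω) :
    IsReflectionDomain Ω (Module.Basis.finTwoProd ℝ) planeReflection ![-1, 1]
      (gamma2.restrict Ω) := by
  have hcomp := exists_comparable_withDensity (volume : Measure (ℝ × ℝ))
    (ρ := fun z => gaussianPDFReal 0 1 z.1 * gaussianPDFReal 0 1 z.2)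
    ((continuous_gaussianPDFReal.comp continuous_fst).mul
      (continuous_gaussianPDFReal.comp continuous_snd))
    (fun z => mul_pos (gaussianPDFReal_pos 0 1 _ one_ne_zero)
      (gaussianPDFReal_pos 0 1 _ one_ne_zero)) ho.measurableSet hb
  rw [← gamma2_eq_withDensity] at hcomp
  have hpre : planeReflection ⁻¹' Ω = Ω := by
    ext z
    refine ⟨fun h => ?_, fun h => hs _ _ h⟩
    have := hs _ _ h
    simpa using this
  have hγ : MeasurePreserving planeReflection gamma2 gamma2 :=
    measurePreserving_neg_gamma1.prod (MeasurePreserving.id gamma1)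
  have hvol : MeasurePreserving planeReflection volume volume :=
    (Measure.measurePreserving_neg (volume : Measure ℝ)).prod (MeasurePreserving.id volume)
  refine ⟨ho, hne, hc, hb, fun z => by simp, fun z hz => hs _ _ hz, fun i => ?_, fun i => ?_, hvol,
    hγ.restrict_of_preimage_eq ho.measurableSet hpre, hcomp.1, hcomp.2⟩
  · fin_cases i <;> simp
  · fin_cases i <;> simp

theorem isWeakGradient_interval_iff {a : ℝ} (ha : 0 < a) {z : ℝ → ℝ} {g : Unit → ℝ → ℝ} :
    IsWeakGradient (Ioo (-a) a) (Module.Basis.singleton Unit ℝ) z g ↔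
      IsH1Interval (-a) a z (g ()) := by
  have h := isReflectionDomain_interval ha
  constructor
  · intro hz
    exact ⟨h.memLp_iff.2 hz.memLp, h.memLp_iff.2 (hz.memLp_grad ()), by
      simpa using hz.weakDeriv ()⟩
  · intro hz
    exact ⟨h.memLp_iff.1 hz.memLp, fun _ => h.memLp_iff.1 hz.memLp_deriv, fun _ => by
      simpa using hz.weakDeriv⟩

theorem IsReflectionDomain.isWeakGradient_planar_iff {Ω : Set (ℝ × ℝ)}
    (h : IsReflectionDomain Ω (Module.Basis.finTwoProd ℝ) planeReflection ![-1, 1]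
      (gamma2.restrict Ω)) {u : ℝ × ℝ → ℝ} {g : Fin 2 → ℝ × ℝ → ℝ} :
    IsWeakGradient Ω (Module.Basis.finTwoProd ℝ) u g ↔ IsH1Planar Ω u (g 0) (g 1) := by
  constructor
  · intro hz
    exact ⟨h.memLp_iff.2 hz.memLp, h.memLp_iff.2 (hz.memLp_grad 0), h.memLp_iff.2 (hz.memLp_grad 1),
      by simpa using hz.weakDeriv 0, by simpa using hz.weakDeriv 1⟩
  · intro hz
    refine ⟨h.memLp_iff.1 hz.memLp, fun i => ?_, fun i => ?_⟩
    · fin_cases i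
      · exact h.memLp_iff.1 hz.memLp_x
      · exact h.memLp_iff.1 hz.memLp_y
    · fin_cases i
      · simpa using hz.weakDeriv_x
      · simpa using hz.weakDeriv_y

/-! ### The odd Poincaré inequality on an interval and its localisation -/

/-- The Poincaré inequality with constant `m` for odd functions on `(-a, a)`. -/
def OddPoincare (a m : ℝ) : Prop :=
  ∀ v dv : ℝ → ℝ, IsH1Interval (-a) a v dv →
    (∀ᵐ x ∂(gamma1.restrict (Ioo (-a) a)), v (-x) = - v x) →
    m * ∫ x in Ioo (-a) a, v x ^ 2 ∂gamma1 ≤ ∫ x in Ioo (-a) a, dv x ^ 2 ∂gamma1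

/-- Extending by a constant creates corners, so the function is not `C¹`. The fundamental theorem of
calculus with a countable exceptional set, applied to `F φ`, still gives integration by parts; `φ`
vanishes at both end points. -/
theorem hasWeakDirDeriv_of_hasDerivAt_off_countable {F F' : ℝ → ℝ} {s : Set ℝ} {α β : ℝ}
    (hαβ : α ≤ β) (hs : s.Countable) (hF : Continuous F) (hd : ∀ x ∉ s, HasDerivAt F (F' x) x)
    (hF' : IntervalIntegrable F' volume α β) : HasWeakDirDeriv (Ioo α β) 1 F F' := by
  intro φ h1 h2 h3
  have hα : φ α = 0 := image_eq_zero_of_notMem_tsupport fun h => lt_irrefl _ (h3 h).1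
  have hβ : φ β = 0 := image_eq_zero_of_notMem_tsupport fun h => lt_irrefl _ (h3 h).2
  have hφd : ∀ x, HasDerivAt φ (fderiv ℝ φ x 1) x := fun x =>
    (h1.differentiable (by simp) x).hasFDerivAt.hasDerivAt
  have c1 := h1.continuous_fderiv (by simp)
  have i1 : IntervalIntegrable (fun x => F' x * φ x) volume α β :=
    hF'.mul_continuousOn h1.continuous.continuousOn
  have i2 : IntervalIntegrable (fun x => F x * fderiv ℝ φ x 1) volume α β :=
    Continuous.intervalIntegrable (by fun_prop) _ _
  have key := integral_eq_of_hasDerivAt_off_countable_of_le (fun x => F x * φ x)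
    (fun x => F' x * φ x + F x * fderiv ℝ φ x 1) hαβ hs
    (hF.mul h1.continuous).continuousOn (fun x hx => (hd x hx.2).mul (hφd x)) (i1.add i2)
  rw [intervalIntegral.integral_add i1 i2, hα, hβ, intervalIntegral.integral_of_le hαβ,
    intervalIntegral.integral_of_le hαβ, integral_Ioc_eq_integral_Ioo,
    integral_Ioc_eq_integral_Ioo] at key
  linarith

/-- Derivative of the function equal to `f` on `[0, l]` and constant outside. -/
theorem hasDerivAt_comp_clamp {f : ℝ → ℝ} (hf : ContDiff ℝ 1 f) {l : ℝ} (hl : 0 < l) {x : ℝ}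
    (hx : x ∉ ({0, l} : Set ℝ)) :
    HasDerivAt (fun x => f (max 0 (min x l))) ((Ioo 0 l).indicator (deriv f) x) x := by
  simp only [mem_insert_iff, mem_singleton_iff, not_or] at hx
  rcases lt_or_gt_of_ne hx.1 with h0 | h0
  · rw [indicator_of_notMem (fun h => lt_asymm h0 h.1)]
    refine (hasDerivAt_const x (f 0)).congr_of_eventuallyEq ?_
    filter_upwards [gt_mem_nhds h0] with y hy
    rw [min_eq_left (by linarith), max_eq_left hy.le]
  · rcases lt_or_gt_of_ne hx.2 with h1 | h1
    · rw [indicator_of_mem (show x ∈ Ioo 0 l from ⟨h0, h1⟩)]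
      refine (hf.differentiable one_ne_zero x).hasDerivAt.congr_of_eventuallyEq ?_
      filter_upwards [lt_mem_nhds h0, gt_mem_nhds h1] with y hy hy'
      rw [min_eq_left hy'.le, max_eq_right hy.le]
    · rw [indicator_of_notMem (fun h => lt_asymm h1 h.2)]
      refine (hasDerivAt_const x (f l)).congr_of_eventuallyEq ?_
      filter_upwards [lt_mem_nhds h1] with y hy
      rw [min_eq_right hy.le, max_eq_right hl.le]

theorem integrableOn_gamma1_of_continuous {f : ℝ → ℝ} (hf : Continuous f) (α β : ℝ) :
    IntegrableOn f (Ioo α β) gamma1 :=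
  (hf.continuousOn.integrableOn_compact isCompact_Icc).mono_set Ioo_subset_Icc_self

theorem integral_Ioo_comp_neg (f : ℝ → ℝ) (a : ℝ) :
    ∫ x in Ioo (-a) a, f (-x) ∂gamma1 = ∫ x in Ioo (-a) a, f x ∂gamma1 := by
  have hpre : (fun x : ℝ => -x) ⁻¹' Ioo (-a) a = Ioo (-a) a := by
    ext x
    simp only [mem_preimage, mem_Ioo]
    constructor <;> rintro ⟨h1, h2⟩ <;> constructor <;> linarith
  exact (measurePreserving_neg_gamma1.restrict_of_preimage_eq measurableSet_Ioo hpre).integral_comp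
    (MeasurableEquiv.neg ℝ).measurableEmbedding f

/-- A function vanishing at the left end point satisfies the odd Poincaré inequality on each
shorter interval: extend it by a constant and reflect. -/
theorem OddPoincare.integral_Ioo_zero_le {a m : ℝ} (h : OddPoincare a m) (hm : 0 ≤ m) {l : ℝ}
    (hl : 0 < l) (hla : l ≤ a) {f : ℝ → ℝ} (hf : ContDiff ℝ 1 f) (hf0 : f 0 = 0) :
    m * ∫ x in Ioo 0 l, f x ^ 2 ∂gamma1 ≤ ∫ x in Ioo 0 l, deriv f x ^ 2 ∂gamma1 := by
  have ha : 0 < a := hl.trans_le hla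
  have hdom := isReflectionDomain_interval ha
  set G : ℝ → ℝ := fun x => f (max 0 (min x l)) with hG
  set G' : ℝ → ℝ := (Ioo 0 l).indicator (deriv f) with hG'
  have hGc : Continuous G := by
    have := hf.continuous
    fun_prop
  have hdc : Continuous (deriv f) := hf.continuous_deriv le_rfl
  obtain ⟨C, hC⟩ := isCompact_Icc.exists_bound_of_continuousOn (s := Icc 0 l) hdc.continuousOn
  have hC0 : 0 ≤ C := (norm_nonneg _).trans (hC 0 ⟨le_rfl, hl.le⟩)
  have hG'm : Measurable G' := hdc.measurable.indicator measurableSet_Ioo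
  have hG'b : ∀ x, ‖G' x‖ ≤ C := by
    intro x
    by_cases hx : x ∈ Ioo 0 l
    · rw [hG', indicator_of_mem hx]; exact hC x (Ioo_subset_Icc_self hx)
    · rw [hG', indicator_of_notMem hx]; simpa using hC0
  have hGw : IsWeakGradient (Ioo (-a) a) (Module.Basis.singleton Unit ℝ) G (fun _ => G') := by
    rw [isWeakGradient_interval_iff ha]
    refine ⟨hdom.memLp_iff.2 ?_, MemLp.of_bound hG'm.aestronglyMeasurable C
      (Eventually.of_forall hG'b), ?_⟩
    · obtain ⟨D, hD⟩ := isCompact_Icc.exists_bound_of_continuousOn (s := Icc (-a) a)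
        hGc.continuousOn
      exact MemLp.of_bound hGc.aestronglyMeasurable D
        ((ae_restrict_mem measurableSet_Ioo).mono fun x hx => hD x (Ioo_subset_Icc_self hx))
    · refine hasWeakDirDeriv_of_hasDerivAt_off_countable (by linarith)
        ((finite_singleton l).insert 0).countable hGc
        (fun x hx => hasDerivAt_comp_clamp hf hl hx) ?_
      rw [intervalIntegrable_iff]
      exact Measure.integrableOn_of_bounded (by simp) hG'm.aestronglyMeasurable
        (Eventually.of_forall hG'b)
  -- The competitor is the odd function `G x - G (-x)`. As `f 0 = 0`, `G` vanishes on the negative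
  -- half-line, so the two terms never interact.
  have hw := (isWeakGradient_interval_iff ha).1
    (hGw.add ((hdom.isWeakGradient_comp hGw).const_smul (-1)))
  have key := h _ _ hw (Eventually.of_forall fun x => by simp)
  have hi : ∀ {k : ℝ → ℝ}, Measurable k → (∃ D, ∀ x ∈ Ioo 0 l, ‖k x‖ ≤ D) →
      IntegrableOn ((Ioo 0 l).indicator k) (Ioo (-a) a) gamma1 := by
    rintro k hk ⟨D, hD⟩
    refine (Measure.integrableOn_of_bounded (M := max D 0) (by simp)
      (hk.indicator measurableSet_Ioo).aestronglyMeasurable (Eventually.of_forall fun x => ?_))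
    by_cases hx : x ∈ Ioo 0 l
    · rw [indicator_of_mem hx]; exact (hD x hx).trans (le_max_left _ _)
    · rw [indicator_of_notMem hx]; simp
  have hint : ∀ k : ℝ → ℝ, ∫ x in Ioo (-a) a, (Ioo 0 l).indicator k x ∂gamma1 =
      ∫ x in Ioo 0 l, k x ∂gamma1 := by
    intro k
    rw [integral_indicator measurableSet_Ioo, Measure.restrict_restrict measurableSet_Ioo,
      inter_eq_left.2 (Ioo_subset_Ioo (by linarith) hla)]
  have hneg : ∀ {k : ℝ → ℝ}, IntegrableOn k (Ioo (-a) a) gamma1 →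
      IntegrableOn (fun x => k (-x)) (Ioo (-a) a) gamma1 := by
    intro k hk
    exact hdom.measurePreserving.integrable_comp_of_integrable hk
  obtain ⟨D, hD⟩ := isCompact_Icc.exists_bound_of_continuousOn (s := Icc 0 l)
    hf.continuous.continuousOn
  have I1 : IntegrableOn ((Ioo 0 l).indicator fun x => f x ^ 2) (Ioo (-a) a) gamma1 :=
    hi (hf.continuous.measurable.pow_const 2) ⟨D ^ 2, fun x hx => by
      rw [norm_pow]
      exact pow_le_pow_left₀ (norm_nonneg _) (hD x (Ioo_subset_Icc_self hx)) 2⟩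
  have I2 : IntegrableOn ((Ioo 0 l).indicator fun x => deriv f x ^ 2) (Ioo (-a) a) gamma1 :=
    hi (hdc.measurable.pow_const 2) ⟨C ^ 2, fun x hx => by
      rw [norm_pow]
      exact pow_le_pow_left₀ (norm_nonneg _) (hC x (Ioo_subset_Icc_self hx)) 2⟩
  have e1 : ∀ k : ℝ → ℝ, IntegrableOn ((Ioo 0 l).indicator k) (Ioo (-a) a) gamma1 →
      ∫ x in Ioo (-a) a, ((Ioo 0 l).indicator k x + (Ioo 0 l).indicator k (-x)) ∂gamma1 =
      2 * ∫ x in Ioo 0 l, k x ∂gamma1 := by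
    intro k hk
    rw [integral_add hk (hneg hk), integral_Ioo_comp_neg ((Ioo 0 l).indicator k), hint]
    ring
  -- Only an inequality: where `|x| ≥ l` the competitor is a constant whose square is discarded.
  have L1 : 2 * ∫ x in Ioo 0 l, f x ^ 2 ∂gamma1 ≤
      ∫ x in Ioo (-a) a, (G + (-1 : ℝ) • (G ∘ lineReflection)) x ^ 2 ∂gamma1 := by
    rw [← e1 _ I1]
    refine integral_mono (I1.add (hneg I1)) hw.memLp.integrable_sq fun x => ?_
    simp only [Pi.add_apply, Pi.smul_apply, Function.comp_apply, lineReflection_apply, smul_eq_mul]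
    by_cases hx : x ∈ Ioo 0 l
    · have hx' : -x ∉ Ioo 0 l := fun h' => by linarith [h'.1, hx.1]
      rw [indicator_of_mem hx, indicator_of_notMem hx']
      have g1 : G x = f x := by
        simp only [hG]; rw [min_eq_left hx.2.le, max_eq_right hx.1.le]
      have g2 : G (-x) = 0 := by
        simp only [hG]
        rw [min_eq_left (by linarith [hx.1]), max_eq_left (by linarith [hx.1]), hf0]
      rw [g1, g2]; simp
    · rw [indicator_of_notMem hx]
      by_cases hx' : -x ∈ Ioo 0 l
      · rw [indicator_of_mem hx']
        have g1 : G (-x) = f (-x) := by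
          simp only [hG]; rw [min_eq_left hx'.2.le, max_eq_right hx'.1.le]
        have g2 : G x = 0 := by
          simp only [hG]
          rw [min_eq_left (by linarith [hx'.1]), max_eq_left (by linarith [hx'.1]), hf0]
        rw [g1, g2]; simp
      · rw [indicator_of_notMem hx']
        simpa using sq_nonneg _
  -- Here equality holds, because the derivative of the constant extension is zero.
  have L2 : ∫ x in Ioo (-a) a,
      ((fun _ : Unit => G') + (-1 : ℝ) • fun _ : Unit => (-1 : ℝ) • (G' ∘ lineReflection)) () x ^ 2
        ∂gamma1 = 2 * ∫ x in Ioo 0 l, deriv f x ^ 2 ∂gamma1 := by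
    rw [← e1 _ I2]
    refine integral_congr_ae (Eventually.of_forall fun x => ?_)
    simp only [Pi.add_apply, Pi.smul_apply, Function.comp_apply, lineReflection_apply, smul_eq_mul,
      hG']
    by_cases hx : x ∈ Ioo 0 l
    · have hx' : -x ∉ Ioo 0 l := fun h' => by linarith [h'.1, hx.1]
      simp only [indicator_of_mem hx, indicator_of_notMem hx']
      ring
    · by_cases hx' : -x ∈ Ioo 0 l
      · simp only [indicator_of_notMem hx, indicator_of_mem hx']; ring
      · simp only [indicator_of_notMem hx, indicator_of_notMem hx']; ring
  have := (mul_le_mul_of_nonneg_left L1 hm).trans (key.trans L2.le)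
  linarith

theorem integral_Ioo_neg_eq {f : ℝ → ℝ} (hf : Continuous f) {l : ℝ} (hl : 0 < l) :
    ∫ x in Ioo (-l) l, f x ∂gamma1 =
      ∫ x in Ioo 0 l, f (-x) ∂gamma1 + ∫ x in Ioo 0 l, f x ∂gamma1 := by
  have hIf : ∀ α β : ℝ, IntervalIntegrable f gamma1 α β := fun α β => hf.intervalIntegrable _ _
  have e : ∫ x in Ioo (-l) 0, f x ∂gamma1 = ∫ x in Ioo 0 l, f (-x) ∂gamma1 := by
    have hpre : (fun x : ℝ => -x) ⁻¹' Ioo (-l) 0 = Ioo 0 l := by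
      ext x
      simp only [mem_preimage, mem_Ioo]
      constructor <;> rintro ⟨h1, h2⟩ <;> constructor <;> linarith
    rw [← hpre]
    exact (measurePreserving_neg_gamma1.setIntegral_preimage_emb
      (MeasurableEquiv.neg ℝ).measurableEmbedding f _).symm
  rw [← e]
  simp only [← integral_Ioc_eq_integral_Ioo]
  rw [← intervalIntegral.integral_of_le (by linarith), ← intervalIntegral.integral_of_le
    (by linarith), ← intervalIntegral.integral_of_le hl.le]
  exact (intervalIntegral.integral_add_adjacent_intervals (hIf _ _) (hIf _ _)).symm

/-- The odd Poincaré inequality controls the deviation of a function from its value at zero, on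
each shorter symmetric interval. -/
theorem OddPoincare.integral_Ioo_sub_le {a m : ℝ} (h : OddPoincare a m) (hm : 0 ≤ m) {l : ℝ}
    (hl : 0 < l) (hla : l ≤ a) {f : ℝ → ℝ} (hf : ContDiff ℝ 1 f) :
    m * ∫ x in Ioo (-l) l, (f x - f 0) ^ 2 ∂gamma1 ≤
      ∫ x in Ioo (-l) l, deriv f x ^ 2 ∂gamma1 := by
  have h1 := h.integral_Ioo_zero_le hm hl hla (f := fun x => f x - f 0)
    (hf.sub contDiff_const) (by simp)
  have h2 := h.integral_Ioo_zero_le hm hl hla (f := fun x => f (-x) - f 0)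
    ((hf.comp contDiff_neg).sub contDiff_const) (by simp)
  have hdc : Continuous (deriv f) := hf.continuous_deriv le_rfl
  have hfc := hf.continuous
  rw [integral_Ioo_neg_eq (by fun_prop) hl, integral_Ioo_neg_eq (by fun_prop) hl]
  simp only [deriv_sub_const_fun, deriv_comp_neg, neg_sq] at h1 h2
  linarith

/-- Minimisation needs one nonzero odd competitor. A linear form that changes sign under `σ` is odd,
and a nonzero linear form cannot vanish on an open set. -/
theorem IsReflectionDomain.exists_odd_ne_zero {E : Type*} [NormedAddCommGroup E] [NormedSpace ℝ E]
    [FiniteDimensional ℝ E] [MeasureSpace E] [BorelSpace E] [(volume : Measure E).IsAddHaarMeasure]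
    {ι : Type*} {Ω : Set E} {b : Module.Basis ι ℝ E} {σ : E →L[ℝ] E} {s : ι → ℝ} {ν : Measure E}
    (h : IsReflectionDomain Ω b σ s ν) (L : E →L[ℝ] ℝ) (hL : ∀ z, L (σ z) = - L z) {e : E}
    (he : L e ≠ 0) :
    ∃ u g, IsWeakGradient Ω b u g ∧ (∀ᵐ z ∂ν, u (σ z) = - u z) ∧ ¬ (∀ᵐ z ∂ν, u z = 0) := by
  refine ⟨L, _, IsWeakGradient.of_contDiff h.isBounded L.contDiff, Eventually.of_forall hL,
    fun h0 => ?_⟩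
  rw [h.ae_eq] at h0
  have h1 : EqOn L 0 Ω := Measure.eqOn_open_of_ae_eq h0 h.isOpen L.continuous.continuousOn
    continuousOn_const
  obtain ⟨z, hz⟩ := h.nonempty
  have hev : ∀ᶠ t : ℝ in 𝓝[>] 0, z + t • e ∈ Ω := by
    have hc : Continuous fun t : ℝ => z + t • e := by fun_prop
    exact nhdsWithin_le_nhds (hc.continuousAt.preimage_mem_nhds
      (h.isOpen.mem_nhds (by simpa using hz)))
  obtain ⟨t, ht, ht0⟩ := (hev.and self_mem_nhdsWithin).exists
  have h2 := h1 ht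
  have h3 := h1 hz
  simp only [map_add, map_smul, Pi.zero_apply, smul_eq_mul] at h2 h3
  rw [h3, zero_add] at h2
  exact (mul_ne_zero (ne_of_gt ht0) he) h2

theorem integral_sq_pos_of_not_ae_zero {A : Type*} [MeasurableSpace A] {μ : Measure A} {f : A → ℝ}
    (hf : MemLp f 2 μ) (h0 : ¬ ∀ᵐ x ∂μ, f x = 0) : 0 < ∫ x, f x ^ 2 ∂μ := by
  refine lt_of_le_of_ne (integral_nonneg fun x => sq_nonneg _) fun h => h0 ?_
  rw [eq_comm, integral_eq_zero_iff_of_nonneg (fun x => sq_nonneg _) hf.integrable_sq] at h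
  filter_upwards [h] with x hx
  simpa using hx

theorem exists_odd_eigenfunction_interval {a : ℝ} (ha : 0 < a) :
    ∃ (m : ℝ) (v dv : ℝ → ℝ), 0 < m ∧ IsH1Interval (-a) a v dv ∧
      (∀ᵐ x ∂(gamma1.restrict (Ioo (-a) a)), v (-x) = - v x) ∧
      ¬ (∀ᵐ x ∂(gamma1.restrict (Ioo (-a) a)), v x = 0) ∧
      (∀ w dw, IsH1Interval (-a) a w dw → ∫ x in Ioo (-a) a, dv x * dw x ∂gamma1 =
        m * ∫ x in Ioo (-a) a, v x * w x ∂gamma1) ∧ OddPoincare a m := by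
  have hdom := isReflectionDomain_interval ha
  obtain ⟨m, u, g, hm, hu, ho, hn, heq, hlow⟩ := hdom.exists_odd_eigenfunction
    (hdom.exists_odd_ne_zero (ContinuousLinearMap.id ℝ ℝ) (fun z => by simp) (e := 1) (by simp))
  refine ⟨m, u, g (), hm, (isWeakGradient_interval_iff ha).1 hu, ho, hn, fun w dw hw => ?_,
    fun w dw hw hwo => ?_⟩
  · simpa using heq w (fun _ => dw) ((isWeakGradient_interval_iff ha).2 hw)
  · simpa using hlow w (fun _ => dw) ((isWeakGradient_interval_iff ha).2 hw) hwo

/-- The odd Poincaré inequality implies the Poincaré inequality for functions of mean zero. -/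
theorem OddPoincare.integral_sq_le_of_integral_eq_zero {a m : ℝ} (h : OddPoincare a m) (hm : 0 ≤ m)
    (ha : 0 < a) {z dz : ℝ → ℝ} (hz : IsH1Interval (-a) a z dz)
    (hmean : ∫ x in Ioo (-a) a, z x ∂gamma1 = 0) :
    m * ∫ x in Ioo (-a) a, z x ^ 2 ∂gamma1 ≤ ∫ x in Ioo (-a) a, dz x ^ 2 ∂gamma1 := by
  have hdom := isReflectionDomain_interval ha
  have hw : IsWeakGradient (Ioo (-a) a) (Module.Basis.singleton Unit ℝ) z (fun _ => dz) :=
    (isWeakGradient_interval_iff ha).2 hz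
  obtain ⟨η, hη, -⟩ := hdom.exists_mollifier
  obtain ⟨t, -, hs, h1, h2⟩ := hη.exists_smooth_approximation measurableSet_Ioo hdom.convex
    hdom.isBounded hw
  set f : ℕ → ℝ → ℝ := fun k => contractionAverage η ((Ioo (-a) a).indicator z) (t k)
  have hf1 : ∀ k, ContDiff ℝ 1 (f k) := fun k => (hs k).of_le (by simp)
  have hfw := fun k => (isWeakGradient_interval_iff ha).1
    (IsWeakGradient.of_contDiff (b := Module.Basis.singleton Unit ℝ) hdom.isBounded (hf1 k))
  have h2' := h2 ()
  simp only [Module.Basis.singleton_apply, fderiv_apply_one_eq_deriv] at h2' hfw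
  set M := gamma1.real (Ioo (-a) a) with hM
  have hMpos : 0 < M := by
    have hne : gamma1.restrict (Ioo (-a) a) ≠ 0 := by
      intro h0
      have h3 := hdom.ae_eq
      rw [h0, ae_zero, eq_comm, ae_eq_bot, Measure.restrict_eq_zero, Real.volume_Ioo] at h3
      simp only [ENNReal.ofReal_eq_zero] at h3
      linarith
    refine ENNReal.toReal_pos (fun h0 => hne (Measure.restrict_eq_zero.2 h0)) (measure_ne_top _ _)
  have hone : MemLp (fun _ : ℝ => (1 : ℝ)) 2 (gamma1.restrict (Ioo (-a) a)) := memLp_const 1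
  have t1 := tendsto_integral_sq_of_eLpNorm (fun k => (hfw k).memLp) hz.memLp
    (hdom.tendsto_iff.2 h1)
  have t2 := tendsto_integral_sq_of_eLpNorm (fun k => (hfw k).memLp_deriv) hz.memLp_deriv
    (hdom.tendsto_iff.2 h2')
  have t3 := tendsto_integral_mul_of_eLpNorm (fun k => (hfw k).memLp) (fun _ => hone) hz.memLp hone
    (hdom.tendsto_iff.2 h1) (by simp)
  simp only [mul_one, hmean] at t3
  -- The smooth approximations need not have mean zero, so the inequality is proved for their
  -- variance, multiplied by the total mass `M`; the squared mean disappears in the limit.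
  have hk : ∀ k, m * (M * (∫ x in Ioo (-a) a, f k x ^ 2 ∂gamma1) -
      (∫ x in Ioo (-a) a, f k x ∂gamma1) ^ 2) ≤
      M * ∫ x in Ioo (-a) a, deriv (f k) x ^ 2 ∂gamma1 := by
    intro k
    have key := h.integral_Ioo_sub_le hm ha le_rfl (hf1 k)
    have i1 := integrableOn_gamma1_of_continuous (f := fun x => f k x ^ 2)
      ((hf1 k).continuous.pow 2) (-a) a
    have i2 := integrableOn_gamma1_of_continuous ((hf1 k).continuous) (-a) a
    set c := f k 0
    have e : ∫ x in Ioo (-a) a, (f k x - c) ^ 2 ∂gamma1 =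
        (∫ x in Ioo (-a) a, f k x ^ 2 ∂gamma1) - 2 * c * (∫ x in Ioo (-a) a, f k x ∂gamma1) +
          c ^ 2 * M := by
      have : ∀ x, (f k x - c) ^ 2 = (f k x ^ 2 - 2 * c * f k x) + c ^ 2 := fun x => by ring
      simp only [this]
      have i3 : IntegrableOn (fun x => f k x ^ 2 - 2 * c * f k x) (Ioo (-a) a) gamma1 :=
        i1.sub (i2.const_mul _)
      rw [integral_add i3 (integrable_const _),
        integral_sub i1 (i2.const_mul _), integral_const_mul, setIntegral_const, hM]
      simp [mul_comm]
    rw [e] at key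
    set A := ∫ x in Ioo (-a) a, f k x ∂gamma1
    -- This is the statement that the deviation from the constant `c` is at least the deviation from
    -- the mean `A / M`.
    have h3 := mul_nonneg hm (sq_nonneg (A - c * M))
    have h4 := mul_le_mul_of_nonneg_left key hMpos.le
    nlinarith
  have hlim := le_of_tendsto_of_tendsto'
    ((((t1.const_mul M).sub (t3.pow 2))).const_mul m) (t2.const_mul M) hk
  refine le_of_mul_le_mul_left ?_ hMpos
  nlinarith

/-! ### Slicing planar domains -/

theorem eq_Ioo_of_symmetric {S : Set ℝ} {a : ℝ} (ha : 0 ≤ a) (ho : IsOpen S) (hc : Convex ℝ S)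
    (hs : ∀ x ∈ S, -x ∈ S) (hSa : S ⊆ Ioo (-a) a) : ∃ l, 0 ≤ l ∧ l ≤ a ∧ S = Ioo (-l) l := by
  rcases S.eq_empty_or_nonempty with rfl | hne
  · exact ⟨0, le_rfl, ha, by simp⟩
  have hbdd : BddAbove S := ⟨a, fun x hx => (hSa hx).2.le⟩
  have hlt : ∀ x ∈ S, x < sSup S := by
    intro x hx
    have hev : ∀ᶠ y in 𝓝[>] x, y ∈ S := nhdsWithin_le_nhds (ho.mem_nhds hx)
    obtain ⟨y, hy, hxy⟩ := (hev.and self_mem_nhdsWithin).exists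
    exact lt_of_lt_of_le hxy (le_csSup hbdd hy)
  refine ⟨sSup S, ?_, csSup_le hne fun x hx => (hSa hx).2.le, ?_⟩
  · obtain ⟨x, hx⟩ := hne
    have h1 := hlt x hx
    have h2 := hlt _ (hs x hx)
    linarith
  · ext x
    refine ⟨fun hx => ⟨by linarith [hlt _ (hs x hx)], hlt x hx⟩, fun hx => ?_⟩
    have hmax : |x| < sSup S := abs_lt.2 hx
    obtain ⟨y, hy, hxy⟩ := exists_lt_of_lt_csSup hne hmax
    exact hc.ordConnected.out (hs y hy) hy
      ⟨by linarith [neg_abs_le x], by linarith [le_abs_self x]⟩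

theorem deriv_slice {f : ℝ × ℝ → ℝ} (hf : Differentiable ℝ f) (x y : ℝ) :
    deriv (fun x => f (x, y)) x = fderiv ℝ f (x, y) (1, 0) := by
  have h1 : HasDerivAt (fun x : ℝ => (x, y)) ((1 : ℝ), (0 : ℝ)) x :=
    (hasDerivAt_id x).prodMk (hasDerivAt_const x y)
  exact ((hf (x, y)).hasFDerivAt.comp_hasDerivAt x h1).deriv

section Planar

variable {Ω : Set (ℝ × ℝ)}

theorem setIntegral_gamma2_eq (hΩ : MeasurableSet Ω)
    {f : ℝ × ℝ → ℝ} (hf : IntegrableOn f Ω gamma2) :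
    ∫ z in Ω, f z ∂gamma2 = ∫ y, ∫ x in {x | (x, y) ∈ Ω}, f (x, y) ∂gamma1 ∂gamma1 := by
  rw [← integral_indicator hΩ, gamma2, integral_prod_symm _ ((integrable_indicator_iff hΩ).2 hf)]
  refine integral_congr_ae (Eventually.of_forall fun y => ?_)
  have hm : MeasurableSet {x | (x, y) ∈ Ω} := hΩ.preimage (by fun_prop)
  simp only
  rw [← integral_indicator hm]
  rfl

theorem integrable_slice_gamma2 (hΩ : MeasurableSet Ω) {f : ℝ × ℝ → ℝ}
    (hf : IntegrableOn f Ω gamma2) :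
    Integrable (fun y => ∫ x in {x | (x, y) ∈ Ω}, f (x, y) ∂gamma1) gamma1 := by
  have h1 := ((integrable_indicator_iff hΩ).2 hf)
  rw [gamma2] at h1
  refine h1.integral_prod_right.congr (Eventually.of_forall fun y => ?_)
  have hm : MeasurableSet {x | (x, y) ∈ Ω} := hΩ.preimage (by fun_prop)
  simp only
  rw [← integral_indicator hm]
  rfl

/-- Slicing reduces the planar inequality for odd functions to the interval. -/
theorem OddPoincare.integral_planar_le {a m : ℝ} (h : OddPoincare a m) (hm : 0 ≤ m) (ha : 0 < a)
    (ho : IsOpen Ω) (hc : Convex ℝ Ω) (hs : ∀ x y : ℝ, (x, y) ∈ Ω → (-x, y) ∈ Ω)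
    (hΩa : ∀ z ∈ Ω, z.1 ∈ Ioo (-a) a) {f : ℝ × ℝ → ℝ} (hf : ContDiff ℝ 1 f)
    (hodd : ∀ z, f (planeReflection z) = - f z)
    (hi : IntegrableOn (fun z => f z ^ 2) Ω gamma2)
    (hi' : IntegrableOn (fun z => fderiv ℝ f z (1, 0) ^ 2) Ω gamma2) :
    m * ∫ z in Ω, f z ^ 2 ∂gamma2 ≤ ∫ z in Ω, fderiv ℝ f z (1, 0) ^ 2 ∂gamma2 := by
  have hΩm := ho.measurableSet
  rw [setIntegral_gamma2_eq hΩm hi, setIntegral_gamma2_eq hΩm hi', ← integral_const_mul]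
  refine integral_mono ((integrable_slice_gamma2 hΩm hi).const_mul m)
    (integrable_slice_gamma2 hΩm hi') fun y => ?_
  have hcont : Continuous fun x : ℝ => (x, y) := by fun_prop
  obtain ⟨l, hl0, hla, hl⟩ := eq_Ioo_of_symmetric (S := {x | (x, y) ∈ Ω}) ha.le (ho.preimage hcont)
    (fun x hx x' hx' α β hα hβ hαβ => by
      have := hc hx hx' hα hβ hαβ
      simp only [Prod.smul_mk, Prod.mk_add_mk, ← add_smul, hαβ, one_smul] at this
      exact this)
    (fun x hx => hs x y hx) (fun x hx => hΩa _ hx)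
  simp only [hl]
  rcases hl0.eq_or_lt with rfl | hl0
  · simp
  · have hfy : ContDiff ℝ 1 fun x => f (x, y) := hf.comp (contDiff_id.prodMk contDiff_const)
    -- Oddness at every point makes `f` vanish on the axis, so the constant subtracted in the
    -- interval estimate is zero. An almost-everywhere condition would say nothing about this line.
    have h0 : f (0, y) = 0 := by
      have := hodd (0, y)
      simp only [planeReflection_apply, neg_zero] at this
      linarith
    have key := h.integral_Ioo_sub_le hm hl0 hla hfy
    simpa only [h0, sub_zero, deriv_slice (hf.differentiable one_ne_zero)] using key

/-- The planar inequality for odd Sobolev functions. -/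
theorem OddPoincare.integral_isH1Planar_le {a m : ℝ} (h : OddPoincare a m) (hm : 0 ≤ m) (ha : 0 < a)
    (ho : IsOpen Ω) (hne : Ω.Nonempty) (hc : Convex ℝ Ω) (hb : Bornology.IsBounded Ω)
    (hs : ∀ x y : ℝ, (x, y) ∈ Ω → (-x, y) ∈ Ω) (hΩa : ∀ z ∈ Ω, z.1 ∈ Ioo (-a) a)
    {u ux uy : ℝ × ℝ → ℝ} (hu : IsH1Planar Ω u ux uy)
    (hodd : ∀ᵐ z ∂(gamma2.restrict Ω), u (-z.1, z.2) = - u z) :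
    m * ∫ z in Ω, u z ^ 2 ∂gamma2 ≤ ∫ z in Ω, ux z ^ 2 ∂gamma2 := by
  have hdom := isReflectionDomain_planar ho hne hc hb hs
  have hw : IsWeakGradient Ω (Module.Basis.finTwoProd ℝ) u ![ux, uy] :=
    hdom.isWeakGradient_planar_iff.2 hu
  -- The symmetric mollifier turns almost-everywhere oddness of `u` into pointwise oddness of the
  -- smooth approximations.
  obtain ⟨η, hη, hησ⟩ := hdom.exists_mollifier
  obtain ⟨t, ht, hsm, h1, h2⟩ := hη.exists_smooth_approximation ho.measurableSet hc hb hw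
  set f : ℕ → ℝ × ℝ → ℝ := fun k => contractionAverage η (Ω.indicator u) (t k)
  have hf1 : ∀ k, ContDiff ℝ 1 (f k) := fun k => (hsm k).of_le (by simp)
  have hfw := fun k => hdom.isWeakGradient_planar_iff.1 (IsWeakGradient.of_contDiff hb (hf1 k))
  have h2' := h2 0
  simp only [Module.Basis.finTwoProd_zero, Matrix.cons_val_zero] at h2' hfw
  have hodd' : ∀ᵐ z ∂(volume.restrict Ω), u (planeReflection z) = - u z := by
    rw [← hdom.ae_eq]; exact hodd
  have t1 := tendsto_integral_sq_of_eLpNorm (fun k => (hfw k).memLp) hu.memLp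
    (hdom.tendsto_iff.2 h1)
  have t2 := tendsto_integral_sq_of_eLpNorm (fun k => (hfw k).memLp_x) hu.memLp_x
    (hdom.tendsto_iff.2 h2')
  refine le_of_tendsto_of_tendsto' (t1.const_mul m) t2 fun k => ?_
  exact h.integral_planar_le hm ha ho hc hs hΩa (hf1 k)
    (fun z => hdom.contractionAverage_odd hησ hodd' (ht k).1 z) (hfw k).memLp.integrable_sq
    (hfw k).memLp_x.integrable_sq

/-- The lowest odd Neumann eigenvalue of a symmetric planar convex domain in a strip exists and is
at least the odd Poincaré constant of the strip. -/
theorem OddPoincare.exists_isLeast_oddNeumannEigenvalues {a m : ℝ} (h : OddPoincare a m)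
    (hm : 0 ≤ m) (ha : 0 < a)
    (ho : IsOpen Ω) (hne : Ω.Nonempty) (hc : Convex ℝ Ω) (hb : Bornology.IsBounded Ω)
    (hs : ∀ x y : ℝ, (x, y) ∈ Ω → (-x, y) ∈ Ω) (hΩa : ∀ z ∈ Ω, z.1 ∈ Ioo (-a) a) :
    ∃ μ, IsLeast (oddNeumannEigenvalues Ω) μ ∧ m ≤ μ ∧
      ∀ v vx vy, IsH1Planar Ω v vx vy → (∀ᵐ z ∂(gamma2.restrict Ω), v (-z.1, z.2) = - v z) →
        μ * ∫ z in Ω, v z ^ 2 ∂gamma2 ≤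
          ∫ z in Ω, vx z ^ 2 ∂gamma2 + ∫ z in Ω, vy z ^ 2 ∂gamma2 := by
  have hdom := isReflectionDomain_planar ho hne hc hb hs
  obtain ⟨μ, u, g, hμ, hu, hodd, hn, heq, hlow⟩ := hdom.exists_odd_eigenfunction
    (hdom.exists_odd_ne_zero (ContinuousLinearMap.fst ℝ ℝ ℝ) (fun z => by simp) (e := (1, 0))
      (by simp))
  have hu' := hdom.isWeakGradient_planar_iff.1 hu
  have hlow' : ∀ v vx vy, IsH1Planar Ω v vx vy →
      (∀ᵐ z ∂(gamma2.restrict Ω), v (-z.1, z.2) = - v z) →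
        μ * ∫ z in Ω, v z ^ 2 ∂gamma2 ≤
          ∫ z in Ω, vx z ^ 2 ∂gamma2 + ∫ z in Ω, vy z ^ 2 ∂gamma2 := by
    intro v vx vy hv hvo
    have := hlow v ![vx, vy] (hdom.isWeakGradient_planar_iff.2 hv) hvo
    simpa [Fin.sum_univ_two] using this
  have hself : ∀ (ν : ℝ) (w wx wy : ℝ × ℝ → ℝ), IsH1Planar Ω w wx wy →
      ∫ z in Ω, (wx z * wx z + wy z * wy z) ∂gamma2 = ν * ∫ z in Ω, w z * w z ∂gamma2 →
      ∫ z in Ω, wx z ^ 2 ∂gamma2 + ∫ z in Ω, wy z ^ 2 ∂gamma2 =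
        ν * ∫ z in Ω, w z ^ 2 ∂gamma2 := by
    intro ν w wx wy hw he
    simp only [← pow_two] at he
    rw [← he, integral_add hw.memLp_x.integrable_sq hw.memLp_y.integrable_sq]
  have heq' : ∀ v vx vy, IsH1Planar Ω v vx vy →
      ∫ z in Ω, (g 0 z * vx z + g 1 z * vy z) ∂gamma2 = μ * ∫ z in Ω, u z * v z ∂gamma2 := by
    intro v vx vy hv
    rw [← heq v ![vx, vy] (hdom.isWeakGradient_planar_iff.2 hv), Fin.sum_univ_two,
      integral_add (integrable_mul_of_memLp_two hu'.memLp_x hv.memLp_x)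
        (integrable_mul_of_memLp_two hu'.memLp_y hv.memLp_y)]
    simp
  refine ⟨μ, ⟨⟨u, ⟨g 0, g 1, hu', hn, heq'⟩, hodd⟩, ?_⟩, ?_, hlow'⟩
  -- Tested against itself, an odd eigenfunction has its eigenvalue as Rayleigh quotient, which the
  -- minimum `μ` bounds from below.
  · rintro ν ⟨w, ⟨wx, wy, hw, hwn, hwe⟩, hwo⟩
    have h1 := hself ν w wx wy hw (hwe w wx wy hw)
    have h2 := hlow' w wx wy hw hwo
    rw [h1] at h2
    exact le_of_mul_le_mul_right h2 (integral_sq_pos_of_not_ae_zero hw.memLp hwn)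
  -- Slicing bounds `m ∫ u²` by the horizontal part of the energy; the vertical part is nonnegative
  -- and is dropped.
  · have h1 := hself μ u _ _ hu' (heq' u _ _ hu')
    have h2 := h.integral_isH1Planar_le hm ha ho hne hc hb hs hΩa hu' hodd
    have h3 : 0 ≤ ∫ z in Ω, g 1 z ^ 2 ∂gamma2 := integral_nonneg fun z => sq_nonneg _
    exact le_of_mul_le_mul_right (by linarith) (integral_sq_pos_of_not_ae_zero hu'.memLp hn)

end Planar

/-! ### Functions of `x` alone on a rectangle -/

section Rectangle

variable {I J : Set ℝ}

theorem tsupport_slice_left_subset (φ : ℝ × ℝ → ℝ) (y : ℝ) :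
    tsupport (fun x => φ (x, y)) ⊆ {x | (x, y) ∈ tsupport φ} :=
  tsupport_comp_subset_preimage φ (f := fun x : ℝ => (x, y)) (by fun_prop)

theorem tsupport_slice_right_subset (φ : ℝ × ℝ → ℝ) (x : ℝ) :
    tsupport (fun y => φ (x, y)) ⊆ {y | (x, y) ∈ tsupport φ} :=
  tsupport_comp_subset_preimage φ (f := fun y : ℝ => (x, y)) (by fun_prop)

theorem HasCompactSupport.slice_left {φ : ℝ × ℝ → ℝ} (h : HasCompactSupport φ) (y : ℝ) :
    HasCompactSupport fun x => φ (x, y) :=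
  HasCompactSupport.intro (h.isCompact.image continuous_fst) fun x hx =>
    image_eq_zero_of_notMem_tsupport fun hh => hx ⟨(x, y), hh, rfl⟩

theorem HasCompactSupport.slice_right {φ : ℝ × ℝ → ℝ} (h : HasCompactSupport φ) (x : ℝ) :
    HasCompactSupport fun y => φ (x, y) :=
  HasCompactSupport.intro (h.isCompact.image continuous_snd) fun y hy =>
    image_eq_zero_of_notMem_tsupport fun hh => hy ⟨(x, y), hh, rfl⟩

theorem fderiv_slice_left {φ : ℝ × ℝ → ℝ} (h : Differentiable ℝ φ) (x y : ℝ) :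
    fderiv ℝ (fun x => φ (x, y)) x 1 = fderiv ℝ φ (x, y) (1, 0) := by
  rw [fderiv_apply_one_eq_deriv, deriv_slice h]

theorem fderiv_slice_right {φ : ℝ × ℝ → ℝ} (h : Differentiable ℝ φ) (x y : ℝ) :
    fderiv ℝ (fun y => φ (x, y)) y 1 = fderiv ℝ φ (x, y) (0, 1) := by
  have h1 : HasDerivAt (fun y : ℝ => (x, y)) ((0 : ℝ), (1 : ℝ)) y :=
    (hasDerivAt_const y x).prodMk (hasDerivAt_id y)
  rw [fderiv_apply_one_eq_deriv]
  exact ((h (x, y)).hasFDerivAt.comp_hasDerivAt y h1).deriv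

theorem volume_restrict_prod (I J : Set ℝ) : (volume : Measure (ℝ × ℝ)).restrict (I ×ˢ J) =
    ((volume : Measure ℝ).restrict I).prod ((volume : Measure ℝ).restrict J) := by
  rw [Measure.volume_eq_prod, Measure.prod_restrict]

theorem gamma2_restrict_prod (I J : Set ℝ) : gamma2.restrict (I ×ˢ J) =
    (gamma1.restrict I).prod (gamma1.restrict J) := by
  rw [gamma2, Measure.prod_restrict]

/-- By Fubini it suffices to test on each horizontal line, where the slice of a test function is
again a test function on `I`. -/
theorem HasWeakDirDeriv.comp_fst {v dv : ℝ → ℝ} (hJ : MeasurableSet J)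
    (hJb : Bornology.IsBounded J)
    (hv : MemLp v 2 (volume.restrict I)) (hdv : MemLp dv 2 (volume.restrict I))
    (h : HasWeakDirDeriv I 1 v dv) :
    HasWeakDirDeriv (I ×ˢ J) ((1 : ℝ), (0 : ℝ)) (fun z => v z.1) (fun z => dv z.1) := by
  intro φ h1 h2 h3
  have hfin : IsFiniteMeasure ((volume : Measure ℝ).restrict J) :=
    ⟨by simpa using hJb.measure_lt_top⟩
  have m1 := memLp_of_continuous_of_hasCompactSupport h1.continuous h2 (I ×ˢ J)
  have m2 := memLp_fderiv_of_hasCompactSupport h1 h2 (I ×ˢ J) ((1 : ℝ), (0 : ℝ))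
  rw [volume_restrict_prod] at m1 m2 ⊢
  have i1 := integrable_mul_of_memLp_two (hv.comp_fst ((volume : Measure ℝ).restrict J)) m2
  have i2 := integrable_mul_of_memLp_two (hdv.comp_fst ((volume : Measure ℝ).restrict J)) m1
  rw [integral_prod_symm _ i1, integral_prod_symm _ i2, ← integral_neg]
  refine integral_congr_ae ?_
  filter_upwards [ae_restrict_mem hJ] with y hy
  have key := h (fun x => φ (x, y)) (h1.comp (contDiff_id.prodMk contDiff_const))
    (h2.slice_left y) fun x hx => (h3 (tsupport_slice_left_subset φ y hx)).1
  simpa only [fderiv_slice_left (h1.differentiable (by simp))] using key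

/-- On each vertical line `v` is a constant factor, and the derivative of a compactly supported test
function integrates to zero. -/
theorem HasWeakDirDeriv.comp_fst_vertical {v : ℝ → ℝ} (hI : MeasurableSet I)
    (hJb : Bornology.IsBounded J) (hv : MemLp v 2 (volume.restrict I)) :
    HasWeakDirDeriv (I ×ˢ J) ((0 : ℝ), (1 : ℝ)) (fun z => v z.1) (fun _ => 0) := by
  intro φ h1 h2 h3
  have hfin : IsFiniteMeasure ((volume : Measure ℝ).restrict J) :=
    ⟨by simpa using hJb.measure_lt_top⟩
  have m2 := memLp_fderiv_of_hasCompactSupport h1 h2 (I ×ˢ J) ((0 : ℝ), (1 : ℝ))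
  rw [volume_restrict_prod] at m2 ⊢
  have i1 := integrable_mul_of_memLp_two (hv.comp_fst ((volume : Measure ℝ).restrict J)) m2
  rw [integral_prod _ i1]
  simp only [zero_mul, integral_zero, neg_zero, integral_const_mul]
  refine integral_eq_zero_of_ae ?_
  filter_upwards [ae_restrict_mem hI] with x hx
  have key := HasWeakDirDeriv.of_contDiff (Ω := J) (e := (1 : ℝ))
    (contDiff_const (c := (1 : ℝ))) (fun y => φ (x, y))
    (h1.comp (contDiff_const.prodMk contDiff_id))
    (h2.slice_right x) fun y hy => (h3 (tsupport_slice_right_subset φ x hy)).2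
  simp only [fderiv_slice_right (h1.differentiable (by simp)), one_mul, fderiv_fun_const,
    Pi.zero_apply, zero_apply, zero_mul, integral_zero, neg_zero] at key
  simp [key]

theorem isH1Planar_comp_fst {a b : ℝ} (ha : 0 < a) {v dv : ℝ → ℝ} (h : IsH1Interval (-a) a v dv) :
    IsH1Planar (Ioo (-a) a ×ˢ Ioo (-b) b) (fun z => v z.1) (fun z => dv z.1) (fun _ => 0) := by
  have hw := (isWeakGradient_interval_iff ha (g := fun _ => dv)).2 h
  have hJ : Bornology.IsBounded (Ioo (-b) b) := Metric.isBounded_Ioo _ _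
  refine ⟨?_, ?_, MemLp.zero, ?_, ?_⟩
  · rw [gamma2_restrict_prod]; exact h.memLp.comp_fst _
  · rw [gamma2_restrict_prod]; exact h.memLp_deriv.comp_fst _
  · exact h.weakDeriv.comp_fst measurableSet_Ioo hJ hw.memLp (hw.memLp_grad ())
  · exact .comp_fst_vertical measurableSet_Ioo hJ hw.memLp

theorem integral_gamma2_comp_fst (f : ℝ → ℝ) :
    ∫ z in I ×ˢ J, f z.1 ∂gamma2 = gamma1.real J * ∫ x in I, f x ∂gamma1 := by
  rw [gamma2_restrict_prod, integral_fun_fst]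
  simp [Measure.real]

end Rectangle

/-! ### Identification of the constants and conclusion -/

theorem gamma1_real_Ioo_pos {b : ℝ} (hb : 0 < b) : 0 < gamma1.real (Ioo (-b) b) := by
  refine ENNReal.toReal_pos (fun h0 => ?_) (measure_ne_top _ _)
  have h1 := (isReflectionDomain_interval hb).ae_eq
  rw [Measure.restrict_eq_zero.2 h0, ae_zero, eq_comm, ae_eq_bot, Measure.restrict_eq_zero,
    Real.volume_Ioo] at h1
  simp only [ENNReal.ofReal_eq_zero] at h1
  linarith

theorem integral_eq_zero_of_odd {a : ℝ} {v : ℝ → ℝ}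
    (h : ∀ᵐ x ∂(gamma1.restrict (Ioo (-a) a)), v (-x) = - v x) :
    ∫ x in Ioo (-a) a, v x ∂gamma1 = 0 := by
  have h1 := integral_Ioo_comp_neg v a
  rw [integral_congr_ae h, integral_neg] at h1
  linarith

theorem isH1Interval_one {a : ℝ} (ha : 0 < a) :
    IsH1Interval (-a) a (fun _ => 1) (fun _ => 0) := by
  have := (isWeakGradient_interval_iff ha).1 (IsWeakGradient.of_contDiff
    (b := Module.Basis.singleton Unit ℝ) (Metric.isBounded_Ioo (-a) a)
    (contDiff_const (c := (1 : ℝ))))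
  simpa using this

theorem theorem1 (a : ℝ) (ha : 0 < a) :
    -- `μ₁(-a,a)` is an attained minimum, and is the first nontrivial Neumann eigenvalue
    IsLeast (rayleighQuotients (-a) a) (mu1 (-a) a) ∧
    IsLeast {μ : ℝ | IsNeumannEigenvalueInterval (-a) a μ ∧ μ ≠ 0} (mu1 (-a) a) ∧
    -- the lowest odd eigenvalue exists, and satisfies the estimate
    (∀ (Ω : Set (ℝ × ℝ)) (p q : ℝ → ℝ),
      IsOpen Ω → Ω.Nonempty → Convex ℝ Ω → Bornology.IsBounded Ω →
      (∀ x y : ℝ, (x, y) ∈ Ω → (-x, y) ∈ Ω) →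
      ConcaveOn ℝ (Ioo (-a) a) p → ConcaveOn ℝ (Ioo (-a) a) (fun x => - q x) →
      (∀ x ∈ Ioo (-a) a, p (-x) = p x) → (∀ x ∈ Ioo (-a) a, q (-x) = q x) →
      Ω = {z : ℝ × ℝ | z.1 ∈ Ioo (-a) a ∧ q z.1 < z.2 ∧ z.2 < p z.1} →
      IsLeast (oddNeumannEigenvalues Ω) (mu1Odd Ω) ∧ mu1 (-a) a ≤ mu1Odd Ω) ∧
    -- equality for rectangles
    (∀ b : ℝ, 0 < b → mu1Odd (Ioo (-a) a ×ˢ Ioo (-b) b) = mu1 (-a) a) := by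
  obtain ⟨m, v, dv, hm, hv, hvo, hvn, hve, hP⟩ := exists_odd_eigenfunction_interval ha
  have hpos := integral_sq_pos_of_not_ae_zero hv.memLp hvn
  have hself : ∫ x in Ioo (-a) a, dv x ^ 2 ∂gamma1 = m * ∫ x in Ioo (-a) a, v x ^ 2 ∂gamma1 := by
    simpa only [← pow_two] using hve v dv hv
  have hR : IsLeast (rayleighQuotients (-a) a) m := by
    -- The odd minimiser has mean zero, so it competes in the larger class; the mean-zero Poincaré
    -- inequality shows that nothing there does better.
    refine ⟨⟨v, dv, hv, hvn, integral_eq_zero_of_odd hvo, ?_⟩, ?_⟩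
    · rw [hself, mul_div_cancel_right₀ _ hpos.ne']
    · rintro r ⟨z, dz, hz, hzn, hz0, rfl⟩
      rw [le_div_iff₀ (integral_sq_pos_of_not_ae_zero hz.memLp hzn)]
      exact hP.integral_sq_le_of_integral_eq_zero hm.le ha hz hz0
  have hmu : mu1 (-a) a = m := hR.csInf_eq
  rw [hmu]
  refine ⟨hR, ⟨⟨⟨v, dv, hv, hvn, hve⟩, hm.ne'⟩, ?_⟩, ?_, ?_⟩
  · rintro ν ⟨⟨z, dz, hz, hzn, hze⟩, hν⟩
    -- Testing with the constant `1` shows that an eigenfunction with nonzero eigenvalue has mean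
    -- zero.
    have h1 := hze _ _ (isH1Interval_one ha)
    simp only [mul_zero, integral_zero, mul_one] at h1
    have hz0 := (mul_eq_zero.1 h1.symm).resolve_left hν
    have h2 := hze z dz hz
    simp only [← pow_two] at h2
    have h3 := hP.integral_sq_le_of_integral_eq_zero hm.le ha hz hz0
    rw [h2] at h3
    exact le_of_mul_le_mul_right h3 (integral_sq_pos_of_not_ae_zero hz.memLp hzn)
  · intro Ω p q ho hne hc hb hs _ _ _ _ hΩ
    have hΩa : ∀ z ∈ Ω, z.1 ∈ Ioo (-a) a := fun z hz => by
      rw [hΩ] at hz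
      exact hz.1
    obtain ⟨μ, hμ, hle, -⟩ := hP.exists_isLeast_oddNeumannEigenvalues hm.le ha ho hne hc hb hs hΩa
    have he : mu1Odd Ω = μ := hμ.csInf_eq
    rw [he]
    exact ⟨hμ, hle⟩
  · intro b hb
    have hs : ∀ x y : ℝ, (x, y) ∈ Ioo (-a) a ×ˢ Ioo (-b) b →
        (-x, y) ∈ Ioo (-a) a ×ˢ Ioo (-b) b := fun x y h =>
      ⟨⟨by linarith [h.1.2], by linarith [h.1.1]⟩, h.2⟩
    obtain ⟨μ, hμ, hle, hlow⟩ := hP.exists_isLeast_oddNeumannEigenvalues hm.le ha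
      (isOpen_Ioo.prod isOpen_Ioo) ⟨(0, 0), by simp [ha, hb]⟩
      ((convex_Ioo (-a) a).prod (convex_Ioo (-b) b))
      ((Metric.isBounded_Ioo _ _).prod (Metric.isBounded_Ioo _ _)) hs (fun z hz => hz.1)
    have he : mu1Odd (Ioo (-a) a ×ˢ Ioo (-b) b) = μ := hμ.csInf_eq
    rw [he]
    refine le_antisymm ?_ hle
    have hodd : ∀ᵐ z ∂(gamma2.restrict (Ioo (-a) a ×ˢ Ioo (-b) b)),
        (fun z : ℝ × ℝ => v z.1) (-z.1, z.2) = - (fun z : ℝ × ℝ => v z.1) z := by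
      rw [gamma2_restrict_prod]
      exact Measure.quasiMeasurePreserving_fst.ae hvo
    -- The one-dimensional eigenfunction, constant in `y`, is an odd competitor with Rayleigh
    -- quotient `m`: the Gaussian mass of `(-b, b)` is a common positive factor and cancels.
    have h1 := hlow _ _ _ (isH1Planar_comp_fst ha hv) hodd
    simp only [ne_eq, OfNat.ofNat_ne_zero, not_false_eq_true, zero_pow, integral_zero,
      add_zero] at h1
    rw [integral_gamma2_comp_fst (fun x => v x ^ 2), integral_gamma2_comp_fst (fun x => dv x ^ 2),
      hself] at h1
    have hB := mul_pos (gamma1_real_Ioo_pos hb) hpos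
    refine le_of_mul_le_mul_right (h1.trans (le_of_eq ?_)) hB
    ring
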